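/- Let $k$ be a field, let $G$ be a Hopf algebra over $k$ with bijective antipode $S$, and let $\mathcal C={}^G_G\mathcal{YD}$ be the category of (left-left) Yetter–Drinfeld modules over $G$, i.e. left $G$-modules and left $G$-comodules $V$ with $h_{(1)}v_{(-1)}\otimes h_{(2)}v_{(0)}=(h_{(1)}v)_{(-1)}h_{(2)}\otimes (h_{(1)}v)_{(0)}$, with tensor product over $k$ (diagonal action, codiagonal coaction), unit object $I=k$ and braiding $c(v\otimes w)=v_{(-1)}w\otimes v_{(0)}$. Let $R$ be a bialgebra in the braided category $\mathcal C$, with counit $\varepsilon$, and assume that $G$ or $R$ is finite dimensional over $k$. For objects $V,Y$ of $\mathcal C$, an inner hom object $\hom(V,Y)$ is an object with a morphism $\mathrm{ev}:\hom(V,Y)\otimes V\to Y$ that induces bijections $\mathcal C(X,\hom(V,Y))\cong\mathcal C(X\otimes V,Y)$ for all $X$. Let $\partial=\sum_{i=0}^{n+1}(-1)^i\partial_i:R^{\otimes (n+1)}\to R^{\otimes n}$, where $\partial_0=\varepsilon\otimes 1$, $\partial_{n+1}=1\otimes\varepsilon$, and $\partial_i$ multiplies the $i$-th and $(i+1)$-st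 factors for $0<i<n+1$. Then: 1. The inner hom objects $\hom(R^{\otimes n},I)$ exist in $\mathcal C$ for all $n\ge 0$. 2. For every choice of these objects, let $\mathrm H^n(R)\in\mathcal C$ be the cohomology of the cochain complex $\hom(R^{\otimes n},I)$ with differential induced by $\partial$ (the Hochschild cohomology of $R$ in $\mathcal C$). The cup product, induced by the morphisms $\hom(R^{\otimes m},I)\otimes\hom(R^{\otimes n},I)\to\hom(R^{\otimes n}\otimes R^{\otimes m},I)=\hom(R^{\otimes (m+n)},I)$ which evaluate the inner factors first, is well defined on cohomology and makes $\mathrm H^*(R)$ a unital associative $\mathbb N$-graded algebra in $\mathcal C$. This algebra is braided graded commutative: its multiplication $\mu$ satisfies $\mu\circ c_{\mathrm{gr}}=\mu$, where $c_{\mathrm{gr}}=(-1)^{mn}c$ on $\mathrm H^m(R)\otimes \mathrm H^n(R)$. 3. Let $\mathrm H^n(R,k)$ be the ordinary Hochschild cohomology of the augmented algebra $R$ with trivial coefficients, i.e. the cohomology of $\mathrm{Hom}_k(R^{\otimes n},k)$ with differential $f\mapsto f\circ\partial$. The Yetter–Drinfeld structure of $R$ induces one on $\mathrm H^n(R,k)$: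 at the level of cochains it is given by $(gf)(v)=f(S(g)v)$ and $f_{(-1)}f_{(0)}(v)=S^{-1}(v_{(-1)})f(v_{(0)})$ for $v\in R^{\otimes n}$. With this structure and the opposite $f\cdot g=g\cup f$ of the usual cup product $(f\cup g)(x\otimes y)=f(x)g(y)$, $\mathrm H^*(R,k)$ is a graded algebra in $\mathcal C$ (a Yetter–Drinfeld module algebra) that is braided graded commutative in the same sense. Moreover, for every choice of inner hom objects, $z\mapsto \mathrm{ev}(z\otimes -)$ induces an isomorphism of graded algebras in $\mathcal C$ from $\mathrm H^*(R)$ to this algebra. -/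

import Mathlib

open scoped TensorProduct

universe u

/-! ### Yetter–Drinfeld modules -/

/-- A (left-left) Yetter–Drinfeld structure over the Hopf algebra `G` on the vector space `V`:
a left `G`-module and left `G`-comodule structure such that
`h₍₁₎ v₍₋₁₎ ⊗ h₍₂₎ v₍₀₎ = (h₍₁₎ v)₍₋₁₎ h₍₂₎ ⊗ (h₍₁₎ v)₍₀₎`. -/
structure YDStruct (k G V : Type u) [Field k] [Ring G] [HopfAlgebra k G]
    [AddCommGroup V] [Module k V] where
  act : G →ₐ[k] Module.End k V
  coact : V →ₗ[k] G ⊗[k] V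
  coassoc : ∀ v, TensorProduct.assoc k G G V ((Coalgebra.comul (R := k)).rTensor V (coact v)) =
    coact.lTensor G (coact v)
  counit_coact : ∀ v,
    TensorProduct.lid k V ((Coalgebra.counit (R := k) (A := G)).rTensor V (coact v)) = v
  compat : ∀ (h : G) (v : V),
    TensorProduct.map (LinearMap.mul' k G) (TensorProduct.lift act.toLinearMap)
      (TensorProduct.tensorTensorTensorComm k G G G V (Coalgebra.comul (R := k) h ⊗ₜ coact v)) =
    (LinearMap.mul' k G).rTensor V (TensorProduct.rightComm k G V G
      ((coact ∘ₗ act.toLinearMap.flip v).rTensor G (Coalgebra.comul (R := k) h)))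

/-- A Yetter–Drinfeld module over `G`. -/
structure YDModule (k G : Type u) [Field k] [Ring G] [HopfAlgebra k G] where
  carrier : Type u
  [addCommGroup : AddCommGroup carrier]
  [module : Module k carrier]
  str : YDStruct k G carrier

namespace YDModule

attribute [instance] YDModule.addCommGroup YDModule.module

variable {k G : Type u} [Field k] [Ring G] [HopfAlgebra k G]

instance : CoeSort (YDModule k G) (Type u) := ⟨YDModule.carrier⟩

/-- The action of `G`. -/
abbrev act (V : YDModule k G) : G →ₐ[k] Module.End k V := V.str.act

/-- The coaction of `G`. -/
abbrev coact (V : YDModule k G) : V →ₗ[k] G ⊗[k] V := V.str.coact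

/-- Morphisms of Yetter–Drinfeld modules: `G`-linear and `G`-colinear maps. -/
structure IsHom (V W : YDModule k G) (f : V →ₗ[k] W) : Prop where
  map_act : ∀ (g : G) (v : V), f (V.act g v) = W.act g (f v)
  map_coact : ∀ v : V, W.coact (f v) = f.lTensor G (V.coact v)

/-- The unit object: `k` with trivial action and coaction. -/
abbrev unit (k G : Type u) [Field k] [Ring G] [HopfAlgebra k G] : YDModule k G where
  carrier := k
  str :=
    { act := (Algebra.ofId k (Module.End k k)).comp (Bialgebra.counitAlgHom k G)
      coact := TensorProduct.mk k G k 1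
      coassoc := fun v => by
        simp [Bialgebra.comul_one, Algebra.TensorProduct.one_def]
      counit_coact := fun v => by simp
      compat := fun h v => by
        have key : ∀ x : G ⊗[k] G, ∀ c : k,
            TensorProduct.map (LinearMap.mul' k G) (TensorProduct.lift
              ((Algebra.ofId k (Module.End k k)).comp (Bialgebra.counitAlgHom k G)).toLinearMap)
              (TensorProduct.tensorTensorTensorComm k G G G k (x ⊗ₜ ((1 : G) ⊗ₜ c))) =
            (TensorProduct.rid k G ((Coalgebra.counit (R := k) (A := G)).lTensor G x)) ⊗ₜ c := by
          intro x c
          induction x with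
          | zero => simp
          | add x y hx hy => simp only [TensorProduct.add_tmul, map_add, hx, hy]
          | tmul a b =>
            simp [Algebra.ofId_apply, Algebra.algebraMap_eq_smul_one, TensorProduct.smul_tmul]
        have key' : ∀ x : G ⊗[k] G, ∀ c : k,
            (LinearMap.mul' k G).rTensor k (TensorProduct.rightComm k G k G
              ((TensorProduct.mk k G k 1 ∘ₗ ((Algebra.ofId k (Module.End k k)).comp
                (Bialgebra.counitAlgHom k G)).toLinearMap.flip c).rTensor G x)) =
            (TensorProduct.lid k G ((Coalgebra.counit (R := k) (A := G)).rTensor G x)) ⊗ₜ c := by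
          intro x c
          induction x with
          | zero => simp
          | add x y hx hy => simp only [TensorProduct.add_tmul, map_add, hx, hy]
          | tmul a b =>
            simp [Algebra.ofId_apply, Algebra.algebraMap_eq_smul_one, TensorProduct.smul_tmul]
        rw [TensorProduct.mk_apply, key, key']
        simp }

/-- The codiagonal map `(a ⊗ v) ⊗ (b ⊗ w) ↦ ab ⊗ (v ⊗ w)`. -/
def codiag (k G V W : Type u) [Field k] [Ring G] [HopfAlgebra k G]
    [AddCommGroup V] [Module k V] [AddCommGroup W] [Module k W] :
    (G ⊗[k] V) ⊗[k] (G ⊗[k] W) →ₗ[k] G ⊗[k] (V ⊗[k] W) :=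
  (LinearMap.mul' k G).rTensor (V ⊗[k] W) ∘ₗ
    (TensorProduct.tensorTensorTensorComm k G V G W).toLinearMap

@[simp] theorem codiag_tmul {V W : Type u} [AddCommGroup V] [Module k V] [AddCommGroup W]
    [Module k W] (a b : G) (v : V) (w : W) :
    codiag k G V W ((a ⊗ₜ v) ⊗ₜ (b ⊗ₜ w)) = (a * b) ⊗ₜ (v ⊗ₜ w) := by
  simp [codiag]

section tensor

variable {V W : Type u} [AddCommGroup V] [Module k V] [AddCommGroup W] [Module k W]

/-- The diagonal action `h (v ⊗ w) = h₍₁₎ v ⊗ h₍₂₎ w`. -/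
def tensorAct (S : YDStruct k G V) (T : YDStruct k G W) :
    G →ₐ[k] Module.End k (V ⊗[k] W) :=
  (Module.endTensorEndAlgHom (R := k) (S := k) (A := k) (M := V) (N := W)).comp
    ((Algebra.TensorProduct.map S.act T.act).comp (Bialgebra.comulAlgHom k G))

/-- The codiagonal coaction `v ⊗ w ↦ v₍₋₁₎ w₍₋₁₎ ⊗ (v₍₀₎ ⊗ w₍₀₎)`. -/
def tensorCoact (S : YDStruct k G V) (T : YDStruct k G W) :
    V ⊗[k] W →ₗ[k] G ⊗[k] (V ⊗[k] W) :=
  codiag k G V W ∘ₗ TensorProduct.map S.coact T.coact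

theorem tensorAct_apply (S : YDStruct k G V) (T : YDStruct k G W) (h : G) :
    tensorAct S T h =
      TensorProduct.homTensorHomMap (RingHom.id k) V W V W
        (TensorProduct.map S.act.toLinearMap T.act.toLinearMap (Coalgebra.comul (R := k) h)) := by
  have key : ∀ x : G ⊗[k] G,
      (Module.endTensorEndAlgHom (R := k) (S := k) (A := k) (M := V) (N := W))
        (Algebra.TensorProduct.map S.act T.act x) = TensorProduct.homTensorHomMap (RingHom.id k) V W V W
        (TensorProduct.map S.act.toLinearMap T.act.toLinearMap x) := by
    intro x
    induction x with
    | zero => simp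
    | add x y hx hy => simp only [map_add, hx, hy]
    | tmul a b => ext; simp [Module.endTensorEndAlgHom_apply]
  exact key _

theorem tensorCoact_tmul (S : YDStruct k G V) (T : YDStruct k G W) (v : V) (w : W) :
    tensorCoact S T (v ⊗ₜ w) = codiag k G V W (S.coact v ⊗ₜ T.coact w) := rfl

theorem tensor_coassoc (S : YDStruct k G V) (T : YDStruct k G W) (x : V ⊗[k] W) :
    TensorProduct.assoc k G G (V ⊗[k] W)
      ((Coalgebra.comul (R := k)).rTensor (V ⊗[k] W) (tensorCoact S T x)) =
    (tensorCoact S T).lTensor G (tensorCoact S T x) := by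
  let N : (G ⊗[k] (G ⊗[k] V)) ⊗[k] (G ⊗[k] (G ⊗[k] W)) →ₗ[k] G ⊗[k] (G ⊗[k] (V ⊗[k] W)) :=
    (codiag k G V W).lTensor G ∘ₗ codiag k G (G ⊗[k] V) (G ⊗[k] W)
  have hmul : ∀ (y z : G ⊗[k] G) (v : V) (w : W),
      TensorProduct.assoc k G G (V ⊗[k] W) ((y * z) ⊗ₜ (v ⊗ₜ w)) =
        N (TensorProduct.assoc k G G V (y ⊗ₜ v) ⊗ₜ TensorProduct.assoc k G G W (z ⊗ₜ w)) := by
    intro y z v w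
    induction y with
    | zero => simp
    | add a b ha hb => simp only [add_mul, TensorProduct.add_tmul, map_add, ha, hb]
    | tmul a b =>
      induction z with
      | zero => simp
      | add a b ha hb =>
        simp only [mul_add, TensorProduct.add_tmul, TensorProduct.tmul_add, map_add, ha, hb]
      | tmul c d => simp [N]
  have h1 : ∀ (p : G ⊗[k] V) (q : G ⊗[k] W),
      TensorProduct.assoc k G G (V ⊗[k] W)
        ((Coalgebra.comul (R := k)).rTensor (V ⊗[k] W) (codiag k G V W (p ⊗ₜ q))) =
      N (TensorProduct.assoc k G G V ((Coalgebra.comul (R := k)).rTensor V p) ⊗ₜ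
        TensorProduct.assoc k G G W ((Coalgebra.comul (R := k)).rTensor W q)) := by
    intro p q
    induction p with
    | zero => simp
    | add a b ha hb => simp only [TensorProduct.add_tmul, map_add, ha, hb]
    | tmul a v =>
      induction q with
      | zero => simp
      | add a b ha hb => simp only [TensorProduct.tmul_add, map_add, ha, hb]
      | tmul b w => simp only [codiag_tmul, LinearMap.rTensor_tmul, Bialgebra.comul_mul, hmul]
  have h2 : ∀ (p : G ⊗[k] V) (q : G ⊗[k] W),
      (tensorCoact S T).lTensor G (codiag k G V W (p ⊗ₜ q)) =
      N (S.coact.lTensor G p ⊗ₜ T.coact.lTensor G q) := by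
    intro p q
    induction p with
    | zero => simp
    | add a b ha hb => simp only [TensorProduct.add_tmul, map_add, ha, hb]
    | tmul a v =>
      induction q with
      | zero => simp
      | add a b ha hb => simp only [TensorProduct.tmul_add, map_add, ha, hb]
      | tmul b w => simp [N, tensorCoact_tmul]
  induction x with
  | zero => simp
  | add a b ha hb => simp only [map_add, ha, hb]
  | tmul v w => rw [tensorCoact_tmul, h1, h2, S.coassoc, T.coassoc]

theorem tensor_counit (S : YDStruct k G V) (T : YDStruct k G W) (x : V ⊗[k] W) :
    TensorProduct.lid k (V ⊗[k] W)
      ((Coalgebra.counit (R := k) (A := G)).rTensor (V ⊗[k] W) (tensorCoact S T x)) = x := by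
  have h1 : ∀ (p : G ⊗[k] V) (q : G ⊗[k] W),
      TensorProduct.lid k (V ⊗[k] W)
        ((Coalgebra.counit (R := k) (A := G)).rTensor (V ⊗[k] W) (codiag k G V W (p ⊗ₜ q))) =
      TensorProduct.lid k V ((Coalgebra.counit (R := k) (A := G)).rTensor V p) ⊗ₜ
        TensorProduct.lid k W ((Coalgebra.counit (R := k) (A := G)).rTensor W q) := by
    intro p q
    induction p with
    | zero => simp
    | add a b ha hb => simp only [TensorProduct.add_tmul, map_add, ha, hb]
    | tmul a v =>
      induction q with
      | zero => simp
      | add a b ha hb => simp only [TensorProduct.tmul_add, map_add, ha, hb]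
      | tmul b w =>
        simp only [codiag_tmul, LinearMap.rTensor_tmul, Bialgebra.counit_mul,
          TensorProduct.lid_tmul]
        rw [TensorProduct.smul_tmul_smul]
  induction x with
  | zero => simp
  | add a b ha hb => simp only [map_add, ha, hb]
  | tmul v w => rw [tensorCoact_tmul, h1, S.counit_coact, T.counit_coact]

/-- `(a ⊗ b) ⊗ (g ⊗ v) ↦ ag ⊗ bv`. -/
def leftMul (S : YDStruct k G V) : G ⊗[k] G →ₗ[k] G ⊗[k] V →ₗ[k] G ⊗[k] V :=
  TensorProduct.curry (TensorProduct.map (LinearMap.mul' k G)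
    (TensorProduct.lift S.act.toLinearMap) ∘ₗ
      (TensorProduct.tensorTensorTensorComm k G G G V).toLinearMap)

/-- `a ⊗ b ↦ (a v)₍₋₁₎ b ⊗ (a v)₍₀₎`. -/
def rightMul (S : YDStruct k G V) (v : V) : G ⊗[k] G →ₗ[k] G ⊗[k] V :=
  (LinearMap.mul' k G).rTensor V ∘ₗ (TensorProduct.rightComm k G V G).toLinearMap ∘ₗ
    (S.coact ∘ₗ S.act.toLinearMap.flip v).rTensor G

theorem leftMul_tmul (S : YDStruct k G V) (a b g : G) (v : V) :
    leftMul S (a ⊗ₜ b) (g ⊗ₜ v) = (a * g) ⊗ₜ S.act b v := by simp [leftMul]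

theorem rightMul_tmul (S : YDStruct k G V) (a b : G) (v : V) :
    rightMul S v (a ⊗ₜ b) =
      (LinearMap.mulRight k b).rTensor V (S.coact (S.act a v)) := by
  have : ∀ p : G ⊗[k] V, (LinearMap.mul' k G).rTensor V (TensorProduct.rightComm k G V G
      (p ⊗ₜ b)) = (LinearMap.mulRight k b).rTensor V p := by
    intro p
    induction p with
    | zero => simp
    | add a b ha hb => simp only [TensorProduct.add_tmul, map_add, ha, hb]
    | tmul a v => simp
  simp [rightMul, this]

theorem leftMul_comul (S : YDStruct k G V) (h : G) (v : V) :
    leftMul S (Coalgebra.comul (R := k) h) (S.coact v) =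
      rightMul S v (Coalgebra.comul (R := k) h) := S.compat h v

theorem tensor_compat (S : YDStruct k G V) (T : YDStruct k G W) (h : G) (x : V ⊗[k] W) :
    TensorProduct.map (LinearMap.mul' k G) (TensorProduct.lift (tensorAct S T).toLinearMap)
      (TensorProduct.tensorTensorTensorComm k G G G (V ⊗[k] W)
        (Coalgebra.comul (R := k) h ⊗ₜ tensorCoact S T x)) =
    (LinearMap.mul' k G).rTensor (V ⊗[k] W) (TensorProduct.rightComm k G (V ⊗[k] W) G
      ((tensorCoact S T ∘ₗ (tensorAct S T).toLinearMap.flip x).rTensor G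
        (Coalgebra.comul (R := k) h))) := by
  let F : G ⊗[k] V → G ⊗[k] W → (G ⊗[k] G) ⊗[k] G →ₗ[k] G ⊗[k] (V ⊗[k] W) := fun p q =>
    codiag k G V W ∘ₗ TensorProduct.map ((leftMul S).flip p)
      (((LinearMap.lTensorHom G).comp T.act.toLinearMap).flip q)
  let K : V → W → (G ⊗[k] (G ⊗[k] G)) →ₗ[k] G ⊗[k] (V ⊗[k] W) := fun v w =>
    codiag k G V W ∘ₗ TensorProduct.map (S.coact ∘ₗ S.act.toLinearMap.flip v)
      (rightMul T w)
  have e1 : ∀ (y : G ⊗[k] G) (p : G ⊗[k] V) (q : G ⊗[k] W),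
      TensorProduct.map (LinearMap.mul' k G) (TensorProduct.lift (tensorAct S T).toLinearMap)
        (TensorProduct.tensorTensorTensorComm k G G G (V ⊗[k] W)
          (y ⊗ₜ codiag k G V W (p ⊗ₜ q))) =
      F p q ((TensorProduct.assoc k G G G).symm ((Coalgebra.comul (R := k)).lTensor G y)) := by
    intro y p q
    induction y with
    | zero => simp
    | add a b ha hb => simp only [TensorProduct.add_tmul, map_add, ha, hb]
    | tmul a b =>
      induction p with
      | zero => simp [F]
      | add c d hc hd =>
        have : F (c + d) q = F c q + F d q := by
          ext; simp [F, TensorProduct.add_tmul]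
        simp only [TensorProduct.add_tmul, TensorProduct.tmul_add, map_add, hc, hd, this,
          LinearMap.add_apply]
      | tmul g v =>
        induction q with
        | zero => simp [F]
        | add c d hc hd =>
          have : F (g ⊗ₜ v) (c + d) = F (g ⊗ₜ v) c + F (g ⊗ₜ v) d := by
            ext; simp [F, TensorProduct.tmul_add]
          simp only [TensorProduct.tmul_add, map_add, hc, hd, this, LinearMap.add_apply]
        | tmul g' w =>
          simp only [codiag_tmul, TensorProduct.tensorTensorTensorComm_tmul,
            TensorProduct.map_tmul, LinearMap.mul'_apply, TensorProduct.lift.tmul,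
            AlgHom.toLinearMap_apply, tensorAct_apply, LinearMap.lTensor_tmul]
          generalize (Coalgebra.comul (R := k) b : G ⊗[k] G) = z
          induction z with
          | zero => simp
          | add c d hc hd =>
            simp only [TensorProduct.tmul_add, map_add, LinearMap.add_apply, hc, hd]
          | tmul c d => simp [F, leftMul_tmul, mul_assoc]
  have e3 : ∀ (z : G ⊗[k] G) (c : G) (v : V) (q : G ⊗[k] W),
      codiag k G V W (rightMul S v z ⊗ₜ (T.act c).lTensor G q) =
      codiag k G V W (TensorProduct.map (S.coact ∘ₗ S.act.toLinearMap.flip v)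
        ((leftMul T).flip q) (TensorProduct.assoc k G G G (z ⊗ₜ c))) := by
    intro z c v q
    induction z with
    | zero => simp
    | add a b ha hb => simp only [TensorProduct.add_tmul, map_add, ha, hb]
    | tmul a b =>
      simp only [rightMul_tmul, TensorProduct.assoc_tmul, TensorProduct.map_tmul,
        LinearMap.comp_apply, LinearMap.flip_apply, AlgHom.toLinearMap_apply]
      generalize S.coact (S.act a v) = p
      induction p with
      | zero => simp
      | add a b ha hb => simp only [TensorProduct.add_tmul, map_add, ha, hb]
      | tmul g v =>
        induction q with
        | zero => simp
        | add a b ha hb => simp only [TensorProduct.tmul_add, map_add, ha, hb]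
        | tmul g' w => simp [leftMul_tmul, mul_assoc]
  have e4 : ∀ (y : G ⊗[k] G) (v : V) (w : W),
      F (S.coact v) (T.coact w) ((Coalgebra.comul (R := k)).rTensor G y) =
      codiag k G V W (TensorProduct.map (S.coact ∘ₗ S.act.toLinearMap.flip v)
        ((leftMul T).flip (T.coact w)) (TensorProduct.assoc k G G G
          ((Coalgebra.comul (R := k)).rTensor G y))) := by
    intro y v w
    induction y with
    | zero => simp
    | add a b ha hb => simp only [map_add, ha, hb]
    | tmul a b =>
      rw [LinearMap.rTensor_tmul, ← e3, ← leftMul_comul]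
      simp [F]
  have e5 : ∀ (y : G ⊗[k] G) (v : V) (w : W),
      codiag k G V W (TensorProduct.map (S.coact ∘ₗ S.act.toLinearMap.flip v)
        ((leftMul T).flip (T.coact w)) ((Coalgebra.comul (R := k)).lTensor G y)) =
      K v w ((Coalgebra.comul (R := k)).lTensor G y) := by
    intro y v w
    induction y with
    | zero => simp
    | add a b ha hb => simp only [map_add, ha, hb]
    | tmul a b => simp [K, leftMul_comul]
  have e6 : ∀ (y : G ⊗[k] G) (v : V) (w : W),
      K v w (TensorProduct.assoc k G G G ((Coalgebra.comul (R := k)).rTensor G y)) =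
      (LinearMap.mul' k G).rTensor (V ⊗[k] W) (TensorProduct.rightComm k G (V ⊗[k] W) G
      ((tensorCoact S T ∘ₗ (tensorAct S T).toLinearMap.flip (v ⊗ₜ w)).rTensor G y)) := by
    intro y v w
    induction y with
    | zero => simp
    | add a b ha hb => simp only [map_add, ha, hb]
    | tmul a b =>
      simp only [LinearMap.rTensor_tmul, LinearMap.comp_apply, LinearMap.flip_apply,
        AlgHom.toLinearMap_apply, tensorAct_apply]
      generalize (Coalgebra.comul (R := k) a : G ⊗[k] G) = z
      induction z with
      | zero => simp
      | add c d hc hd =>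
        simp only [TensorProduct.add_tmul, map_add, LinearMap.add_apply, hc, hd]
      | tmul c d =>
        simp only [K, TensorProduct.assoc_tmul, TensorProduct.map_tmul, LinearMap.comp_apply,
          LinearMap.flip_apply, AlgHom.toLinearMap_apply, rightMul_tmul,
          TensorProduct.homTensorHomMap_apply, tensorCoact_tmul]
        generalize S.coact (S.act c v) = p
        generalize T.coact (T.act d w) = q
        induction p with
        | zero => simp
        | add a b ha hb => simp only [TensorProduct.add_tmul, map_add, ha, hb]
        | tmul g v =>
          induction q with
          | zero => simp
          | add a b ha hb =>
            simp only [TensorProduct.tmul_add, TensorProduct.add_tmul, map_add, ha, hb]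
          | tmul g' w => simp [mul_assoc]
  induction x with
  | zero => simp
  | add a b ha hb =>
    simp only [TensorProduct.tmul_add, map_add, LinearMap.comp_add, LinearMap.rTensor_add,
      LinearMap.add_apply, ha, hb]
  | tmul v w =>
    rw [tensorCoact_tmul, e1, Coalgebra.coassoc_symm_apply, e4, Coalgebra.coassoc_apply, e5,
      ← Coalgebra.coassoc_apply, e6]

end tensor

/-- The tensor product of two Yetter–Drinfeld modules. -/
abbrev tensor (V W : YDModule k G) : YDModule k G where
  carrier := V ⊗[k] W
  str :=
    { act := tensorAct V.str W.str
      coact := tensorCoact V.str W.str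
      coassoc := tensor_coassoc V.str W.str
      counit_coact := tensor_counit V.str W.str
      compat := tensor_compat V.str W.str }

/-- The braiding `v ⊗ w ↦ v₍₋₁₎ w ⊗ v₍₀₎`. -/
def braiding (V W : YDModule k G) : V ⊗[k] W →ₗ[k] W ⊗[k] V :=
  (TensorProduct.lift W.act.toLinearMap).rTensor V ∘ₗ
    (TensorProduct.rightComm k G V W).toLinearMap ∘ₗ V.coact.rTensor W

/-- The map `1 ⊗ c ⊗ 1 : A ⊗ B ⊗ C ⊗ D → A ⊗ C ⊗ B ⊗ D` given by the braiding `c` of `B, C`. -/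
def interchange (A B C D : YDModule k G) :
    (A ⊗[k] B) ⊗[k] (C ⊗[k] D) →ₗ[k] (A ⊗[k] C) ⊗[k] (B ⊗[k] D) :=
  (TensorProduct.assoc k A C (B ⊗[k] D)).symm.toLinearMap ∘ₗ
    ((TensorProduct.assoc k C B D).toLinearMap ∘ₗ (braiding B C).rTensor D ∘ₗ
      (TensorProduct.assoc k B C D).symm.toLinearMap).lTensor A ∘ₗ
    (TensorProduct.assoc k A B (C ⊗[k] D)).toLinearMap

/-! ### Morphisms -/

namespace IsHom

theorem id (V : YDModule k G) : IsHom V V LinearMap.id := ⟨fun _ _ => rfl, fun v => by simp⟩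

theorem comp {U V W : YDModule k G} {g : V →ₗ[k] W} {f : U →ₗ[k] V} (hg : IsHom V W g)
    (hf : IsHom U V f) : IsHom U W (g ∘ₗ f) :=
  ⟨fun a v => by simp [hf.map_act, hg.map_act],
    fun v => by simp [hf.map_coact, hg.map_coact, LinearMap.lTensor_comp]⟩

theorem zero (V W : YDModule k G) : IsHom V W 0 := ⟨fun _ _ => by simp, fun v => by simp⟩

theorem add {V W : YDModule k G} {f g : V →ₗ[k] W} (hf : IsHom V W f) (hg : IsHom V W g) :
    IsHom V W (f + g) :=
  ⟨fun a v => by simp [hf.map_act, hg.map_act],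
    fun v => by simp [hf.map_coact, hg.map_coact, LinearMap.lTensor_add]⟩

theorem smul {V W : YDModule k G} {f : V →ₗ[k] W} (c : k) (hf : IsHom V W f) :
    IsHom V W (c • f) :=
  ⟨fun a v => by simp [hf.map_act], fun v => by simp [hf.map_coact, LinearMap.lTensor_smul]⟩

theorem sum {V W : YDModule k G} {ι : Type*} (s : Finset ι) {f : ι → V →ₗ[k] W}
    (hf : ∀ i ∈ s, IsHom V W (f i)) : IsHom V W (∑ i ∈ s, f i) := by
  classical
  induction s using Finset.induction_on with
  | empty => simpa using zero V W
  | insert a s ha ih =>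
    rw [Finset.sum_insert ha]
    exact (hf a (Finset.mem_insert_self a s)).add
      (ih fun i hi => hf i (Finset.mem_insert_of_mem hi))

theorem symm {V W : YDModule k G} (e : V ≃ₗ[k] W) (he : IsHom V W e.toLinearMap) :
    IsHom W V e.symm.toLinearMap where
  map_act g w := by
    apply e.injective
    have := he.map_act g (e.symm w)
    simp only [LinearEquiv.coe_coe] at this
    simp [this]
  map_coact w := by
    have h := he.map_coact (e.symm w)
    simp only [LinearEquiv.coe_coe, LinearEquiv.apply_symm_apply] at h
    rw [h, ← LinearMap.lTensor_comp_apply]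
    simp

theorem tensorMap {V W V' W' : YDModule k G} {f : V →ₗ[k] V'} {g : W →ₗ[k] W'}
    (hf : IsHom V V' f) (hg : IsHom W W' g) :
    IsHom (V.tensor W) (V'.tensor W') (TensorProduct.map f g) where
  map_act h x := by
    change TensorProduct.map f g (tensorAct V.str W.str h x) =
      tensorAct V'.str W'.str h (TensorProduct.map f g x)
    rw [tensorAct_apply, tensorAct_apply]
    induction x using TensorProduct.induction_on with
    | zero => simp
    | add a b ha hb => simp only [map_add, ha, hb]
    | tmul v w =>
      generalize (Coalgebra.comul (R := k) h : G ⊗[k] G) = z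
      induction z with
      | zero => simp
      | add a b ha hb => simp only [map_add, LinearMap.add_apply, ha, hb]
      | tmul a b => simp [hf.map_act, hg.map_act]
  map_coact x := by
    change tensorCoact V'.str W'.str (TensorProduct.map f g x) =
      (TensorProduct.map f g).lTensor G (tensorCoact V.str W.str x)
    induction x using TensorProduct.induction_on with
    | zero => simp
    | add a b ha hb => simp only [map_add, ha, hb]
    | tmul v w =>
      rw [TensorProduct.map_tmul, tensorCoact_tmul, tensorCoact_tmul, hf.map_coact, hg.map_coact]
      generalize V.coact v = p
      generalize W.coact w = q
      induction p with
      | zero => simp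
      | add a b ha hb => simp only [TensorProduct.add_tmul, map_add, ha, hb]
      | tmul a v =>
        induction q with
        | zero => simp
        | add a b ha hb => simp only [TensorProduct.tmul_add, map_add, ha, hb]
        | tmul b w => simp

theorem rTensor {V V' : YDModule k G} (W : YDModule k G) {f : V →ₗ[k] V'} (hf : IsHom V V' f) :
    IsHom (V.tensor W) (V'.tensor W) (f.rTensor W) := hf.tensorMap (id W)

theorem lTensor {V V' : YDModule k G} (W : YDModule k G) {f : V →ₗ[k] V'} (hf : IsHom V V' f) :
    IsHom (W.tensor V) (W.tensor V') (f.lTensor W) := (id W).tensorMap hf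

theorem assoc (U V W : YDModule k G) : IsHom ((U.tensor V).tensor W) (U.tensor (V.tensor W))
    (TensorProduct.assoc k U V W).toLinearMap where
  map_act h x := by
    change TensorProduct.assoc k U V W (tensorAct (tensor U V).str W.str h x) =
      tensorAct U.str (tensor V W).str h (TensorProduct.assoc k U V W x)
    rw [tensorAct_apply, tensorAct_apply]
    let A : G ⊗[k] (G ⊗[k] G) →ₗ[k] (U ⊗[k] (V ⊗[k] W) →ₗ[k] U ⊗[k] (V ⊗[k] W)) :=
      TensorProduct.homTensorHomMap (RingHom.id k) U (V ⊗[k] W) U (V ⊗[k] W) ∘ₗ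
        TensorProduct.map U.act.toLinearMap
          (TensorProduct.homTensorHomMap (RingHom.id k) V W V W ∘ₗ
            TensorProduct.map V.act.toLinearMap W.act.toLinearMap)
    have e1 : ∀ (y : G ⊗[k] G) (u : U) (v : V) (w : W),
        TensorProduct.assoc k U V W (TensorProduct.homTensorHomMap (RingHom.id k) (U ⊗[k] V) W
          (U ⊗[k] V) W (TensorProduct.map (tensor U V).str.act.toLinearMap
            W.str.act.toLinearMap y) ((u ⊗ₜ v) ⊗ₜ w)) =
        A (TensorProduct.assoc k G G G ((Coalgebra.comul (R := k)).rTensor G y))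
          (u ⊗ₜ (v ⊗ₜ w)) := by
      intro y u v w
      induction y with
      | zero => simp
      | add a b ha hb => simp only [map_add, LinearMap.add_apply, ha, hb]
      | tmul a b =>
        simp only [TensorProduct.map_tmul, AlgHom.toLinearMap_apply, tensorAct_apply,
          TensorProduct.homTensorHomMap_apply, LinearMap.rTensor_tmul]
        generalize (Coalgebra.comul (R := k) a : G ⊗[k] G) = z
        induction z with
        | zero => simp
        | add a b ha hb =>
          simp only [TensorProduct.add_tmul, map_add, LinearMap.add_apply, ha, hb]
        | tmul a b => simp [A]
    have e2 : ∀ (y : G ⊗[k] G) (u : U) (v : V) (w : W),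
        TensorProduct.homTensorHomMap (RingHom.id k) U (V ⊗[k] W) U (V ⊗[k] W)
          (TensorProduct.map U.str.act.toLinearMap (tensor V W).str.act.toLinearMap y)
            (u ⊗ₜ (v ⊗ₜ w)) =
        A ((Coalgebra.comul (R := k)).lTensor G y) (u ⊗ₜ (v ⊗ₜ w)) := by
      intro y u v w
      induction y with
      | zero => simp
      | add a b ha hb => simp only [map_add, LinearMap.add_apply, ha, hb]
      | tmul a b =>
        simp only [TensorProduct.map_tmul, AlgHom.toLinearMap_apply, tensorAct_apply,
          TensorProduct.homTensorHomMap_apply, LinearMap.lTensor_tmul]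
        generalize (Coalgebra.comul (R := k) b : G ⊗[k] G) = z
        induction z with
        | zero => simp
        | add a b ha hb =>
          simp only [TensorProduct.tmul_add, map_add, LinearMap.add_apply, ha, hb]
        | tmul a b => simp [A]
    induction x using TensorProduct.induction_on with
    | zero => simp
    | add a b ha hb => simp only [map_add, ha, hb]
    | tmul x w =>
      induction x using TensorProduct.induction_on with
      | zero => simp
      | add a b ha hb => simp only [TensorProduct.add_tmul, map_add, ha, hb]
      | tmul u v => rw [e1, TensorProduct.assoc_tmul, e2, Coalgebra.coassoc_apply]
  map_coact x := by
    change tensorCoact U.str (tensor V W).str (TensorProduct.assoc k U V W x) =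
      (TensorProduct.assoc k U V W).toLinearMap.lTensor G (tensorCoact (tensor U V).str W.str x)
    induction x using TensorProduct.induction_on with
    | zero => simp
    | add a b ha hb => simp only [map_add, ha, hb]
    | tmul x w =>
      induction x using TensorProduct.induction_on with
      | zero => simp
      | add a b ha hb => simp only [TensorProduct.add_tmul, map_add, ha, hb]
      | tmul u v =>
        simp only [TensorProduct.assoc_tmul, tensorCoact_tmul]
        generalize U.coact u = p
        generalize V.coact v = q
        generalize W.coact w = r
        induction p with
        | zero => simp
        | add a b ha hb => simp only [TensorProduct.add_tmul, map_add, ha, hb]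
        | tmul a u =>
          induction q with
          | zero => simp
          | add a b ha hb =>
            simp only [TensorProduct.tmul_add, TensorProduct.add_tmul, map_add, ha, hb]
          | tmul b v =>
            induction r with
            | zero => simp
            | add a b ha hb => simp only [TensorProduct.tmul_add, map_add, ha, hb]
            | tmul c w => simp [mul_assoc]

theorem lid (V : YDModule k G) :
    IsHom ((unit k G).tensor V) V (TensorProduct.lid k V).toLinearMap where
  map_act h x := by
    change TensorProduct.lid k V (tensorAct (unit k G).str V.str h x) =
      V.act h (TensorProduct.lid k V x)
    rw [tensorAct_apply]
    induction x using TensorProduct.induction_on with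
    | zero => simp
    | add a b ha hb => simp only [map_add, ha, hb]
    | tmul c v =>
      have e : ∀ y : G ⊗[k] G, TensorProduct.lid k V (TensorProduct.homTensorHomMap
          (RingHom.id k) k V k V (TensorProduct.map (unit k G).str.act.toLinearMap
            V.str.act.toLinearMap y) (c ⊗ₜ v)) =
          c • V.act (TensorProduct.lid k G ((Coalgebra.counit (R := k)).rTensor G y)) v := by
        intro y
        induction y with
        | zero => simp
        | add a b ha hb => simp only [map_add, LinearMap.add_apply, ha, hb, smul_add]
        | tmul a b =>
          simp [Algebra.ofId_apply, Algebra.algebraMap_eq_smul_one, mul_smul, smul_comm c]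
      rw [e]
      simp
  map_coact x := by
    change V.coact (TensorProduct.lid k V x) =
      (TensorProduct.lid k V).toLinearMap.lTensor G (tensorCoact (unit k G).str V.str x)
    induction x using TensorProduct.induction_on with
    | zero => simp
    | add a b ha hb => simp only [map_add, ha, hb]
    | tmul c v =>
      rw [tensorCoact_tmul, TensorProduct.lid_tmul, map_smul]
      generalize V.coact v = p
      change c • p = (TensorProduct.lid k V).toLinearMap.lTensor G
        (codiag k G k V (((1 : G) ⊗ₜ c) ⊗ₜ p))
      induction p with
      | zero => simp
      | add a b ha hb => simp only [TensorProduct.tmul_add, map_add, smul_add, ha, hb]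
      | tmul a v => simp

theorem rid (V : YDModule k G) :
    IsHom (V.tensor (unit k G)) V (TensorProduct.rid k V).toLinearMap where
  map_act h x := by
    change TensorProduct.rid k V (tensorAct V.str (unit k G).str h x) =
      V.act h (TensorProduct.rid k V x)
    rw [tensorAct_apply]
    induction x using TensorProduct.induction_on with
    | zero => simp
    | add a b ha hb => simp only [map_add, ha, hb]
    | tmul v c =>
      have e : ∀ y : G ⊗[k] G, TensorProduct.rid k V (TensorProduct.homTensorHomMap
          (RingHom.id k) V k V k (TensorProduct.map V.str.act.toLinearMap
            (unit k G).str.act.toLinearMap y) (v ⊗ₜ c)) =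
          c • V.act (TensorProduct.rid k G ((Coalgebra.counit (R := k)).lTensor G y)) v := by
        intro y
        induction y with
        | zero => simp
        | add a b ha hb => simp only [map_add, LinearMap.add_apply, ha, hb, smul_add]
        | tmul a b =>
          simp [Algebra.ofId_apply, Algebra.algebraMap_eq_smul_one, smul_comm c]
      rw [e]
      simp
  map_coact x := by
    change V.coact (TensorProduct.rid k V x) =
      (TensorProduct.rid k V).toLinearMap.lTensor G (tensorCoact V.str (unit k G).str x)
    induction x using TensorProduct.induction_on with
    | zero => simp
    | add a b ha hb => simp only [map_add, ha, hb]
    | tmul v c =>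
      rw [tensorCoact_tmul, TensorProduct.rid_tmul, map_smul]
      generalize V.coact v = p
      change c • p = (TensorProduct.rid k V).toLinearMap.lTensor G
        (codiag k G V k (p ⊗ₜ ((1 : G) ⊗ₜ c)))
      induction p with
      | zero => simp
      | add a b ha hb => simp only [TensorProduct.add_tmul, map_add, smul_add, ha, hb]
      | tmul a v => simp

end IsHom

/-! ### Subobjects and quotients -/

/-- A Yetter–Drinfeld submodule: a `G`-stable subspace `W` with `δ(W) ⊆ G ⊗ W`. -/
structure IsSub (V : YDModule k G) (W : Submodule k V) : Prop where
  act_mem : ∀ (g : G), ∀ w ∈ W, V.act g w ∈ W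
  coact_mem : ∀ w ∈ W, V.coact w ∈ LinearMap.range (W.subtype.lTensor G)

theorem lTensor_injective {M N : Type u} [AddCommGroup M] [Module k M] [AddCommGroup N]
    [Module k N] (f : M →ₗ[k] N) (hf : Function.Injective f) :
    Function.Injective (f.lTensor G) :=
  Module.Flat.lTensor_preserves_injective_linearMap f hf

/-- The coaction on a Yetter–Drinfeld submodule. -/
noncomputable def subCoact (V : YDModule k G) (W : Submodule k V) (h : IsSub V W) :
    W →ₗ[k] G ⊗[k] W :=
  (LinearEquiv.ofInjective (W.subtype.lTensor G)
      (lTensor_injective W.subtype W.injective_subtype)).symm.toLinearMap ∘ₗ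
    LinearMap.codRestrict _ (V.coact ∘ₗ W.subtype) fun w => h.coact_mem w w.2

theorem subCoact_spec (V : YDModule k G) (W : Submodule k V) (h : IsSub V W) (w : W) :
    W.subtype.lTensor G (subCoact V W h w) = V.coact w := by
  have := congrArg Subtype.val ((LinearEquiv.ofInjective (W.subtype.lTensor G)
    (lTensor_injective W.subtype W.injective_subtype)).apply_symm_apply
      ⟨V.coact w, h.coact_mem w w.2⟩)
  exact this

section naturality

variable {V W : Type u} [AddCommGroup V] [Module k V] [AddCommGroup W] [Module k W]

theorem nat_coassoc (f : V →ₗ[k] W) (c : V →ₗ[k] G ⊗[k] V) (c' : W →ₗ[k] G ⊗[k] W)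
    (hc : ∀ v, c' (f v) = f.lTensor G (c v)) (v : V) :
    TensorProduct.assoc k G G W ((Coalgebra.comul (R := k)).rTensor W (c' (f v))) =
      (f.lTensor G).lTensor G
        (TensorProduct.assoc k G G V ((Coalgebra.comul (R := k)).rTensor V (c v))) ∧
    c'.lTensor G (c' (f v)) = (f.lTensor G).lTensor G (c.lTensor G (c v)) := by
  constructor
  · rw [hc]
    generalize c v = p
    induction p with
    | zero => simp
    | add a b ha hb => simp only [map_add, ha, hb]
    | tmul a v =>
      simp only [LinearMap.lTensor_tmul, LinearMap.rTensor_tmul]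
      generalize (Coalgebra.comul (R := k) a : G ⊗[k] G) = z
      induction z with
      | zero => simp
      | add a b ha hb => simp only [TensorProduct.add_tmul, map_add, ha, hb]
      | tmul a b => simp
  · rw [hc]
    generalize c v = p
    induction p with
    | zero => simp
    | add a b ha hb => simp only [map_add, ha, hb]
    | tmul a v => simp [hc]

theorem nat_counit (f : V →ₗ[k] W) (c : V →ₗ[k] G ⊗[k] V) (c' : W →ₗ[k] G ⊗[k] W)
    (hc : ∀ v, c' (f v) = f.lTensor G (c v)) (v : V) :
    TensorProduct.lid k W ((Coalgebra.counit (R := k) (A := G)).rTensor W (c' (f v))) =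
      f (TensorProduct.lid k V ((Coalgebra.counit (R := k) (A := G)).rTensor V (c v))) := by
  rw [hc]
  generalize c v = p
  induction p with
  | zero => simp
  | add a b ha hb => simp only [map_add, ha, hb]
  | tmul a v => simp

theorem nat_compat (f : V →ₗ[k] W) (c : V →ₗ[k] G ⊗[k] V) (c' : W →ₗ[k] G ⊗[k] W)
    (hc : ∀ v, c' (f v) = f.lTensor G (c v))
    (a : G →ₐ[k] Module.End k V) (a' : G →ₐ[k] Module.End k W)
    (ha : ∀ g v, a' g (f v) = f (a g v)) (x : G ⊗[k] G) (v : V) :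
    TensorProduct.map (LinearMap.mul' k G) (TensorProduct.lift a'.toLinearMap)
      (TensorProduct.tensorTensorTensorComm k G G G W (x ⊗ₜ c' (f v))) =
    f.lTensor G (TensorProduct.map (LinearMap.mul' k G) (TensorProduct.lift a.toLinearMap)
      (TensorProduct.tensorTensorTensorComm k G G G V (x ⊗ₜ c v))) ∧
    (LinearMap.mul' k G).rTensor W (TensorProduct.rightComm k G W G
      ((c' ∘ₗ a'.toLinearMap.flip (f v)).rTensor G x)) =
    f.lTensor G ((LinearMap.mul' k G).rTensor V (TensorProduct.rightComm k G V G
      ((c ∘ₗ a.toLinearMap.flip v).rTensor G x))) := by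
  constructor
  · rw [hc]
    generalize c v = p
    induction x with
    | zero => simp
    | add a b ha hb => simp only [TensorProduct.add_tmul, map_add, ha, hb]
    | tmul g h =>
      induction p with
      | zero => simp
      | add a b ha hb => simp only [TensorProduct.tmul_add, map_add, ha, hb]
      | tmul g' v => simp [ha]
  · induction x with
    | zero => simp
    | add a b ha hb => simp only [map_add, ha, hb]
    | tmul g h =>
      simp only [LinearMap.rTensor_tmul, LinearMap.comp_apply, LinearMap.flip_apply,
        AlgHom.toLinearMap_apply, ha, hc]
      generalize c (a g v) = p
      induction p with
      | zero => simp
      | add a b ha hb => simp only [TensorProduct.add_tmul, map_add, ha, hb]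
      | tmul g' v => simp

end naturality

/-- The action on a Yetter–Drinfeld submodule. -/
def subAct (V : YDModule k G) (W : Submodule k V) (h : IsSub V W) : G →ₐ[k] Module.End k W where
  toFun := fun g => (V.act g).restrict (h.act_mem g)
  map_one' := by ext; simp
  map_mul' := fun a b => by ext; simp
  map_zero' := by ext; simp
  map_add' := fun a b => by ext; simp
  commutes' := fun c => by ext; simp [Algebra.algebraMap_eq_smul_one]

/-- A Yetter–Drinfeld submodule as a Yetter–Drinfeld module. -/
noncomputable abbrev sub (V : YDModule k G) (W : Submodule k V) (h : IsSub V W) :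
    YDModule k G where
  carrier := W
  str :=
    { act := subAct V W h
      coact := subCoact V W h
      coassoc := fun w => by
        have n := nat_coassoc W.subtype (subCoact V W h) V.coact
          (fun w => (subCoact_spec V W h w).symm) w
        apply lTensor_injective _ (lTensor_injective _ W.injective_subtype)
        rw [← n.1, ← n.2, V.str.coassoc]
      counit_coact := fun w => by
        apply W.injective_subtype
        rw [← nat_counit W.subtype (subCoact V W h) V.coact
          (fun w => (subCoact_spec V W h w).symm) w, V.str.counit_coact]
      compat := fun g w => by
        have n := nat_compat W.subtype (subCoact V W h) V.coact
          (fun w => (subCoact_spec V W h w).symm) (subAct V W h) V.act (fun _ _ => rfl)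
          (Coalgebra.comul (R := k) g) w
        apply lTensor_injective _ W.injective_subtype
        rw [← n.1, ← n.2, V.str.compat] }

/-- The action on a quotient. -/
def quotAct (V : YDModule k G) (W : Submodule k V) (h : IsSub V W) :
    G →ₐ[k] Module.End k (V ⧸ W) where
  toFun := fun g => W.mapQ W (V.act g) (h.act_mem g)
  map_one' := by ext; simp
  map_mul' := fun a b => by ext; simp
  map_zero' := by ext; simp
  map_add' := fun a b => by ext; simp
  commutes' := fun c => by ext; simp [Algebra.algebraMap_eq_smul_one]

/-- The coaction on a quotient. -/
def quotCoact (V : YDModule k G) (W : Submodule k V) (h : IsSub V W) :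
    (V ⧸ W) →ₗ[k] G ⊗[k] (V ⧸ W) :=
  W.liftQ (W.mkQ.lTensor G ∘ₗ V.coact) fun w hw => by
    obtain ⟨t, ht⟩ := h.coact_mem w hw
    rw [LinearMap.mem_ker, LinearMap.comp_apply, ← ht, ← LinearMap.lTensor_comp_apply]
    have : W.mkQ ∘ₗ W.subtype = 0 := by ext; simp
    simp [this]

/-- The quotient of a Yetter–Drinfeld module by a Yetter–Drinfeld submodule. -/
abbrev quot (V : YDModule k G) (W : Submodule k V) (h : IsSub V W) : YDModule k G where
  carrier := V ⧸ W
  str :=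
    { act := quotAct V W h
      coact := quotCoact V W h
      coassoc := fun w => by
        obtain ⟨v, rfl⟩ := W.mkQ_surjective w
        have n := nat_coassoc W.mkQ V.coact (quotCoact V W h) (fun _ => rfl) v
        rw [n.1, n.2, V.str.coassoc]
      counit_coact := fun w => by
        obtain ⟨v, rfl⟩ := W.mkQ_surjective w
        rw [nat_counit W.mkQ V.coact (quotCoact V W h) (fun _ => rfl) v, V.str.counit_coact]
      compat := fun g w => by
        obtain ⟨v, rfl⟩ := W.mkQ_surjective w
        have n := nat_compat W.mkQ V.coact (quotCoact V W h) (fun _ => rfl) V.act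
          (quotAct V W h) (fun _ _ => rfl) (Coalgebra.comul (R := k) g) v
        rw [n.1, n.2, V.str.compat] }

theorem isHom_subtype (V : YDModule k G) (W : Submodule k V) (h : IsSub V W) :
    IsHom (sub V W h) V W.subtype :=
  ⟨fun _ _ => rfl, fun v => (subCoact_spec V W h v).symm⟩

theorem isHom_mkQ (V : YDModule k G) (W : Submodule k V) (h : IsSub V W) :
    IsHom V (quot V W h) W.mkQ :=
  ⟨fun _ _ => rfl, fun _ => rfl⟩

theorem IsHom.isSub_ker {V W : YDModule k G} {f : V →ₗ[k] W} (hf : IsHom V W f) :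
    IsSub V (LinearMap.ker f) where
  act_mem g v hv := by
    rw [LinearMap.mem_ker] at hv ⊢
    rw [hf.map_act, hv, map_zero]
  coact_mem v hv := by
    have hex : Function.Exact (LinearMap.ker f).subtype f := LinearMap.exact_subtype_ker_map f
    have := Module.Flat.lTensor_exact G hex
    rw [LinearMap.mem_range]
    apply (this _).1
    rw [← hf.map_coact, LinearMap.mem_ker.1 hv, map_zero]

theorem IsHom.isSub_range {V W : YDModule k G} {f : V →ₗ[k] W} (hf : IsHom V W f) :
    IsSub W (LinearMap.range f) where
  act_mem g w hw := by
    obtain ⟨v, rfl⟩ := hw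
    exact ⟨V.act g v, hf.map_act g v⟩
  coact_mem w hw := by
    obtain ⟨v, rfl⟩ := hw
    refine ⟨f.rangeRestrict.lTensor G (V.coact v), ?_⟩
    rw [← LinearMap.lTensor_comp_apply, hf.map_coact]
    rfl

theorem isSub_bot (V : YDModule k G) : IsSub V ⊥ where
  act_mem g w hw := by
    rw [Submodule.mem_bot] at hw ⊢
    rw [hw, map_zero]
  coact_mem w hw := by
    rw [(Submodule.mem_bot k).1 hw, map_zero]
    exact zero_mem _

theorem IsSub.comap_subtype {V : YDModule k G} {Z B : Submodule k V} (hZ : IsSub V Z)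
    (hB : IsSub V B) : IsSub (sub V Z hZ) (B.comap Z.subtype) := by
  have h := ((isHom_mkQ V B hB).comp (isHom_subtype V Z hZ)).isSub_ker
  rwa [LinearMap.ker_comp, Submodule.ker_mkQ] at h

/-! ### Inner hom objects -/

/-- An inner hom object `hom(V, Y)`: an object `obj` with an evaluation `obj ⊗ V → Y` which
induces bijections `Hom(X, obj) ≃ Hom(X ⊗ V, Y)`. -/
structure InnerHom (V Y : YDModule k G) where
  obj : YDModule k G
  ev : obj ⊗[k] V →ₗ[k] Y
  isHom_ev : IsHom (obj.tensor V) Y ev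
  existsUnique : ∀ (X : YDModule k G) (φ : X ⊗[k] V →ₗ[k] Y), IsHom (X.tensor V) Y φ →
    ∃! ψ : X →ₗ[k] obj, IsHom X obj ψ ∧ ev ∘ₗ ψ.rTensor V = φ

namespace InnerHom

variable {V Y : YDModule k G}

/-- The morphism `X → hom(V, Y)` corresponding to a morphism `X ⊗ V → Y`. -/
noncomputable def curry (E : InnerHom V Y) (X : YDModule k G) (φ : X ⊗[k] V →ₗ[k] Y)
    (hφ : IsHom (X.tensor V) Y φ) : X →ₗ[k] E.obj :=
  (E.existsUnique X φ hφ).choose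

theorem isHom_curry (E : InnerHom V Y) (X : YDModule k G) (φ : X ⊗[k] V →ₗ[k] Y)
    (hφ : IsHom (X.tensor V) Y φ) : IsHom X E.obj (E.curry X φ hφ) :=
  (E.existsUnique X φ hφ).choose_spec.1.1

theorem ev_curry (E : InnerHom V Y) (X : YDModule k G) (φ : X ⊗[k] V →ₗ[k] Y)
    (hφ : IsHom (X.tensor V) Y φ) : E.ev ∘ₗ (E.curry X φ hφ).rTensor V = φ :=
  (E.existsUnique X φ hφ).choose_spec.1.2

end InnerHom

end YDModule

open YDModule

/-! ### Graded algebras in the category of Yetter–Drinfeld modules -/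

/-- The structure of a (unital, associative) `ℕ`-graded algebra in the category of
Yetter–Drinfeld modules on the family `A`. -/
structure YDGradedAlgebra {k G : Type u} [Field k] [Ring G] [HopfAlgebra k G]
    (A : ℕ → YDModule k G) where
  one : k →ₗ[k] A 0
  mul : ∀ m n N : ℕ, m + n = N → (A m ⊗[k] A n →ₗ[k] A N)
  isHom_one : IsHom (YDModule.unit k G) (A 0) one
  isHom_mul : ∀ m n N h, IsHom ((A m).tensor (A n)) (A N) (mul m n N h)
  one_mul : ∀ n h (x : A n), mul 0 n n h (one 1 ⊗ₜ x) = x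
  mul_one : ∀ n h (x : A n), mul n 0 n h (x ⊗ₜ one 1) = x
  mul_assoc : ∀ a b c ab bc N (h₁ : a + b = ab) (h₂ : b + c = bc) (h₃ : ab + c = N)
    (h₄ : a + bc = N) (x : A a) (y : A b) (z : A c),
    mul ab c N h₃ (mul a b ab h₁ (x ⊗ₜ y) ⊗ₜ z) = mul a bc N h₄ (x ⊗ₜ mul b c bc h₂ (y ⊗ₜ z))

/-- The braiding of graded Yetter–Drinfeld modules on the component of bidegree `(m, n)`. -/
def gradedBraiding {k G : Type u} [Field k] [Ring G] [HopfAlgebra k G]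
    (A : ℕ → YDModule k G) (m n : ℕ) : A m ⊗[k] A n →ₗ[k] A n ⊗[k] A m :=
  (-1 : k) ^ (m * n) • braiding (A m) (A n)

/-- A graded algebra is braided graded commutative if `μ ∘ c_gr = μ`. -/
def YDGradedAlgebra.IsBraidedGradedCommutative {k G : Type u} [Field k] [Ring G]
    [HopfAlgebra k G] {A : ℕ → YDModule k G} (S : YDGradedAlgebra A) : Prop :=
  ∀ m n N (h : m + n = N) (h' : n + m = N),
    S.mul n m N h' ∘ₗ gradedBraiding A m n = S.mul m n N h

/-! ### Bialgebras in the category of Yetter–Drinfeld modules -/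

/-- A bialgebra in the braided category of Yetter–Drinfeld modules over `G`. -/
structure YDBialgebra (k G : Type u) [Field k] [Ring G] [HopfAlgebra k G]
    extends YDModule k G where
  one : k →ₗ[k] carrier
  mul : carrier ⊗[k] carrier →ₗ[k] carrier
  counit : carrier →ₗ[k] k
  comul : carrier →ₗ[k] carrier ⊗[k] carrier
  isHom_one : IsHom (YDModule.unit k G) toYDModule one
  isHom_mul : IsHom (toYDModule.tensor toYDModule) toYDModule mul
  isHom_counit : IsHom toYDModule (YDModule.unit k G) counit
  isHom_comul : IsHom toYDModule (toYDModule.tensor toYDModule) comul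
  one_mul : ∀ x, mul (one 1 ⊗ₜ x) = x
  mul_one : ∀ x, mul (x ⊗ₜ one 1) = x
  mul_assoc : ∀ x y z, mul (mul (x ⊗ₜ y) ⊗ₜ z) = mul (x ⊗ₜ mul (y ⊗ₜ z))
  counit_comul : ∀ x, TensorProduct.lid k carrier (counit.rTensor carrier (comul x)) = x
  comul_counit : ∀ x, TensorProduct.rid k carrier (counit.lTensor carrier (comul x)) = x
  coassoc : ∀ x, TensorProduct.assoc k carrier carrier carrier
    (comul.rTensor carrier (comul x)) = comul.lTensor carrier (comul x)
  counit_one : counit (one 1) = 1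
  counit_mul : ∀ x y, counit (mul (x ⊗ₜ y)) = counit x * counit y
  comul_one : comul (one 1) = one 1 ⊗ₜ one 1
  comul_mul : ∀ x y, comul (mul (x ⊗ₜ y)) = TensorProduct.map mul mul
    (interchange toYDModule toYDModule toYDModule toYDModule (comul x ⊗ₜ comul y))

namespace YDBialgebra

variable {k G : Type u} [Field k] [Ring G] [HopfAlgebra k G] (R : YDBialgebra k G)

/-- The tensor power `R^{⊗ n}`, with `R^{⊗ (n+1)} = R^{⊗ n} ⊗ R`. -/
def tpow : ℕ → YDModule k G
  | 0 => YDModule.unit k G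
  | n + 1 => (tpow n).tensor R.toYDModule

/-- The isomorphism `R^{⊗ (m+n)} → R^{⊗ m} ⊗ R^{⊗ n}`. -/
noncomputable def split (m : ℕ) : ∀ n, R.tpow (m + n) →ₗ[k] R.tpow m ⊗[k] R.tpow n
  | 0 => (TensorProduct.rid k (R.tpow m)).symm.toLinearMap
  | n + 1 => (TensorProduct.assoc k (R.tpow m) (R.tpow n) R.carrier).toLinearMap ∘ₗ
      (split m n).rTensor R.carrier

theorem isHom_split (m : ℕ) : ∀ n,
    IsHom (R.tpow (m + n)) ((R.tpow m).tensor (R.tpow n)) (R.split m n)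
  | 0 => (IsHom.rid (R.tpow m)).symm
  | n + 1 => (IsHom.assoc (R.tpow m) (R.tpow n) R.toYDModule).comp
      ((isHom_split m n).rTensor R.toYDModule)

/-- The isomorphism `R^{⊗ N} → R^{⊗ m} ⊗ R^{⊗ n}` for `m + n = N`. -/
noncomputable def splitTo (m n N : ℕ) (h : m + n = N) :
    R.tpow N →ₗ[k] R.tpow m ⊗[k] R.tpow n :=
  match N, h with
  | _, rfl => R.split m n

theorem isHom_splitTo (m n N : ℕ) (h : m + n = N) :
    IsHom (R.tpow N) ((R.tpow m).tensor (R.tpow n)) (R.splitTo m n N h) := by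
  subst h
  exact R.isHom_split m n

/-- The multiplication of the last two factors, `1 ⊗ μ : R^{⊗ (n+2)} → R^{⊗ (n+1)}`. -/
def mulLast (n : ℕ) : R.tpow (n + 2) →ₗ[k] R.tpow (n + 1) :=
  R.mul.lTensor (R.tpow n) ∘ₗ
    (TensorProduct.assoc k (R.tpow n) R.carrier R.carrier).toLinearMap

/-- The augmentation applied to the last factor, `1 ⊗ ε : R^{⊗ (n+1)} → R^{⊗ n}`. -/
def counitLast (n : ℕ) : R.tpow (n + 1) →ₗ[k] R.tpow n :=
  (TensorProduct.rid k (R.tpow n)).toLinearMap ∘ₗ R.counit.lTensor (R.tpow n)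

theorem isHom_mulLast (n : ℕ) : IsHom (R.tpow (n + 2)) (R.tpow (n + 1)) (R.mulLast n) :=
  (R.isHom_mul.lTensor (R.tpow n)).comp (IsHom.assoc (R.tpow n) R.toYDModule R.toYDModule)

theorem isHom_counitLast (n : ℕ) : IsHom (R.tpow (n + 1)) (R.tpow n) (R.counitLast n) :=
  (IsHom.rid (R.tpow n)).comp (R.isHom_counit.lTensor (R.tpow n))

/-- The faces `∂ᵢ : R^{⊗ (n+1)} → R^{⊗ n}`, `0 ≤ i ≤ n + 1`: `∂₀ = ε ⊗ 1`, `∂ₙ₊₁ = 1 ⊗ ε`, and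
`∂ᵢ` multiplies the `i`-th and the `(i+1)`-st factor for `0 < i < n + 1`. -/
def face : ∀ n : ℕ, ℕ → (R.tpow (n + 1) →ₗ[k] R.tpow n)
  | 0, _ => R.counitLast 0
  | n + 1, i =>
      if i = n + 2 then R.counitLast (n + 1)
      else if i = n + 1 then R.mulLast n
      else (face n i).rTensor R.carrier

theorem isHom_face : ∀ n i, IsHom (R.tpow (n + 1)) (R.tpow n) (R.face n i)
  | 0, _ => R.isHom_counitLast 0
  | n + 1, i => by
      have ite_hom : ∀ {V W : YDModule k G} (p : Prop) [Decidable p] {f g : V →ₗ[k] W},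
          IsHom V W f → IsHom V W g → IsHom V W (if p then f else g) := by
        intro V W p _ f g hf hg
        split_ifs
        exacts [hf, hg]
      exact ite_hom _ (R.isHom_counitLast (n + 1))
        (ite_hom _ (R.isHom_mulLast n) ((isHom_face n i).rTensor R.toYDModule))

/-- The differential `∑ (-1)ⁱ ∂ᵢ` of the bar complex `R^{⊗ (n+1)} → R^{⊗ n}`. -/
def bar (n : ℕ) : R.tpow (n + 1) →ₗ[k] R.tpow n :=
  ∑ i ∈ Finset.range (n + 2), (-1 : k) ^ i • R.face n i

theorem isHom_bar (n : ℕ) : IsHom (R.tpow (n + 1)) (R.tpow n) (R.bar n) :=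
  IsHom.sum _ fun i _ => (R.isHom_face n i).smul _

/-! ### Hochschild cohomology in the category of Yetter–Drinfeld modules -/

/-- A choice of inner hom objects `hom(R^{⊗ n}, I)` for all `n`. -/
abbrev HomObjects := ∀ n, InnerHom (R.tpow n) (YDModule.unit k G)

section HH

variable {R} (E : R.HomObjects)

/-- The differential `hom(R^{⊗ n}, I) → hom(R^{⊗ (n+1)}, I)`. -/
noncomputable def diff (n : ℕ) : (E n).obj →ₗ[k] (E (n + 1)).obj :=
  (E (n + 1)).curry (E n).obj ((E n).ev ∘ₗ (R.bar n).lTensor (E n).obj)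
    ((E n).isHom_ev.comp ((R.isHom_bar n).lTensor (E n).obj))

theorem isHom_diff (n : ℕ) : IsHom (E n).obj (E (n + 1)).obj (diff E n) :=
  InnerHom.isHom_curry _ _ _ _

/-- The boundaries in degree `n`. -/
noncomputable def boundaries : ∀ n, Submodule k (E n).obj
  | 0 => ⊥
  | n + 1 => LinearMap.range (diff E n)

theorem isSub_boundaries : ∀ n, IsSub (E n).obj (boundaries E n)
  | 0 => isSub_bot _
  | n + 1 => (isHom_diff E n).isSub_range

/-- The cocycles in degree `n`. -/
noncomputable abbrev cocycles (n : ℕ) : YDModule k G :=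
  (E n).obj.sub (LinearMap.ker (diff E n)) (isHom_diff E n).isSub_ker

/-- The `n`-th Hochschild cohomology of `R` in the category of Yetter–Drinfeld modules. -/
noncomputable abbrev HH (n : ℕ) : YDModule k G :=
  (cocycles E n).quot ((boundaries E n).comap (LinearMap.ker (diff E n)).subtype)
    ((isHom_diff E n).isSub_ker.comap_subtype (isSub_boundaries E n))

/-- The class of a cocycle. -/
noncomputable def cls (n : ℕ) : cocycles E n →ₗ[k] HH E n := Submodule.mkQ _

/-- The morphism `I → hom(R^{⊗ 0}, I)` corresponding to `I ⊗ I = I`. -/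
noncomputable def unitCochain : k →ₗ[k] (E 0).obj :=
  (E 0).curry (YDModule.unit k G) (TensorProduct.lid k k).toLinearMap
    (IsHom.lid (YDModule.unit k G))

/-- The morphism `A ⊗ B ⊗ X ⊗ Y → I` that evaluates `A` on `Y` and `B` on `X`, in the order
`A ⊗ B ⊗ X ⊗ Y → A ⊗ Y → I`. -/
noncomputable def evalTwice {X Y : YDModule k G} (A : InnerHom Y (YDModule.unit k G))
    (B : InnerHom X (YDModule.unit k G)) :
    (A.obj ⊗[k] B.obj) ⊗[k] (X ⊗[k] Y) →ₗ[k] k :=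
  A.ev ∘ₗ
    ((TensorProduct.lid k Y).toLinearMap ∘ₗ B.ev.rTensor Y ∘ₗ
      (TensorProduct.assoc k B.obj X Y).symm.toLinearMap).lTensor A.obj ∘ₗ
    (TensorProduct.assoc k A.obj B.obj (X ⊗[k] Y)).toLinearMap

theorem isHom_evalTwice {X Y : YDModule k G} (A : InnerHom Y (YDModule.unit k G))
    (B : InnerHom X (YDModule.unit k G)) :
    IsHom ((A.obj.tensor B.obj).tensor (X.tensor Y)) (YDModule.unit k G) (evalTwice A B) :=
  A.isHom_ev.comp
    ((((IsHom.lid Y).comp ((B.isHom_ev.rTensor Y).comp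
      (IsHom.assoc B.obj X Y).symm)).lTensor A.obj).comp
    (IsHom.assoc A.obj B.obj (X.tensor Y)))

/-- The cup product of cochains
`hom(R^{⊗ m}, I) ⊗ hom(R^{⊗ n}, I) → hom(R^{⊗ n} ⊗ R^{⊗ m}, I) = hom(R^{⊗ (m+n)}, I)`. -/
noncomputable def cup (m n N : ℕ) (h : m + n = N) :
    (E m).obj ⊗[k] (E n).obj →ₗ[k] (E N).obj :=
  (E N).curry ((E m).obj.tensor (E n).obj)
    (evalTwice (E m) (E n) ∘ₗ
      (R.splitTo n m N (by omega)).lTensor ((E m).obj ⊗[k] (E n).obj))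
    ((isHom_evalTwice (E m) (E n)).comp
      ((R.isHom_splitTo n m N (by omega)).lTensor ((E m).obj.tensor (E n).obj)))

/-- The unit and the multiplication of `A` are induced by the unit cochain and the cup product
of cocycles. -/
def IsCupAlgebra (A : YDGradedAlgebra (HH E)) : Prop :=
  (∃ z : cocycles E 0, (z : (E 0).obj) = unitCochain E 1 ∧ A.one 1 = cls E 0 z) ∧
  ∀ m n N (h : m + n = N) (x : cocycles E m) (y : cocycles E n),
    ∃ z : cocycles E N, (z : (E N).obj) = cup E m n N h ((x : (E m).obj) ⊗ₜ (y : (E n).obj)) ∧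
      A.mul m n N h (cls E m x ⊗ₜ cls E n y) = cls E N z

end HH

/-! ### Ordinary Hochschild cohomology with trivial coefficients -/

/-- Ordinary Hochschild cochains `Hom_k(R^{⊗ n}, k)`. -/
def OrdCochain (n : ℕ) : Type u := R.tpow n →ₗ[k] k

instance (n : ℕ) : AddCommGroup (R.OrdCochain n) :=
  inferInstanceAs (AddCommGroup (R.tpow n →ₗ[k] k))

instance (n : ℕ) : Module k (R.OrdCochain n) :=
  inferInstanceAs (Module k (R.tpow n →ₗ[k] k))

variable {R} in
/-- A cochain as a linear form on `R^{⊗ n}`. -/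
def OrdCochain.toLin {n : ℕ} : R.OrdCochain n ≃ₗ[k] (R.tpow n →ₗ[k] k) :=
  LinearEquiv.refl k (R.tpow n →ₗ[k] k)

/-- The Hochschild differential `f ↦ f ∘ ∑ (-1)ⁱ ∂ᵢ`. -/
def ordDiff (n : ℕ) : R.OrdCochain n →ₗ[k] R.OrdCochain (n + 1) :=
  OrdCochain.toLin.symm.toLinearMap ∘ₗ LinearMap.lcomp k k (R.bar n) ∘ₗ
    OrdCochain.toLin.toLinearMap

/-- Ordinary Hochschild cocycles. -/
def OrdCocycles (n : ℕ) : Submodule k (R.OrdCochain n) := LinearMap.ker (R.ordDiff n)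

/-- Ordinary Hochschild coboundaries. -/
def ordBoundaries : ∀ n, Submodule k (R.OrdCochain n)
  | 0 => ⊥
  | n + 1 => LinearMap.range (R.ordDiff n)

/-- Ordinary Hochschild cohomology `H^n(R, k)` of the augmented algebra `R`. -/
abbrev OrdHH (n : ℕ) : Type u :=
  R.OrdCocycles n ⧸ (R.ordBoundaries n).comap (R.OrdCocycles n).subtype

/-- The class of an ordinary Hochschild cocycle. -/
def ordCls (n : ℕ) : R.OrdCocycles n →ₗ[k] R.OrdHH n := Submodule.mkQ _

/-- The usual cup product `(f ∪ g)(x ⊗ y) = f(x) g(y)`. -/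
noncomputable def ordCup (m n N : ℕ) (h : m + n = N) (f : R.OrdCochain m)
    (g : R.OrdCochain n) : R.OrdCochain N :=
  OrdCochain.toLin.symm
    (LinearMap.mul' k k ∘ₗ TensorProduct.map f.toLin g.toLin ∘ₗ R.splitTo m n N h)

/-- The Yetter–Drinfeld structures `D` on ordinary Hochschild cohomology are induced by that of
`R`: they come from the structure `(g f)(v) = f(S(g) v)`,
`f₍₋₁₎ f₍₀₎(v) = S⁻¹(v₍₋₁₎) f(v₍₀₎)` on `Hom_k(R^{⊗ n}, k)`. The second equation is written
as `S(f₍₋₁₎) f₍₀₎(v) = v₍₋₁₎ f(v₍₀₎)`. -/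
def IsInducedStr (D : ∀ n, YDStruct k G (R.OrdHH n)) : Prop :=
  (∀ n (g : G) (f : R.OrdCocycles n), ∃ f' : R.OrdCocycles n,
    (∀ v, f'.1.toLin v = f.1.toLin ((R.tpow n).act (HopfAlgebra.antipode k g) v)) ∧
      (D n).act g (R.ordCls n f) = R.ordCls n f') ∧
  (∀ n (f : R.OrdCocycles n), ∃ t : G ⊗[k] R.OrdCocycles n,
    (∀ v, TensorProduct.rid k G (TensorProduct.map (HopfAlgebra.antipode k)
        (LinearMap.applyₗ v ∘ₗ OrdCochain.toLin.toLinearMap ∘ₗ (R.OrdCocycles n).subtype) t) =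
      TensorProduct.rid k G (f.1.toLin.lTensor G ((R.tpow n).coact v))) ∧
      (D n).coact (R.ordCls n f) = (R.ordCls n).lTensor G t)

/-- The multiplication of `B` is the opposite of the usual cup product on ordinary Hochschild
cohomology, and its unit is the usual one. -/
def IsOppositeCup (D : ∀ n, YDStruct k G (R.OrdHH n))
    (B : YDGradedAlgebra (fun n => (⟨R.OrdHH n, D n⟩ : YDModule k G))) : Prop :=
  (∃ e : R.OrdCocycles 0, (∀ c : k, e.1.toLin c = c) ∧ B.one 1 = R.ordCls 0 e) ∧
  ∀ m n N (h : m + n = N) (f : R.OrdCocycles m) (g : R.OrdCocycles n),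
    ∃ z : R.OrdCocycles N, z.1 = R.ordCup n m N (by omega) g.1 f.1 ∧
      B.mul m n N h (R.ordCls m f ⊗ₜ R.ordCls n g) = R.ordCls N z

/-- The graded algebras `A` (on Hochschild cohomology in the Yetter–Drinfeld category) and `B`
(on ordinary Hochschild cohomology) are isomorphic as graded algebras in the Yetter–Drinfeld
category, through the map induced by `z ↦ ev(z ⊗ -)`. -/
def IsComparisonIso (E : R.HomObjects) (A : YDGradedAlgebra (HH E))
    (D : ∀ n, YDStruct k G (R.OrdHH n))
    (B : YDGradedAlgebra (fun n => (⟨R.OrdHH n, D n⟩ : YDModule k G)))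
    (κ : ∀ n, HH E n ≃ₗ[k] R.OrdHH n) : Prop :=
  (∀ n (z : cocycles E n), ∃ f : R.OrdCocycles n,
    (∀ v, f.1.toLin v = (E n).ev ((z : (E n).obj) ⊗ₜ v)) ∧ κ n (cls E n z) = R.ordCls n f) ∧
  (∀ n, IsHom (HH E n) ⟨R.OrdHH n, D n⟩ (κ n).toLinearMap) ∧
  κ 0 (A.one 1) = B.one 1 ∧
  ∀ m n N h x y, κ N (A.mul m n N h (x ⊗ₜ y)) = B.mul m n N h (κ m x ⊗ₜ κ n y)

end YDBialgebra

/-! Reduction to linear duals. For `V = R^{⊗ n}` the finiteness assumption identifies `G ⊗ V*` with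
the space of all linear maps `V → G` (`tmulEval_bijective`), and bijectivity of `S` allows one to
solve `S(f₍₋₁₎) f₍₀₎(v) = v₍₋₁₎ f(v₍₀₎)` for a coaction on `V*`. Together with the contragredient
action this makes `V*` a Yetter–Drinfeld module and an inner hom object `hom(V, I)`
(`isHom_unit_iff`, `dualInnerHom`). By the universal property, any other choice is identified with
`V*` through `z ↦ ev(z ⊗ -)` (`InnerHom.curry_ev_bijective`). The identification respects
differentials and turns the cup product of the category into the opposite of the usual one, because
the inner factors are evaluated first. Everything is therefore proved for ordinary cochains and then
transported to `HH E`.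

Algebra structure. Deconcatenation of words is coassociative (`splitTo_assoc`), and the bar
differential is a coderivation for it (`splitTo_bar`). Dually, the cup product is associative and
satisfies the Leibniz rule, so it descends to cohomology.

Commutativity. The comultiplication of `R` induces the codiagonal coaction `w ↦ w⁽¹⁾ ⊗ w⁽²⁾` from
`R^{⊗ n}` to `R^{⊗ n} ⊗ R`. Since `Δ` is multiplicative in the braided sense, this coaction commutes
with the inner faces. The outer faces do not: removing the first or last letter from `w⁽¹⁾` leaves a
braided left, or a right, multiplication of `w⁽²⁾` by that letter. An `n`-cocycle `g` thus gives
rise to the `R`-valued cochain `w ↦ g(w⁽¹⁾) w⁽²⁾`, and one inserts it into longer words as in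
Gerstenhaber's circle product: `insertion g` sums `± g(a₍₋₁₎ w⁽¹⁾) a₍₀₎ ⊗ w⁽²⁾ ⊗ b` over all
decompositions `(a, w, b)` of a word with `w` of length `n`. In the boundary of this sum, the
cocycle condition on `g` cancels the products of `w⁽²⁾` with the neighbouring letters of `a` and
`b`. Only the two extreme decompositions survive, `g(w) b` and `± g(a₍₋₁₎ w) a₍₀₎`
(`bar_insertion`). Applying a cocycle `f` shows that `g ∪ f` is cohomologous, up to the sign
`(-1)^{mn}`, to the product of the braided flip of `f ⊗ g` (`exists_homotopy`). -/

namespace HopfAlgebra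

/-! ### The antipode reverses the coproduct. -/

variable {k G : Type*} [CommRing k] [Ring G] [HopfAlgebra k G]

/-- The antipode is an anti-coalgebra map: `Δ(S h) = S h₍₂₎ ⊗ S h₍₁₎`. -/
theorem comul_antipode (h : G) :
    Coalgebra.comul (R := k) (antipode k h) =
      TensorProduct.map (antipode k) (antipode k)
        (TensorProduct.comm k G G (Coalgebra.comul (R := k) h)) := by
  have key : WithConv.toConv ((Coalgebra.comul (R := k) (A := G)) ∘ₗ antipode k) =
      WithConv.toConv (TensorProduct.map (antipode k) (antipode k) ∘ₗ
        (TensorProduct.comm k G G).toLinearMap ∘ₗ Coalgebra.comul (R := k) (A := G)) := by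
    symm
    -- In the convolution algebra `Hom(G, G ⊗ G)` a left and a right inverse of `Δ` coincide. That
    -- `Δ ∘ S` is a right inverse is known; the left inverse has to be computed.
    refine left_inv_eq_right_inv (a := WithConv.toConv (Coalgebra.comul (R := k) (A := G))) ?_
      LinearMap.comul_right_inv
    apply WithConv.ofConv_injective
    refine LinearMap.ext fun h => ?_
    -- `x ⊗ y ↦ (S x₍₂₎ ⊗ S x₍₁₎) y`
    let M : G ⊗[k] G →ₗ[k] (G ⊗[k] G) →ₗ[k] G ⊗[k] G :=
      LinearMap.mul k (G ⊗[k] G) ∘ₗ TensorProduct.map (antipode k) (antipode k) ∘ₗ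
        (TensorProduct.comm k G G).toLinearMap
    -- `Q (a ⊗ b ⊗ c ⊗ d) = S(b) c ⊗ S(a) d`. On the fourfold coproduct the middle pair collapses to
    -- a counit first (`e2`), which leaves `S(h₍₁₎) h₍₂₎` in the second factor (`e4`).
    let Q : G ⊗[k] (G ⊗[k] (G ⊗[k] G)) →ₗ[k] G ⊗[k] G :=
      TensorProduct.lift M ∘ₗ (TensorProduct.assoc k G G (G ⊗[k] G)).symm.toLinearMap
    have e1 : ∀ y : G ⊗[k] G, TensorProduct.lift M (TensorProduct.map Coalgebra.comul
        Coalgebra.comul y) = Q ((Coalgebra.comul.lTensor G).lTensor G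
          (TensorProduct.assoc k G G G (Coalgebra.comul.rTensor G y))) := by
      intro y
      induction y with
      | zero => simp
      | add a b ha hb => simp only [map_add, ha, hb]
      | tmul a b =>
        simp only [TensorProduct.map_tmul, LinearMap.rTensor_tmul]
        generalize (Coalgebra.comul (R := k) a : G ⊗[k] G) = z
        induction z with
        | zero => simp
        | add a b ha hb => simp only [TensorProduct.add_tmul, map_add, ha, hb]
        | tmul c d => simp [Q]
    have e2 : ∀ (a : G) (w : G ⊗[k] G), Q (a ⊗ₜ TensorProduct.assoc k G G G
        (Coalgebra.comul.rTensor G w)) =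
        1 ⊗ₜ (antipode k a * TensorProduct.lid k G (Coalgebra.counit.rTensor G w)) := by
      intro a w
      induction w with
      | zero => simp
      | add b c hb hc => simp only [map_add, TensorProduct.tmul_add, mul_add, hb, hc]
      | tmul p d =>
        have e3 : ∀ z : G ⊗[k] G, Q (a ⊗ₜ TensorProduct.assoc k G G G (z ⊗ₜ d)) =
            LinearMap.mul' k G ((antipode k).rTensor G z) ⊗ₜ (antipode k a * d) := by
          intro z
          induction z with
          | zero => simp
          | add b c hb hc => simp only [TensorProduct.add_tmul, TensorProduct.tmul_add, map_add,
              hb, hc]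
          | tmul b c => simp [Q, M]
        simp only [LinearMap.rTensor_tmul, e3, mul_antipode_rTensor_comul_apply,
          TensorProduct.lid_tmul, Algebra.algebraMap_eq_smul_one, TensorProduct.smul_tmul,
          mul_smul_comm]
    have e4 : ∀ y : G ⊗[k] G, Q ((Coalgebra.comul.lTensor G).lTensor G
        (Coalgebra.comul.lTensor G y)) =
        1 ⊗ₜ LinearMap.mul' k G ((antipode k).rTensor G y) := by
      intro y
      induction y with
      | zero => simp
      | add a b ha hb => simp only [map_add, TensorProduct.tmul_add, ha, hb]
      | tmul a z =>
        rw [LinearMap.lTensor_tmul, LinearMap.lTensor_tmul, ← Coalgebra.coassoc_apply, e2]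
        simp
    have e5 : ∀ y : G ⊗[k] G, TensorProduct.lift M (TensorProduct.map Coalgebra.comul
        Coalgebra.comul y) = LinearMap.mul' k (G ⊗[k] G) (TensorProduct.map
          (TensorProduct.map (antipode k) (antipode k) ∘ₗ
            (TensorProduct.comm k G G).toLinearMap ∘ₗ Coalgebra.comul (R := k) (A := G))
          Coalgebra.comul y) := by
      intro y
      induction y with
      | zero => simp
      | add a b ha hb => simp only [map_add, ha, hb]
      | tmul a b => simp [M]
    rw [LinearMap.convMul_apply, LinearMap.convOne_apply]
    simp only
    rw [← e5, e1, Coalgebra.coassoc_apply, e4, mul_antipode_rTensor_comul_apply,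
      Algebra.algebraMap_eq_smul_one, Algebra.algebraMap_eq_smul_one,
      Algebra.TensorProduct.one_def, TensorProduct.tmul_smul]
  exact LinearMap.congr_fun (congrArg WithConv.ofConv key) h

end HopfAlgebra

/-! ### Tensors in `M ⊗ V*` as linear maps `V → M`. -/

section tmulEval

variable {k : Type*} [Field k] (V M : Type*) [AddCommGroup V] [Module k V] [AddCommGroup M]
  [Module k M]

/-- The map `M ⊗ V* → Hom(V, M)`. -/
def tmulEval : M ⊗[k] (V →ₗ[k] k) →ₗ[k] V →ₗ[k] M :=
  TensorProduct.lift (LinearMap.smulRightₗ).flip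

variable {V M}

@[simp] theorem tmulEval_tmul (m : M) (f : V →ₗ[k] k) (v : V) :
    tmulEval V M (m ⊗ₜ f) v = f v • m := by
  simp [tmulEval]

/-- A tensor is a finite sum of `b i ⊗ c i` over a basis of `M`. If all its values vanish, linear
independence gives `c i v = 0` for each `v`. No finiteness is needed for this half. -/
theorem tmulEval_injective : Function.Injective (tmulEval (k := k) V M) := by
  rw [← LinearMap.ker_eq_bot, LinearMap.ker_eq_bot']
  intro t ht
  classical
  let b := Module.Basis.ofVectorSpace k M
  obtain ⟨c, rfl⟩ := (TensorProduct.equivFinsuppOfBasisLeft b).symm.surjective t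
  suffices c = 0 by simp [this]
  ext i v
  have h := LinearMap.congr_fun ht v
  rw [TensorProduct.equivFinsuppOfBasisLeft_symm_apply, Finsupp.sum, map_sum,
    LinearMap.sum_apply] at h
  simp only [tmulEval_tmul, LinearMap.zero_apply] at h
  by_cases hi : i ∈ c.support
  · exact linearIndependent_iff'.1 b.linearIndependent c.support (fun i => c i v) h i hi
  · simp [Finsupp.notMem_support_iff.1 hi]

/-- The image consists of the maps of finite rank, which are all maps as soon as source or target is
finite dimensional. This is where the finiteness assumption of the main theorem is used. -/
theorem tmulEval_bijective (h : FiniteDimensional k M ∨ FiniteDimensional k V) :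
    Function.Bijective (tmulEval (k := k) V M) := by
  refine ⟨tmulEval_injective, fun φ => ?_⟩
  rcases h with h | h
  · let b := Module.finBasis k M
    refine ⟨∑ i, b i ⊗ₜ (b.coord i ∘ₗ φ), LinearMap.ext fun v => ?_⟩
    simp
  · let b := Module.finBasis k V
    refine ⟨∑ i, φ (b i) ⊗ₜ b.coord i, LinearMap.ext fun v => ?_⟩
    conv_rhs => rw [← b.sum_repr v, map_sum]
    simp

end tmulEval

/-! ### The dual Yetter–Drinfeld module. -/

namespace YDModule

variable {k G : Type u} [Field k] [Ring G] [HopfAlgebra k G]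

section dual

variable (hS : Function.Bijective (HopfAlgebra.antipode k : G →ₗ[k] G)) (V : YDModule k G)
  (hfin : FiniteDimensional k G ∨ FiniteDimensional k V)

/-- The contragredient action `(g f)(v) = f(S(g) v)`. -/
def dualAct : G →ₐ[k] Module.End k (V →ₗ[k] k) where
  toFun g := LinearMap.lcomp k k (V.act (HopfAlgebra.antipode k g))
  map_one' := by ext; simp
  map_mul' a b := by ext; simp [HopfAlgebra.antipode_mul_antidistrib]
  map_zero' := by ext; simp
  map_add' a b := by ext; simp
  commutes' c := by ext; simp [Algebra.algebraMap_eq_smul_one]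

@[simp] theorem dualAct_apply (g : G) (f : V →ₗ[k] k) (v : V) :
    dualAct V g f v = f (V.act (HopfAlgebra.antipode k g) v) := rfl

/-- The linear map `v ↦ v₍₋₁₎ f(v₍₀₎)`. -/
def coactEval : (V →ₗ[k] k) →ₗ[k] V →ₗ[k] G where
  toFun f := (TensorProduct.rid k G).toLinearMap ∘ₗ f.lTensor G ∘ₗ V.coact
  map_add' f g := by ext; simp [LinearMap.lTensor_add]
  map_smul' c f := by ext; simp [LinearMap.lTensor_smul]

theorem coactEval_apply (f : V →ₗ[k] k) (v : V) :
    coactEval V f v = TensorProduct.rid k G (f.lTensor G (V.coact v)) := rfl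

/-- The coaction on the dual, determined by `S(f₍₋₁₎) f₍₀₎(v) = v₍₋₁₎ f(v₍₀₎)`. -/
noncomputable def dualCoact : (V →ₗ[k] k) →ₗ[k] G ⊗[k] (V →ₗ[k] k) :=
  (LinearEquiv.ofBijective (tmulEval (k := k) V G) (tmulEval_bijective hfin)).symm.toLinearMap ∘ₗ
    LinearMap.llcomp k V G G (LinearEquiv.ofBijective _ hS).symm.toLinearMap ∘ₗ coactEval V

/-- The defining equation of the coaction, with `S` kept on the left so that later computations need
no identities for `S⁻¹`. -/
theorem antipode_tmulEval_dualCoact (f : V →ₗ[k] k) (v : V) :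
    HopfAlgebra.antipode k (tmulEval V G (dualCoact hS V hfin f) v) = coactEval V f v := by
  have h := (LinearEquiv.ofBijective (tmulEval (k := k) V G)
    (tmulEval_bijective hfin)).apply_symm_apply
    (LinearMap.llcomp k V G G (LinearEquiv.ofBijective _ hS).symm.toLinearMap (coactEval V f))
  have h' := LinearMap.congr_fun h v
  rw [LinearEquiv.ofBijective_apply] at h'
  change HopfAlgebra.antipode k (tmulEval V G ((LinearEquiv.ofBijective (tmulEval (k := k) V G)
    (tmulEval_bijective hfin)).symm _) v) = _
  rw [LinearMap.comp_apply, h']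
  exact (LinearEquiv.ofBijective _ hS).apply_symm_apply _

/-- Serves to check identities in `G ⊗ V*` by evaluating at `v` and applying `S`, after which
`antipode_tmulEval_dualCoact` turns them into identities for the coaction of `V`. -/
theorem ext_antipode_tmulEval (hS : Function.Bijective (HopfAlgebra.antipode k : G →ₗ[k] G))
    {V : Type u} [AddCommGroup V] [Module k V] {s t : G ⊗[k] (V →ₗ[k] k)}
    (h : ∀ v, HopfAlgebra.antipode k (tmulEval V G s v) =
      HopfAlgebra.antipode k (tmulEval V G t v)) : s = t :=
  tmulEval_injective (LinearMap.ext fun v => hS.1 (h v))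

/-- Evaluated at `v`, and after applying `S ⊗ S` and the flip, both sides become the twofold
coaction of `v` with `f` applied to its last component, so coassociativity is inherited from `V`. -/
theorem dualCoact_coassoc (f : V →ₗ[k] k) :
    TensorProduct.assoc k G G (V →ₗ[k] k)
      ((Coalgebra.comul (R := k)).rTensor (V →ₗ[k] k) (dualCoact hS V hfin f)) =
    (dualCoact hS V hfin).lTensor G (dualCoact hS V hfin f) := by
  apply (TensorProduct.assoc k G G (V →ₗ[k] k)).symm.injective
  rw [LinearEquiv.symm_apply_apply]
  apply tmulEval_injective
  refine LinearMap.ext fun v => ?_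
  have hSS : Function.Injective (TensorProduct.map (HopfAlgebra.antipode k (A := G))
      (HopfAlgebra.antipode k (A := G))) :=
    (TensorProduct.congr (LinearEquiv.ofBijective _ hS) (LinearEquiv.ofBijective _ hS)).injective
  apply hSS
  -- The flip compensates for the reversal of the coproduct by `S`.
  apply (TensorProduct.comm k G G).injective
  let Φ : G ⊗[k] (G ⊗[k] V) →ₗ[k] G ⊗[k] G :=
    ((TensorProduct.rid k G).toLinearMap ∘ₗ f.lTensor G).lTensor G
  have e1 : ∀ t : G ⊗[k] (V →ₗ[k] k), TensorProduct.comm k G G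
      (TensorProduct.map (HopfAlgebra.antipode k) (HopfAlgebra.antipode k)
        (tmulEval V (G ⊗[k] G) ((Coalgebra.comul (R := k)).rTensor (V →ₗ[k] k) t) v)) =
      Coalgebra.comul (R := k) (HopfAlgebra.antipode k (tmulEval V G t v)) := by
    intro t
    induction t with
    | zero => simp
    | add a b ha hb => simp only [map_add, LinearMap.add_apply, ha, hb]
    | tmul a f' => simp [HopfAlgebra.comul_antipode, TensorProduct.map_comm]
  have e2 : ∀ p : G ⊗[k] V, Coalgebra.comul (R := k) (TensorProduct.rid k G (f.lTensor G p)) =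
      Φ (TensorProduct.assoc k G G V ((Coalgebra.comul (R := k)).rTensor V p)) := by
    intro p
    induction p with
    | zero => simp
    | add a b ha hb => simp only [map_add, ha, hb]
    | tmul a v =>
      simp only [LinearMap.lTensor_tmul, TensorProduct.rid_tmul, map_smul, LinearMap.rTensor_tmul]
      generalize (Coalgebra.comul (R := k) a : G ⊗[k] G) = z
      induction z with
      | zero => simp
      | add a b ha hb => simp only [TensorProduct.add_tmul, smul_add, map_add, ha, hb]
      | tmul a b => simp [Φ]
  have e3 : ∀ t : G ⊗[k] (V →ₗ[k] k), TensorProduct.comm k G G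
      (TensorProduct.map (HopfAlgebra.antipode k) (HopfAlgebra.antipode k)
        (tmulEval V (G ⊗[k] G) ((TensorProduct.assoc k G G (V →ₗ[k] k)).symm
          ((dualCoact hS V hfin).lTensor G t)) v)) =
      (HopfAlgebra.antipode k ∘ₗ (tmulEval V G t)).lTensor G (V.coact v) := by
    intro t
    induction t with
    | zero => simp
    | add a b ha hb =>
      simp only [map_add, LinearMap.add_apply, LinearMap.comp_add, LinearMap.lTensor_add, ha, hb]
    | tmul a f' =>
      have e4 : ∀ s : G ⊗[k] (V →ₗ[k] k), TensorProduct.comm k G G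
          (TensorProduct.map (HopfAlgebra.antipode k) (HopfAlgebra.antipode k)
            (tmulEval V (G ⊗[k] G) ((TensorProduct.assoc k G G (V →ₗ[k] k)).symm
              (a ⊗ₜ s)) v)) =
          HopfAlgebra.antipode k (tmulEval V G s v) ⊗ₜ HopfAlgebra.antipode k a := by
        intro s
        induction s with
        | zero => simp
        | add a b ha hb => simp only [TensorProduct.tmul_add, TensorProduct.add_tmul, map_add,
            LinearMap.add_apply, ha, hb]
        | tmul b f' => simp [TensorProduct.smul_tmul']
      rw [LinearMap.lTensor_tmul, e4, antipode_tmulEval_dualCoact, coactEval_apply]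
      generalize V.coact v = p
      induction p with
      | zero => simp
      | add a b ha hb => simp only [TensorProduct.add_tmul, map_add, ha, hb]
      | tmul b w => simp [TensorProduct.smul_tmul]
  rw [e1, e3, antipode_tmulEval_dualCoact, coactEval_apply, e2, V.str.coassoc]
  have e5 : HopfAlgebra.antipode k ∘ₗ tmulEval V G (dualCoact hS V hfin f) = coactEval V f :=
    LinearMap.ext fun v => antipode_tmulEval_dualCoact hS V hfin f v
  rw [e5, ← LinearMap.lTensor_comp_apply]
  rfl

theorem dualCoact_counit (f : V →ₗ[k] k) :
    TensorProduct.lid k (V →ₗ[k] k) ((Coalgebra.counit (R := k) (A := G)).rTensor (V →ₗ[k] k)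
      (dualCoact hS V hfin f)) = f := by
  refine LinearMap.ext fun v => ?_
  have e1 : ∀ t : G ⊗[k] (V →ₗ[k] k), TensorProduct.lid k (V →ₗ[k] k)
      ((Coalgebra.counit (R := k) (A := G)).rTensor (V →ₗ[k] k) t) v =
      Coalgebra.counit (R := k) (HopfAlgebra.antipode k (tmulEval V G t v)) := by
    intro t
    induction t with
    | zero => simp
    | add a b ha hb => simp only [map_add, LinearMap.add_apply, ha, hb]
    | tmul a f' => simp [mul_comm]
  have e2 : ∀ p : G ⊗[k] V, Coalgebra.counit (R := k) (TensorProduct.rid k G (f.lTensor G p)) =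
      f (TensorProduct.lid k V ((Coalgebra.counit (R := k) (A := G)).rTensor V p)) := by
    intro p
    induction p with
    | zero => simp
    | add a b ha hb => simp only [map_add, ha, hb]
    | tmul a v => simp [mul_comm]
  rw [e1, antipode_tmulEval_dualCoact, coactEval_apply, e2, V.str.counit_coact]

/-- Evaluated at `v` and after `S`, this is the compatibility of `V` at `S(h)` with its two sides
exchanged. The match rests on `Δ(S h) = S h₍₂₎ ⊗ S h₍₁₎`. -/
theorem dual_compat (h : G) (f : V →ₗ[k] k) :
    TensorProduct.map (LinearMap.mul' k G) (TensorProduct.lift (dualAct V).toLinearMap)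
      (TensorProduct.tensorTensorTensorComm k G G G (V →ₗ[k] k)
        (Coalgebra.comul (R := k) h ⊗ₜ dualCoact hS V hfin f)) =
    (LinearMap.mul' k G).rTensor (V →ₗ[k] k) (TensorProduct.rightComm k G (V →ₗ[k] k) G
      ((dualCoact hS V hfin ∘ₗ (dualAct V).toLinearMap.flip f).rTensor G
        (Coalgebra.comul (R := k) h))) := by
  apply ext_antipode_tmulEval hS
  intro v
  have e1 : ∀ (a b : G) (t : G ⊗[k] (V →ₗ[k] k)), HopfAlgebra.antipode k (tmulEval V G
      (TensorProduct.map (LinearMap.mul' k G) (TensorProduct.lift (dualAct V).toLinearMap)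
        (TensorProduct.tensorTensorTensorComm k G G G (V →ₗ[k] k) ((a ⊗ₜ b) ⊗ₜ t))) v) =
      HopfAlgebra.antipode k (tmulEval V G t (V.act (HopfAlgebra.antipode k b) v)) *
        HopfAlgebra.antipode k a := by
    intro a b t
    induction t with
    | zero => simp
    | add c d hc hd =>
      simp only [TensorProduct.tmul_add, map_add, LinearMap.add_apply, add_mul, hc, hd]
    | tmul c f' => simp [HopfAlgebra.antipode_mul_antidistrib]
  have e2 : ∀ (b : G) (p : G ⊗[k] V), TensorProduct.rid k G (f.lTensor G p) * b =
      TensorProduct.rid k G (f.lTensor G ((LinearMap.mulRight k b).rTensor V p)) := by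
    intro b p
    induction p with
    | zero => simp
    | add c d hc hd => simp only [map_add, add_mul, hc, hd]
    | tmul c w => simp
  have e3 : ∀ (b : G) (t : G ⊗[k] (V →ₗ[k] k)), HopfAlgebra.antipode k (tmulEval V G
      ((LinearMap.mul' k G).rTensor (V →ₗ[k] k) (TensorProduct.rightComm k G (V →ₗ[k] k) G
        (t ⊗ₜ b))) v) =
      HopfAlgebra.antipode k b * HopfAlgebra.antipode k (tmulEval V G t v) := by
    intro b t
    induction t with
    | zero => simp
    | add c d hc hd =>
      simp only [TensorProduct.add_tmul, map_add, LinearMap.add_apply, mul_add, hc, hd]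
    | tmul c f' => simp [HopfAlgebra.antipode_mul_antidistrib]
  have e4 : ∀ (a b : G) (p : G ⊗[k] V),
      b * TensorProduct.rid k G ((dualAct V a f).lTensor G p) =
      TensorProduct.rid k G (f.lTensor G (leftMul V.str (b ⊗ₜ HopfAlgebra.antipode k a) p)) := by
    intro a b p
    induction p with
    | zero => simp
    | add c d hc hd => simp only [map_add, mul_add, hc, hd]
    | tmul c w => simp [leftMul_tmul]
  have e5 : ∀ y : G ⊗[k] G, HopfAlgebra.antipode k (tmulEval V G
      (TensorProduct.map (LinearMap.mul' k G) (TensorProduct.lift (dualAct V).toLinearMap)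
        (TensorProduct.tensorTensorTensorComm k G G G (V →ₗ[k] k)
          (y ⊗ₜ dualCoact hS V hfin f))) v) =
      TensorProduct.rid k G (f.lTensor G (rightMul V.str v (TensorProduct.map
        (HopfAlgebra.antipode k) (HopfAlgebra.antipode k) (TensorProduct.comm k G G y)))) := by
    intro y
    induction y with
    | zero => simp
    | add a b ha hb =>
      simp only [TensorProduct.add_tmul, map_add, LinearMap.add_apply, ha, hb]
    | tmul a b =>
      rw [e1, antipode_tmulEval_dualCoact, coactEval_apply, e2, TensorProduct.comm_tmul,
        TensorProduct.map_tmul, rightMul_tmul]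
  have e6 : ∀ y : G ⊗[k] G, HopfAlgebra.antipode k (tmulEval V G
      ((LinearMap.mul' k G).rTensor (V →ₗ[k] k) (TensorProduct.rightComm k G (V →ₗ[k] k) G
        ((dualCoact hS V hfin ∘ₗ (dualAct V).toLinearMap.flip f).rTensor G y))) v) =
      TensorProduct.rid k G (f.lTensor G (leftMul V.str (TensorProduct.map
        (HopfAlgebra.antipode k) (HopfAlgebra.antipode k) (TensorProduct.comm k G G y))
          (V.coact v))) := by
    intro y
    induction y with
    | zero => simp
    | add a b ha hb => simp only [map_add, LinearMap.add_apply, ha, hb]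
    | tmul a b =>
      rw [LinearMap.rTensor_tmul, e3, LinearMap.comp_apply, LinearMap.flip_apply,
        AlgHom.toLinearMap_apply, antipode_tmulEval_dualCoact, coactEval_apply, e4,
        TensorProduct.comm_tmul, TensorProduct.map_tmul]
  rw [e5, e6, ← HopfAlgebra.comul_antipode, leftMul_comul]

/-- The dual of a Yetter–Drinfeld module, with `(g f)(v) = f(S(g) v)` and
`f₍₋₁₎ f₍₀₎(v) = S⁻¹(v₍₋₁₎) f(v₍₀₎)`. -/
noncomputable abbrev dual : YDModule k G where
  carrier := V →ₗ[k] k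
  str :=
    { act := dualAct V
      coact := dualCoact hS V hfin
      coassoc := dualCoact_coassoc hS V hfin
      counit_coact := dualCoact_counit hS V hfin
      compat := dual_compat hS V hfin }

end dual

end YDModule

/-! ### Duals as inner hom objects. -/

namespace YDModule

variable {k G : Type u} [Field k] [Ring G] [HopfAlgebra k G]

theorem unit_act_apply (g : G) (c : k) :
    (unit k G).act g c = Coalgebra.counit (R := k) g * c := by
  change (Algebra.ofId k (Module.End k k)) (Coalgebra.counit (R := k) g) c = _
  simp [Algebra.ofId_apply, Algebra.algebraMap_eq_smul_one]

theorem rid_unit_coact (c : k) : TensorProduct.rid k G ((unit k G).coact c) = c • (1 : G) := by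
  change TensorProduct.rid k G ((1 : G) ⊗ₜ c) = _
  simp

/-- `k`-valued morphisms `φ` on `X ⊗ V`, characterized by `φ(g x ⊗ v) = φ(x ⊗ S(g) v)` and
`S(x₍₋₁₎) φ(x₍₀₎ ⊗ v) = v₍₋₁₎ φ(x ⊗ v₍₀₎)`. -/
theorem isHom_unit_iff (hS : Function.Bijective (HopfAlgebra.antipode k : G →ₗ[k] G))
    {X V : YDModule k G} (φ : X ⊗[k] V →ₗ[k] k) :
    IsHom (X.tensor V) (unit k G) φ ↔
      (∀ (g : G) (x : X) (v : V), φ (X.act g x ⊗ₜ v) =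
        φ (x ⊗ₜ V.act (HopfAlgebra.antipode k g) v)) ∧
      ∀ (x : X) (v : V), HopfAlgebra.antipode k (tmulEval V G
        ((TensorProduct.curry φ).lTensor G (X.coact x)) v) =
          coactEval V (TensorProduct.curry φ x) v := by
  -- `B x v (a ⊗ b) = φ(a x ⊗ b v)`
  let B : X → V → G ⊗[k] G →ₗ[k] k := fun x v => φ ∘ₗ
    TensorProduct.map (X.act.toLinearMap.flip x) (V.act.toLinearMap.flip v)
  have hB : ∀ (h : G) (x : X) (v : V), φ ((X.tensor V).act h (x ⊗ₜ v)) =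
      B x v (Coalgebra.comul (R := k) h) := by
    intro h x v
    change φ (tensorAct X.str V.str h (x ⊗ₜ v)) = _
    rw [tensorAct_apply]
    generalize (Coalgebra.comul (R := k) h : G ⊗[k] G) = z
    induction z with
    | zero => simp
    | add a b ha hb => simp only [map_add, LinearMap.add_apply, ha, hb]
    | tmul a b => simp [B]
  -- `C (p ⊗ q) = p₋₁ q₋₁ φ(p₀ ⊗ q₀)`
  let C : (G ⊗[k] X) ⊗[k] (G ⊗[k] V) →ₗ[k] G :=
    (TensorProduct.rid k G).toLinearMap ∘ₗ φ.lTensor G ∘ₗ codiag k G X V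
  have hC : ∀ (x : X) (v : V), TensorProduct.rid k G (φ.lTensor G ((X.tensor V).coact (x ⊗ₜ v))) =
      C (X.coact x ⊗ₜ V.coact v) := fun _ _ => rfl
  constructor
  · intro hφ
    have hA : ∀ (h : G) (x : X) (v : V), B x v (Coalgebra.comul (R := k) h) =
        Coalgebra.counit (R := k) h * φ (x ⊗ₜ v) := by
      intro h x v
      rw [← hB, hφ.map_act, unit_act_apply]
    have hD : ∀ (x : X) (v : V), C (X.coact x ⊗ₜ V.coact v) = φ (x ⊗ₜ v) • (1 : G) := by
      intro x v
      rw [← hC, ← hφ.map_coact, rid_unit_coact]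
    constructor
    · intro g x v
      -- `Q (a ⊗ b ⊗ c) = φ(a x ⊗ b S(c) v)`. On the threefold coproduct of `g`, collapsing `b S(c)`
      -- gives `φ(g x ⊗ v)`, while invariance of `φ` under the first two factors gives `φ(x ⊗ S(g)
      -- v)`.
      let Q : G ⊗[k] (G ⊗[k] G) →ₗ[k] k := φ ∘ₗ TensorProduct.map (X.act.toLinearMap.flip x)
        (V.act.toLinearMap.flip v ∘ₗ LinearMap.mul' k G ∘ₗ (HopfAlgebra.antipode k).lTensor G)
      have e1 : ∀ y : G ⊗[k] G, Q (Coalgebra.comul.lTensor G y) =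
          φ (X.act (TensorProduct.rid k G (Coalgebra.counit.lTensor G y)) x ⊗ₜ v) := by
        intro y
        induction y with
        | zero => simp
        | add a b ha hb => simp only [map_add, LinearMap.add_apply, TensorProduct.add_tmul, ha, hb]
        | tmul a b =>
          simp [Q, Algebra.algebraMap_eq_smul_one, TensorProduct.tmul_smul, TensorProduct.smul_tmul']
      have e2 : ∀ y : G ⊗[k] G, Q (TensorProduct.assoc k G G G (Coalgebra.comul.rTensor G y)) =
          φ (x ⊗ₜ V.act (HopfAlgebra.antipode k
            (TensorProduct.lid k G (Coalgebra.counit.rTensor G y))) v) := by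
        intro y
        induction y with
        | zero => simp
        | add a b ha hb => simp only [map_add, LinearMap.add_apply, TensorProduct.tmul_add, ha, hb]
        | tmul a b =>
          have e3 : ∀ z : G ⊗[k] G, Q (TensorProduct.assoc k G G G (z ⊗ₜ b)) =
              B x (V.act (HopfAlgebra.antipode k b) v) z := by
            intro z
            induction z with
            | zero => simp
            | add c d hc hd => simp only [TensorProduct.add_tmul, map_add, hc, hd]
            | tmul c d => simp [Q, B]
          rw [LinearMap.rTensor_tmul, e3, hA]
          simp [TensorProduct.tmul_smul]
      have h1 := e1 (Coalgebra.comul (R := k) g)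
      rw [← Coalgebra.coassoc_apply, e2] at h1
      simpa using h1.symm
    · intro x v
      -- `a ⊗ (b ⊗ y) ↦ S(a) b v₋₁ φ(y ⊗ v₀)`
      let Q : G ⊗[k] (G ⊗[k] X) →ₗ[k] G := LinearMap.mul' k G ∘ₗ
        TensorProduct.map (HopfAlgebra.antipode k)
          (C ∘ₗ (TensorProduct.mk k _ _).flip (V.coact v))
      have e1 : ∀ p : G ⊗[k] X, Q (X.coact.lTensor G p) =
          HopfAlgebra.antipode k (tmulEval V G ((TensorProduct.curry φ).lTensor G p) v) := by
        intro p
        induction p with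
        | zero => simp
        | add a b ha hb => simp only [map_add, LinearMap.add_apply, ha, hb]
        | tmul a y => simp [Q, hD]
      have e2 : ∀ p : G ⊗[k] X, Q (TensorProduct.assoc k G G X (Coalgebra.comul.rTensor X p)) =
          coactEval V (TensorProduct.curry φ
            (TensorProduct.lid k X (Coalgebra.counit.rTensor X p))) v := by
        intro p
        induction p with
        | zero => simp
        | add a b ha hb => simp only [map_add, LinearMap.add_apply, ha, hb]
        | tmul a y =>
          have e4 : ∀ (b : G) (q : G ⊗[k] V), C ((b ⊗ₜ y) ⊗ₜ q) =
              b * TensorProduct.rid k G ((TensorProduct.curry φ y).lTensor G q) := by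
            intro b q
            induction q with
            | zero => simp
            | add c d hc hd => simp only [TensorProduct.tmul_add, map_add, mul_add, hc, hd]
            | tmul c w => simp [C]
          have e3 : ∀ z : G ⊗[k] G, Q (TensorProduct.assoc k G G X (z ⊗ₜ y)) =
              LinearMap.mul' k G ((HopfAlgebra.antipode k).rTensor G z) *
                coactEval V (TensorProduct.curry φ y) v := by
            intro z
            induction z with
            | zero => simp
            | add c d hc hd => simp only [TensorProduct.add_tmul, map_add, add_mul, hc, hd]
            | tmul c d => simp [Q, e4, coactEval_apply, mul_assoc]
          simp [e3, Algebra.algebraMap_eq_smul_one]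
      rw [← e1, ← X.str.coassoc, e2, X.str.counit_coact]
  · rintro ⟨h1, h2⟩
    constructor
    · intro g t
      induction t using TensorProduct.induction_on with
      | zero => simp
      | add a b ha hb => simp only [map_add, ha, hb]
      | tmul x v =>
        -- Moving `a` across gives `φ(a x ⊗ b v) = φ(x ⊗ S(a) b v)`, and `S(h₍₁₎) h₍₂₎` is the
        -- counit.
        have e1 : ∀ z : G ⊗[k] G, B x v z =
            φ (x ⊗ₜ V.act (LinearMap.mul' k G ((HopfAlgebra.antipode k).rTensor G z)) v) := by
          intro z
          induction z with
          | zero => simp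
          | add a b ha hb => simp only [map_add, LinearMap.add_apply, TensorProduct.tmul_add, ha, hb]
          | tmul a b => simp [B, h1]
        rw [hB, e1, unit_act_apply]
        simp [Algebra.algebraMap_eq_smul_one]
    · intro t
      induction t using TensorProduct.induction_on with
      | zero => simp
      | add a b ha hb => simp only [map_add, ha, hb]
      | tmul x v =>
        apply (TensorProduct.rid k G).injective
        -- After `S` the expression reads `S(v₍₋₁₎) S(x₍₋₁₎) φ(x₍₀₎ ⊗ v₍₀₎)`. The hypothesis
        -- replaces the last two factors by a second coaction on `v`, and `S(v₍₋₂₎) v₍₋₁₎`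
        -- collapses.
        apply hS.1
        rw [hC]
        have e1 : ∀ (p : G ⊗[k] X) (q : G ⊗[k] V), HopfAlgebra.antipode k (C (p ⊗ₜ q)) =
            LinearMap.mul' k G (TensorProduct.map (HopfAlgebra.antipode k)
              (HopfAlgebra.antipode k ∘ₗ
                tmulEval V G ((TensorProduct.curry φ).lTensor G p)) q) := by
          intro p q
          induction q with
          | zero => simp
          | add c d hc hd => simp only [TensorProduct.tmul_add, map_add, hc, hd]
          | tmul c w =>
            induction p with
            | zero => simp
            | add a b ha hb =>
              simp only [TensorProduct.add_tmul, map_add, ha, hb, LinearMap.comp_add,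
                TensorProduct.map_add_right, LinearMap.add_apply]
            | tmul a y => simp [C, HopfAlgebra.antipode_mul_antidistrib]
        have e2 : HopfAlgebra.antipode k ∘ₗ
            tmulEval V G ((TensorProduct.curry φ).lTensor G (X.coact x)) =
              coactEval V (TensorProduct.curry φ x) := LinearMap.ext (h2 x)
        let Q : G ⊗[k] (G ⊗[k] V) →ₗ[k] G := LinearMap.mul' k G ∘ₗ
          TensorProduct.map (HopfAlgebra.antipode k) ((TensorProduct.rid k G).toLinearMap ∘ₗ
            (TensorProduct.curry φ x).lTensor G)
        have e3 : ∀ q : G ⊗[k] V, LinearMap.mul' k G (TensorProduct.map (HopfAlgebra.antipode k)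
            (coactEval V (TensorProduct.curry φ x)) q) = Q (V.coact.lTensor G q) := by
          intro q
          induction q with
          | zero => simp
          | add c d hc hd => simp only [map_add, hc, hd]
          | tmul c w => simp [Q, coactEval_apply]
        have e4 : ∀ q : G ⊗[k] V, Q (TensorProduct.assoc k G G V (Coalgebra.comul.rTensor V q)) =
            φ (x ⊗ₜ TensorProduct.lid k V (Coalgebra.counit.rTensor V q)) • (1 : G) := by
          intro q
          induction q with
          | zero => simp
          | add c d hc hd => simp only [map_add, TensorProduct.tmul_add, add_smul, hc, hd]
          | tmul c w =>
            have e5 : ∀ z : G ⊗[k] G, Q (TensorProduct.assoc k G G V (z ⊗ₜ w)) =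
                φ (x ⊗ₜ w) • LinearMap.mul' k G ((HopfAlgebra.antipode k).rTensor G z) := by
              intro z
              induction z with
              | zero => simp
              | add c d hc hd => simp only [TensorProduct.add_tmul, map_add, smul_add, hc, hd]
              | tmul c d => simp [Q]
            simp [e5, Algebra.algebraMap_eq_smul_one, smul_smul, mul_comm]
        rw [e1, e2, e3, ← V.str.coassoc, e4, V.str.counit_coact,
          rid_unit_coact]
        simp

section dual

variable (hS : Function.Bijective (HopfAlgebra.antipode k : G →ₗ[k] G)) (V : YDModule k G)
  (hfin : FiniteDimensional k G ∨ FiniteDimensional k V)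

/-- The two conditions of `isHom_unit_iff` are `G`-linearity and `G`-colinearity of `ψ` into the
dual, evaluated at `v`. -/
theorem isHom_dual_iff {X : YDModule k G} (ψ : X →ₗ[k] V →ₗ[k] k) :
    IsHom X (dual hS V hfin) ψ ↔
      IsHom (X.tensor V) (unit k G) (TensorProduct.lift ψ) := by
  rw [isHom_unit_iff hS]
  have h : TensorProduct.curry (TensorProduct.lift ψ) = ψ := by ext; simp
  constructor
  · intro hψ
    refine ⟨fun g x v => ?_, fun x v => ?_⟩
    · exact LinearMap.congr_fun (hψ.map_act g x) v
    · rw [h, ← hψ.map_coact]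
      exact antipode_tmulEval_dualCoact hS V hfin (ψ x) v
  · rintro ⟨h1, h2⟩
    rw [h] at h2
    refine ⟨fun g x => LinearMap.ext fun v => ?_, fun x => ?_⟩
    · exact h1 g x v
    · apply ext_antipode_tmulEval hS
      intro v
      rw [h2]
      exact antipode_tmulEval_dualCoact hS V hfin (ψ x) v

/-- The dual is an inner hom object `hom(V, I)`. -/
noncomputable def dualInnerHom : InnerHom V (unit k G) where
  obj := dual hS V hfin
  ev := TensorProduct.lift (LinearMap.id : (V →ₗ[k] k) →ₗ[k] V →ₗ[k] k)
  isHom_ev := (isHom_dual_iff hS V hfin (X := dual hS V hfin) LinearMap.id).1 (IsHom.id _)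
  existsUnique X φ hφ := by
    refine ⟨TensorProduct.curry φ, ⟨(isHom_dual_iff hS V hfin _).2 ?_, ?_⟩, ?_⟩
    · have : TensorProduct.lift (TensorProduct.curry φ) = φ := by ext; simp
      rwa [this]
    · ext x v; simp
    · rintro ψ ⟨-, rfl⟩
      ext x v
      simp

end dual

namespace InnerHom

variable {V Y : YDModule k G} (E : InnerHom V Y)

theorem hom_ext {X : YDModule k G} {f g : X →ₗ[k] E.obj} (hf : IsHom X E.obj f)
    (hg : IsHom X E.obj g) (h : E.ev ∘ₗ f.rTensor V = E.ev ∘ₗ g.rTensor V) : f = g :=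
  (E.existsUnique X _ (E.isHom_ev.comp (hf.rTensor V))).unique ⟨hf, rfl⟩ ⟨hg, h.symm⟩

theorem ev_curry_tmul {X : YDModule k G} (φ : X ⊗[k] V →ₗ[k] Y)
    (hφ : IsHom (X.tensor V) Y φ) (x : X) (v : V) : E.ev (E.curry X φ hφ x ⊗ₜ v) = φ (x ⊗ₜ v) := by
  conv_rhs => rw [← E.ev_curry X φ hφ]
  simp

theorem isHom_curry_ev (hS : Function.Bijective (HopfAlgebra.antipode k : G →ₗ[k] G))
    (hfin : FiniteDimensional k G ∨ FiniteDimensional k V) (E : InnerHom V (unit k G)) :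
    IsHom E.obj (dual hS V hfin) (TensorProduct.curry E.ev) := by
  rw [isHom_dual_iff]
  have : TensorProduct.lift (TensorProduct.curry E.ev) = E.ev := by ext; simp
  rw [this]
  exact E.isHom_ev

/-- Any inner hom object `hom(V, I)` is identified with the dual through `z ↦ ev(z ⊗ -)`. -/
theorem curry_ev_bijective (hS : Function.Bijective (HopfAlgebra.antipode k : G →ₗ[k] G))
    (hfin : FiniteDimensional k G ∨ FiniteDimensional k V) (E : InnerHom V (unit k G)) :
    Function.Bijective (TensorProduct.curry E.ev) := by
  have h1 := isHom_curry_ev hS hfin E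
  let F := dualInnerHom hS V hfin
  have h2 := E.isHom_curry F.obj F.ev F.isHom_ev
  have e : TensorProduct.curry E.ev ∘ₗ E.curry F.obj F.ev F.isHom_ev = LinearMap.id := by
    refine LinearMap.ext fun f => LinearMap.ext fun v => ?_
    exact E.ev_curry_tmul F.ev F.isHom_ev f v
  constructor
  · apply Function.LeftInverse.injective (g := E.curry F.obj F.ev F.isHom_ev)
    -- The other composite is an endomorphism of `E.obj` with the same evaluation as the identity,
    -- hence equal to it by uniqueness.
    have := E.hom_ext (h2.comp h1) (IsHom.id E.obj) (by
      ext z v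
      exact E.ev_curry_tmul F.ev F.isHom_ev _ v)
    exact LinearMap.congr_fun this
  · exact Function.RightInverse.surjective (LinearMap.congr_fun e)

end InnerHom

end YDModule

namespace YDBialgebra

variable {k G : Type u} [Field k] [Ring G] [HopfAlgebra k G] (R : YDBialgebra k G)

/-! ### The bar complex and its faces -/

/-- Appending a letter: `w ⊗ x ∈ R^{⊗ (n+1)}` for `w ∈ R^{⊗ n}` and `x ∈ R`. -/
def snoc {n : ℕ} : R.tpow n →ₗ[k] R.carrier →ₗ[k] R.tpow (n + 1) :=
  TensorProduct.mk k (R.tpow n) R.carrier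

-- Words grow by `snoc`, so identities on tensor powers are checked by induction on the last letter
-- without unfolding the powers.
variable {R} in
theorem tpow_ext {M : Type*} [AddCommMonoid M] [Module k M] {n : ℕ} {f g : R.tpow (n + 1) →ₗ[k] M}
    (h : ∀ w x, f (R.snoc w x) = g (R.snoc w x)) : f = g :=
  TensorProduct.ext' h

/-- The empty word. -/
def nil : R.tpow 0 := (1 : k)

variable {R} in
theorem tpow_zero_ext {M : Type*} [AddCommMonoid M] [Module k M] {f g : R.tpow 0 →ₗ[k] M}
    (h : f R.nil = g R.nil) : f = g :=
  LinearMap.ext_ring h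

/-- The map `f ⊗ 1 : R^{⊗ (m+1)} → R^{⊗ (n+1)}`. -/
def snocMap {m n : ℕ} : (R.tpow m →ₗ[k] R.tpow n) →ₗ[k] R.tpow (m + 1) →ₗ[k] R.tpow (n + 1) :=
  LinearMap.rTensorHom R.carrier

@[simp] theorem snocMap_snoc {m n : ℕ} (f : R.tpow m →ₗ[k] R.tpow n) (w : R.tpow m)
    (x : R.carrier) : R.snocMap f (R.snoc w x) = R.snoc (f w) x := rfl

@[simp] theorem counitLast_snoc {n : ℕ} (w : R.tpow n) (x : R.carrier) :
    R.counitLast n (R.snoc w x) = R.counit x • w :=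
  TensorProduct.rid_tmul (R := k) w (R.counit x)

@[simp] theorem mulLast_snoc {n : ℕ} (w : R.tpow n) (x y : R.carrier) :
    R.mulLast n (R.snoc (R.snoc w x) y) = R.snoc w (R.mul (x ⊗ₜ y)) := rfl

/-- The alternating sum of the faces `∂₀, …, ∂ₙ`, that is of all but the last one. -/
def lowFaces : ∀ n : ℕ, R.tpow (n + 1) →ₗ[k] R.tpow n
  | 0 => R.counitLast 0
  | n + 1 => R.snocMap (lowFaces n) + (-1 : k) ^ (n + 1) • R.mulLast n

/-- The alternating sum of the inner faces `∂₁, …, ∂ₙ`. -/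
def innerFaces : ∀ n : ℕ, R.tpow (n + 1) →ₗ[k] R.tpow n
  | 0 => 0
  | n + 1 => R.snocMap (innerFaces n) + (-1 : k) ^ (n + 1) • R.mulLast n

/-- The face `∂₀ = ε ⊗ 1`. -/
def counitFirst : ∀ n : ℕ, R.tpow (n + 1) →ₗ[k] R.tpow n
  | 0 => R.counitLast 0
  | n + 1 => R.snocMap (counitFirst n)

theorem lowFaces_eq_add : ∀ n, R.lowFaces n = R.counitFirst n + R.innerFaces n
  | 0 => by simp [lowFaces, counitFirst, innerFaces]
  | n + 1 => by
    rw [lowFaces, counitFirst, innerFaces, lowFaces_eq_add n, map_add]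
    exact add_assoc _ _ _

theorem face_counitLast : ∀ n, R.face n (n + 1) = R.counitLast n
  | 0 => rfl
  | _ + 1 => if_pos rfl

theorem face_mulLast (n : ℕ) : R.face (n + 1) (n + 1) = R.mulLast n :=
  (if_neg (by omega)).trans (if_pos rfl)

theorem face_of_lt {n i : ℕ} (hi : i < n + 1) : R.face (n + 1) i = R.snocMap (R.face n i) :=
  (if_neg (by omega)).trans (if_neg (by omega))

theorem lowFaces_eq_sum : ∀ n,
    R.lowFaces n = ∑ i ∈ Finset.range (n + 1), (-1 : k) ^ i • R.face n i
  | 0 => by simp [lowFaces, face]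
  | n + 1 => by
    have h : ∀ i ∈ Finset.range (n + 1), (-1 : k) ^ i • R.face (n + 1) i =
        R.snocMap ((-1 : k) ^ i • R.face n i) := by
      intro i hi
      rw [map_smul, R.face_of_lt (Finset.mem_range.1 hi)]
    rw [Finset.sum_range_succ, Finset.sum_congr rfl h, ← map_sum, ← lowFaces_eq_sum n, lowFaces,
      face_mulLast]

/-- The last face is the only one that drops the last letter. Without it the differential satisfies
a recursion over `snocMap`, on which the later inductions run. -/
theorem bar_eq (n : ℕ) : R.bar n = R.lowFaces n + (-1 : k) ^ (n + 1) • R.counitLast n := by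
  rw [bar, Finset.sum_range_succ, ← lowFaces_eq_sum, face_counitLast]

theorem isHom_snocMap {m n : ℕ} {f : R.tpow m →ₗ[k] R.tpow n} (hf : IsHom (R.tpow m) (R.tpow n) f) :
    IsHom (R.tpow (m + 1)) (R.tpow (n + 1)) (R.snocMap f) :=
  hf.rTensor R.toYDModule

theorem isHom_lowFaces : ∀ n, IsHom (R.tpow (n + 1)) (R.tpow n) (R.lowFaces n)
  | 0 => R.isHom_counitLast 0
  | n + 1 => (R.isHom_snocMap (isHom_lowFaces n)).add ((R.isHom_mulLast n).smul _)

theorem isHom_innerFaces : ∀ n, IsHom (R.tpow (n + 1)) (R.tpow n) (R.innerFaces n)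
  | 0 => IsHom.zero _ _
  | n + 1 => (R.isHom_snocMap (isHom_innerFaces n)).add ((R.isHom_mulLast n).smul _)

theorem isHom_counitFirst : ∀ n, IsHom (R.tpow (n + 1)) (R.tpow n) (R.counitFirst n)
  | 0 => R.isHom_counitLast 0
  | n + 1 => R.isHom_snocMap (isHom_counitFirst n)

/-! ### Splitting words -/

theorem splitTo_zero_right (m : ℕ) (h : m + 0 = m) (z : R.tpow m) :
    R.splitTo m 0 m h z = z ⊗ₜ R.nil := rfl

theorem lTensor_snoc (M : Type*) [AddCommGroup M] [Module k M] {n : ℕ} (t : M ⊗[k] R.tpow n)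
    (x : R.carrier) : (R.snoc.flip x).lTensor M t =
      TensorProduct.assoc k M (R.tpow n) R.carrier (t ⊗ₜ x) := by
  have : (R.snoc.flip x).lTensor M =
      (TensorProduct.assoc k M (R.tpow n) R.carrier).toLinearMap ∘ₗ (TensorProduct.mk k _ _).flip x :=
    TensorProduct.ext' fun _ _ => rfl
  exact LinearMap.congr_fun this t

theorem splitTo_snoc (m n N : ℕ) (h : m + n = N) (h' : m + (n + 1) = N + 1) (z : R.tpow N)
    (x : R.carrier) : R.splitTo m (n + 1) (N + 1) h' (R.snoc z x) =
      (R.snoc.flip x).lTensor (R.tpow m) (R.splitTo m n N h z) := by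
  subst h
  exact (R.lTensor_snoc _ _ x).symm

/-- The isomorphism `R^{⊗ (n+1)} → R ⊗ R^{⊗ n}` splitting off the first letter. -/
noncomputable def uncons : ∀ n, R.tpow (n + 1) →ₗ[k] R.carrier ⊗[k] R.tpow n
  | 0 => (TensorProduct.comm k k R.carrier).toLinearMap
  | n + 1 => (TensorProduct.assoc k R.carrier (R.tpow n) R.carrier).toLinearMap ∘ₗ
      (uncons n).rTensor R.carrier

theorem uncons_zero (x : R.carrier) : R.uncons 0 (R.snoc R.nil x) = x ⊗ₜ R.nil := rfl

theorem uncons_snoc (n : ℕ) (w : R.tpow (n + 1)) (x : R.carrier) :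
    R.uncons (n + 1) (R.snoc w x) = (R.snoc.flip x).lTensor R.carrier (R.uncons n w) := by
  exact (R.lTensor_snoc _ _ x).symm

/-- Moving a letter from the second to the first word. -/
noncomputable def shift (m n : ℕ) : R.tpow m ⊗[k] (R.carrier ⊗[k] R.tpow n) →ₗ[k]
    R.tpow (m + 1) ⊗[k] R.tpow n :=
  (TensorProduct.assoc k (R.tpow m) R.carrier (R.tpow n)).symm.toLinearMap

@[simp] theorem shift_tmul (m n : ℕ) (a : R.tpow m) (x : R.carrier) (w : R.tpow n) :
    R.shift m n (a ⊗ₜ (x ⊗ₜ w)) = R.snoc a x ⊗ₜ w := rfl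

/-- Compares the splittings at two consecutive places. Since words are built from the right, passing
the first letter of the second word to the first word requires `uncons`. -/
theorem splitTo_succ_left (m : ℕ) : ∀ (n N : ℕ) (h : m + 1 + n = N) (h' : m + (n + 1) = N)
    (z : R.tpow N), R.splitTo (m + 1) n N h z =
      R.shift m n ((R.uncons n).lTensor (R.tpow m) (R.splitTo m (n + 1) N h' z))
  | 0, N, h, h', z => by
    subst h
    refine LinearMap.congr_fun (f := R.splitTo (m + 1) 0 (m + 1) _) (g := R.shift m 0 ∘ₗ
      (R.uncons 0).lTensor (R.tpow m) ∘ₗ R.splitTo m 1 (m + 1) h') (tpow_ext fun w x => ?_) z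
    rw [LinearMap.comp_apply, LinearMap.comp_apply, R.splitTo_snoc m 0 m rfl]
    rfl
  | n + 1, N, h, h', z => by
    obtain ⟨N, rfl⟩ : ∃ M, N = M + 1 := ⟨m + 1 + n, by omega⟩
    refine LinearMap.congr_fun (f := R.splitTo (m + 1) (n + 1) (N + 1) h)
      (g := R.shift m (n + 1) ∘ₗ (R.uncons (n + 1)).lTensor (R.tpow m) ∘ₗ
        R.splitTo m (n + 2) (N + 1) h') (tpow_ext fun w x => ?_) z
    rw [LinearMap.comp_apply, LinearMap.comp_apply, R.splitTo_snoc (m + 1) n N (by omega),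
      R.splitTo_snoc m (n + 1) N (by omega), splitTo_succ_left m n N (by omega) (by omega)]
    generalize R.splitTo m (n + 1) N _ w = t
    induction t using TensorProduct.induction_on with
    | zero => simp
    | add a b ha hb => simp only [map_add, ha, hb]
    | tmul a b =>
      simp only [LinearMap.lTensor_tmul, LinearMap.flip_apply, uncons_snoc]
      induction R.uncons n b using TensorProduct.induction_on with
      | zero => simp
      | add c d hc hd => simp only [TensorProduct.tmul_add, map_add, hc, hd]
      | tmul y w => simp

theorem splitTo_mulLast (m n N : ℕ) (h : m + (n + 1) = N + 1) (h' : m + (n + 2) = N + 2)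
    (z : R.tpow (N + 2)) : R.splitTo m (n + 1) (N + 1) h (R.mulLast N z) =
      (R.mulLast n).lTensor (R.tpow m) (R.splitTo m (n + 2) (N + 2) h' z) := by
  refine LinearMap.congr_fun (f := R.splitTo m (n + 1) (N + 1) h ∘ₗ R.mulLast N)
    (g := (R.mulLast n).lTensor (R.tpow m) ∘ₗ R.splitTo m (n + 2) (N + 2) h')
    (tpow_ext fun w y => ?_) z
  refine LinearMap.congr_fun
    (f := (R.splitTo m (n + 1) (N + 1) h ∘ₗ R.mulLast N) ∘ₗ R.snoc.flip y)
    (g := ((R.mulLast n).lTensor (R.tpow m) ∘ₗ R.splitTo m (n + 2) (N + 2) h') ∘ₗ R.snoc.flip y)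
    (tpow_ext fun w x => ?_) w
  simp only [LinearMap.comp_apply, LinearMap.flip_apply, mulLast_snoc]
  rw [R.splitTo_snoc m n N (by omega), R.splitTo_snoc m (n + 1) (N + 1) (by omega),
    R.splitTo_snoc m n N (by omega)]
  induction R.splitTo m n N _ w using TensorProduct.induction_on with
  | zero => simp
  | add a b ha hb => simp only [map_add, ha, hb]
  | tmul a b => simp

/-- The faces with index at most `m` act on the first `m + 1` letters. The face with index `m + i`,
`1 ≤ i ≤ n`, is the `i`-th inner face of the last `n + 1` letters, whence the sign `(-1) ^ m`. -/
theorem splitTo_lowFaces (m : ℕ) : ∀ (n N : ℕ) (h : m + n = N) (h₁ : m + 1 + n = N + 1)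
    (h₂ : m + (n + 1) = N + 1) (z : R.tpow (N + 1)), R.splitTo m n N h (R.lowFaces N z) =
      (R.lowFaces m).rTensor (R.tpow n) (R.splitTo (m + 1) n (N + 1) h₁ z) +
      (-1 : k) ^ m • (R.innerFaces n).lTensor (R.tpow m) (R.splitTo m (n + 1) (N + 1) h₂ z)
  | 0, N, h, h₁, h₂, z => by
    subst h
    simp only [innerFaces, LinearMap.lTensor_zero, LinearMap.zero_apply, smul_zero, add_zero]
    rfl
  | n + 1, N, h, h₁, h₂, z => by
    obtain ⟨N, rfl⟩ : ∃ M, N = M + 1 := ⟨m + n, by omega⟩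
    refine LinearMap.congr_fun (f := R.splitTo m (n + 1) (N + 1) h ∘ₗ R.lowFaces (N + 1))
      (g := (R.lowFaces m).rTensor (R.tpow (n + 1)) ∘ₗ R.splitTo (m + 1) (n + 1) (N + 2) h₁ +
        (-1 : k) ^ m • (R.innerFaces (n + 1)).lTensor (R.tpow m) ∘ₗ
          R.splitTo m (n + 2) (N + 2) h₂) (tpow_ext fun w x => ?_) z
    have hs : (-1 : k) ^ (N + 1) = (-1) ^ m * (-1) ^ (n + 1) := by
      rw [← pow_add]; congr 1; omega
    simp only [LinearMap.comp_apply, LinearMap.add_apply, LinearMap.smul_apply, lowFaces,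
      innerFaces, snocMap_snoc, map_add, map_smul, LinearMap.lTensor_add, LinearMap.lTensor_smul]
    rw [R.splitTo_mulLast m n N h h₂, hs, mul_smul, R.splitTo_snoc m n N (by omega),
      splitTo_lowFaces m n N (by omega) (by omega) (by omega), R.splitTo_snoc (m + 1) n (N + 1)
      (by omega), R.splitTo_snoc m (n + 1) (N + 1) (by omega)]
    have e1 : ∀ t, (R.lowFaces m).rTensor (R.tpow (n + 1))
        ((R.snoc.flip x).lTensor (R.tpow (m + 1)) t) =
        (R.snoc.flip x).lTensor (R.tpow m) ((R.lowFaces m).rTensor (R.tpow n) t) := fun t => by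
      simp only [← LinearMap.comp_apply, LinearMap.lTensor_comp_rTensor,
        LinearMap.rTensor_comp_lTensor]
    have e2 : ∀ t, (R.snocMap (R.innerFaces n)).lTensor (R.tpow m)
        ((R.snoc.flip x).lTensor (R.tpow m) t) =
        (R.snoc.flip x).lTensor (R.tpow m) ((R.innerFaces n).lTensor (R.tpow m) t) := fun t => by
      rw [← LinearMap.lTensor_comp_apply, ← LinearMap.lTensor_comp_apply]
      rfl
    rw [e1, e2, map_add, map_smul, smul_add, add_assoc]

theorem counitFirst_eq : ∀ n, R.counitFirst n =
    (TensorProduct.lid k (R.tpow n)).toLinearMap ∘ₗ R.counit.rTensor (R.tpow n) ∘ₗ R.uncons n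
  | 0 => by
    refine tpow_ext fun w x => ?_
    refine LinearMap.congr_fun (f := R.counitFirst 0 ∘ₗ R.snoc.flip x)
      (g := ((TensorProduct.lid k (R.tpow 0)).toLinearMap ∘ₗ R.counit.rTensor (R.tpow 0) ∘ₗ
        R.uncons 0) ∘ₗ R.snoc.flip x) (tpow_zero_ext ?_) w
    exact (TensorProduct.lid_tmul (R := k) _ _).symm
  | n + 1 => by
    refine tpow_ext fun w x => ?_
    rw [counitFirst, snocMap_snoc, counitFirst_eq n]
    simp only [LinearMap.comp_apply, uncons_snoc]
    induction R.uncons n w using TensorProduct.induction_on with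
    | zero => simp
    | add a b ha hb => simp only [map_add, LinearMap.add_apply, ha, hb]
    | tmul a b => simp

/-- Augmenting the letter at position `m + 1` is both the last face of a first word and the zeroth
face of a second word. -/
theorem splitTo_counit_middle (m n N : ℕ) (h₁ : m + 1 + n = N) (h₂ : m + (n + 1) = N)
    (z : R.tpow N) : (R.counitLast m).rTensor (R.tpow n) (R.splitTo (m + 1) n N h₁ z) =
      (R.counitFirst n).lTensor (R.tpow m) (R.splitTo m (n + 1) N h₂ z) := by
  rw [R.splitTo_succ_left m n N h₁ h₂, counitFirst_eq]
  induction R.splitTo m (n + 1) N h₂ z using TensorProduct.induction_on with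
  | zero => simp
  | add a b ha hb => simp only [map_add, ha, hb]
  | tmul a b =>
    simp only [LinearMap.lTensor_tmul, LinearMap.comp_apply]
    induction R.uncons n b using TensorProduct.induction_on with
    | zero => simp
    | add c d hc hd => simp only [TensorProduct.tmul_add, map_add, hc, hd]
    | tmul y w => simp [TensorProduct.smul_tmul]

theorem splitTo_counitLast (m : ℕ) (n N : ℕ) (h : m + n = N)
    (h₂ : m + (n + 1) = N + 1) (z : R.tpow (N + 1)) : R.splitTo m n N h (R.counitLast N z) =
      (R.counitLast n).lTensor (R.tpow m) (R.splitTo m (n + 1) (N + 1) h₂ z) := by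
  refine LinearMap.congr_fun (f := R.splitTo m n N h ∘ₗ R.counitLast N)
    (g := (R.counitLast n).lTensor (R.tpow m) ∘ₗ R.splitTo m (n + 1) (N + 1) h₂)
    (tpow_ext fun w x => ?_) z
  simp only [LinearMap.comp_apply, counitLast_snoc, map_smul]
  rw [R.splitTo_snoc m n N h, ← LinearMap.lTensor_comp_apply]
  have : R.counitLast n ∘ₗ R.snoc.flip x = R.counit x • LinearMap.id := by
    ext w; simp
  simp [this, LinearMap.lTensor_smul]

/-- The differential of the bar complex is a coderivation for the deconcatenation. -/
theorem splitTo_bar (m n N : ℕ) (h : m + n = N) (h₁ : m + 1 + n = N + 1)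
    (h₂ : m + (n + 1) = N + 1) (z : R.tpow (N + 1)) : R.splitTo m n N h (R.bar N z) =
      (R.bar m).rTensor (R.tpow n) (R.splitTo (m + 1) n (N + 1) h₁ z) +
      (-1 : k) ^ m • (R.bar n).lTensor (R.tpow m) (R.splitTo m (n + 1) (N + 1) h₂ z) := by
  have hs : (-1 : k) ^ (N + 1) = (-1) ^ m * (-1) ^ (n + 1) := by
    rw [← pow_add]; congr 1; omega
  simp only [bar_eq, LinearMap.add_apply, LinearMap.smul_apply, map_add, map_smul,
    LinearMap.rTensor_add, LinearMap.lTensor_add, LinearMap.rTensor_smul, LinearMap.lTensor_smul]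
  -- The augmentation of the middle letter occurs in both summands, with the signs `(-1) ^ (m + 1)`
  -- and `(-1) ^ m`, and cancels.
  rw [R.splitTo_lowFaces m n N h h₁ h₂, R.splitTo_counit_middle m n (N + 1) h₁ h₂,
    R.lowFaces_eq_add n, R.splitTo_counitLast m n N h h₂, hs]
  simp only [LinearMap.lTensor_add, LinearMap.add_apply, smul_add, pow_succ, mul_smul, neg_smul,
    one_smul, smul_neg]
  module

theorem splitTo_zero_left : ∀ (n : ℕ) (h : 0 + n = n) (z : R.tpow n),
    R.splitTo 0 n n h z = R.nil ⊗ₜ z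
  | 0, h, z => by
    exact LinearMap.congr_fun (f := R.splitTo 0 0 0 h)
      (g := TensorProduct.mk k (R.tpow 0) (R.tpow 0) R.nil) (tpow_zero_ext rfl) z
  | n + 1, h, z => by
    refine LinearMap.congr_fun (f := R.splitTo 0 (n + 1) (n + 1) h)
      (g := TensorProduct.mk k (R.tpow 0) (R.tpow (n + 1)) R.nil) (tpow_ext fun w x => ?_) z
    rw [R.splitTo_snoc 0 n n (by omega), splitTo_zero_left n (by omega)]
    rfl

/-- Coassociativity of deconcatenation, the source of the associativity of the cup product. -/
theorem splitTo_assoc (a b : ℕ) : ∀ (c ab bc N : ℕ) (h₁ : a + b = ab) (h₂ : b + c = bc)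
    (h₃ : ab + c = N) (h₄ : a + bc = N) (z : R.tpow N),
    TensorProduct.assoc k (R.tpow a) (R.tpow b) (R.tpow c)
      ((R.splitTo a b ab h₁).rTensor (R.tpow c) (R.splitTo ab c N h₃ z)) =
    (R.splitTo b c bc h₂).lTensor (R.tpow a) (R.splitTo a bc N h₄ z)
  | 0, ab, bc, N, h₁, h₂, h₃, h₄, z => by
    have e₁ : ab = N := h₃
    have e₂ : b = bc := h₂
    subst e₁ e₂
    rw [R.splitTo_zero_right ab h₃ z, LinearMap.rTensor_tmul]
    induction R.splitTo a b ab h₁ z using TensorProduct.induction_on with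
    | zero => simp
    | add a b ha hb => simp only [TensorProduct.add_tmul, map_add, ha, hb]
    | tmul a b => rfl
  | c + 1, ab, bc, N, h₁, h₂, h₃, h₄, z => by
    obtain ⟨N, rfl⟩ : ∃ M, N = M + 1 := ⟨ab + c, by omega⟩
    obtain ⟨bc, rfl⟩ : ∃ M, bc = M + 1 := ⟨b + c, by omega⟩
    refine LinearMap.congr_fun
      (f := (TensorProduct.assoc k (R.tpow a) (R.tpow b) (R.tpow (c + 1))).toLinearMap ∘ₗ
        (R.splitTo a b ab h₁).rTensor (R.tpow (c + 1)) ∘ₗ R.splitTo ab (c + 1) (N + 1) h₃)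
      (g := (R.splitTo b (c + 1) (bc + 1) h₂).lTensor (R.tpow a) ∘ₗ
        R.splitTo a (bc + 1) (N + 1) h₄) (tpow_ext fun w x => ?_) z
    simp only [LinearMap.comp_apply, LinearEquiv.coe_coe]
    rw [R.splitTo_snoc ab c N (by omega), R.splitTo_snoc a bc N (by omega)]
    have e1 : R.splitTo b (c + 1) (bc + 1) h₂ ∘ₗ R.snoc.flip x =
        (R.snoc.flip x).lTensor (R.tpow b) ∘ₗ R.splitTo b c bc (by omega) :=
      LinearMap.ext fun w => R.splitTo_snoc b c bc (by omega) h₂ w x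
    rw [← LinearMap.lTensor_comp_apply, e1, LinearMap.lTensor_comp_apply,
      ← splitTo_assoc a b c ab bc N h₁ (by omega) (by omega) (by omega)]
    induction R.splitTo ab c N _ w using TensorProduct.induction_on with
    | zero => simp
    | add a b ha hb => simp only [map_add, ha, hb]
    | tmul p q =>
      simp only [LinearMap.lTensor_tmul, LinearMap.rTensor_tmul]
      induction R.splitTo a b ab h₁ p using TensorProduct.induction_on with
      | zero => simp
      | add a b ha hb => simp only [TensorProduct.add_tmul, map_add, ha, hb]
      | tmul p q => simp

end YDBialgebra

namespace YDBialgebra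

variable {k G : Type u} [Field k] [Ring G] [HopfAlgebra k G] (R : YDBialgebra k G)

/-! ### The codiagonal coaction of `R` on its tensor powers -/

/-- `g ⊗ x` acts on `X ⊗ R` by `p ⊗ q ↦ g p ⊗ x q`. -/
def twist (X : YDModule k G) : G ⊗[k] R.carrier →ₗ[k] X ⊗[k] R.carrier →ₗ[k] X ⊗[k] R.carrier :=
  TensorProduct.homTensorHomMap (RingHom.id k) X R.carrier X R.carrier ∘ₗ
    TensorProduct.map X.act.toLinearMap (TensorProduct.curry R.mul)

@[simp] theorem twist_tmul (X : YDModule k G) (g : G) (x : R.carrier) (p : X) (q : R.carrier) :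
    R.twist X (g ⊗ₜ x) (p ⊗ₜ q) = X.act g p ⊗ₜ R.mul (x ⊗ₜ q) := rfl

/-- The braided left multiplication of `R` on `X ⊗ R`, `p ⊗ q ↦ x₍₋₁₎ p ⊗ x₍₀₎ q`. -/
def braidMul (X : YDModule k G) : R.carrier →ₗ[k] X ⊗[k] R.carrier →ₗ[k] X ⊗[k] R.carrier :=
  R.twist X ∘ₗ R.coact

theorem braidMul_apply (X : YDModule k G) (x : R.carrier) :
    R.braidMul X x = R.twist X (R.coact x) := rfl

/-- The multiplication of `R` is colinear, so the braided left multiplication is an action of the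
algebra `R` on `X ⊗ R`. -/
theorem braidMul_mul (X : YDModule k G) (x y : R.carrier) (t : X ⊗[k] R.carrier) :
    R.braidMul X (R.mul (x ⊗ₜ y)) t = R.braidMul X x (R.braidMul X y t) := by
  have h : R.coact (R.mul (x ⊗ₜ y)) =
      R.mul.lTensor G (codiag k G R.carrier R.carrier (R.coact x ⊗ₜ R.coact y)) :=
    R.isHom_mul.map_coact (x ⊗ₜ y)
  rw [braidMul_apply, braidMul_apply, braidMul_apply, h]
  generalize R.coact x = p
  generalize R.coact y = q
  induction p with
  | zero => simp
  | add a b ha hb => simp only [TensorProduct.add_tmul, map_add, LinearMap.add_apply, ha, hb]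
  | tmul a x =>
    induction q with
    | zero => simp
    | add a b ha hb => simp only [TensorProduct.tmul_add, map_add, LinearMap.add_apply, ha, hb]
    | tmul b y =>
      induction t using TensorProduct.induction_on with
      | zero => simp
      | add a b ha hb => simp only [map_add, ha, hb]
      | tmul v z => simp [R.mul_assoc]

theorem rTensor_braidMul {X Y : YDModule k G} {f : X →ₗ[k] Y}
    (hf : ∀ (g : G) (v : X), f (X.act g v) = Y.act g (f v)) (x : R.carrier) (t : X ⊗[k] R.carrier) :
    f.rTensor R.carrier (R.braidMul X x t) = R.braidMul Y x (f.rTensor R.carrier t) := by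
  rw [braidMul_apply, braidMul_apply]
  generalize R.coact x = p
  induction p with
  | zero => simp
  | add a b ha hb => simp only [map_add, LinearMap.add_apply, ha, hb]
  | tmul a x =>
    induction t using TensorProduct.induction_on with
    | zero => simp
    | add a b ha hb => simp only [map_add, ha, hb]
    | tmul v z => simp [hf]

theorem braidMul_unit (x y : R.carrier) (c : k) :
    R.braidMul (unit k G) x (c ⊗ₜ y) = c ⊗ₜ R.mul (x ⊗ₜ y) := by
  rw [braidMul_apply]
  conv_rhs => rw [← R.str.counit_coact x]
  change R.twist (unit k G) (R.coact x) (c ⊗ₜ y) =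
    c ⊗ₜ R.mul (TensorProduct.lid k R.carrier (Coalgebra.counit.rTensor R.carrier (R.coact x)) ⊗ₜ y)
  generalize R.coact x = p
  induction p with
  | zero => simp
  | add a b ha hb =>
    simp only [map_add, LinearMap.add_apply, TensorProduct.add_tmul, TensorProduct.tmul_add, ha, hb]
  | tmul a x =>
    rw [twist_tmul, unit_act_apply, ← smul_eq_mul, TensorProduct.smul_tmul,
      LinearMap.rTensor_tmul, TensorProduct.lid_tmul, ← TensorProduct.smul_tmul', map_smul]

/-- The augmentation is multiplicative and colinear, that is `x₍₋₁₎ ε(x₍₀₎) = ε(x) 1`. -/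
theorem lTensor_counit_braidMul (X : YDModule k G) (x : R.carrier) (t : X ⊗[k] R.carrier) :
    R.counit.lTensor X (R.braidMul X x t) = R.counit x • R.counit.lTensor X t := by
  have h : R.counit.lTensor G (R.coact x) = (1 : G) ⊗ₜ R.counit x :=
    (R.isHom_counit.map_coact x).symm
  have h' : ∀ (p : G ⊗[k] R.carrier) (v : X) (z : R.carrier), R.counit.lTensor X
      (R.twist X p (v ⊗ₜ z)) = (X.act (TensorProduct.rid k G (R.counit.lTensor G p)) v) ⊗ₜ
        R.counit z := by
    intro p v z
    induction p with
    | zero => simp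
    | add a b ha hb => simp only [map_add, LinearMap.add_apply, TensorProduct.add_tmul, ha, hb]
    | tmul a x =>
      simp [R.counit_mul, TensorProduct.smul_tmul]
  induction t using TensorProduct.induction_on with
  | zero => simp
  | add a b ha hb => simp only [map_add, smul_add, ha, hb]
  | tmul v z => rw [braidMul_apply, h', h]; simp [TensorProduct.smul_tmul']

theorem braiding_apply (X Y : YDModule k G) (x : X) (y : Y) : braiding X Y (x ⊗ₜ y) =
    TensorProduct.comm k X Y ((Y.act.toLinearMap.flip y).lTensor X
      (TensorProduct.comm k G X (X.coact x))) := by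
  rw [braiding, LinearMap.comp_apply, LinearMap.comp_apply, LinearMap.rTensor_tmul]
  generalize X.coact x = p
  induction p with
  | zero => simp
  | add a b ha hb => simp only [map_add, TensorProduct.add_tmul, ha, hb]
  | tmul a x => simp

/-- By coassociativity of the coaction, acting on `X ⊗ Y ⊗ R` amounts to braiding `x` past `X` first
and then acting on `Y ⊗ R`. -/
theorem braidMul_tensor (X Y : YDModule k G) (x : R.carrier) (p : X) (t : Y ⊗[k] R.carrier) :
    R.braidMul (X.tensor Y) x ((TensorProduct.assoc k X Y R.carrier).symm (p ⊗ₜ t)) =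
      (TensorProduct.assoc k X Y R.carrier).symm (((R.braidMul Y).flip t).lTensor X
        (braiding R.toYDModule X (x ⊗ₜ p))) := by
  let Φ : G ⊗[k] (G ⊗[k] R.carrier) →ₗ[k] (X ⊗[k] Y) ⊗[k] R.carrier :=
    (TensorProduct.assoc k X Y R.carrier).symm.toLinearMap ∘ₗ
      TensorProduct.map (X.act.toLinearMap.flip p) ((R.twist Y).flip t)
  have e1 : ∀ q : G ⊗[k] R.carrier, R.twist (X.tensor Y) q
      ((TensorProduct.assoc k X Y R.carrier).symm (p ⊗ₜ t)) =
      Φ (TensorProduct.assoc k G G R.carrier (Coalgebra.comul.rTensor R.carrier q)) := by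
    intro q
    induction q with
    | zero => simp
    | add a b ha hb => simp only [map_add, LinearMap.add_apply, ha, hb]
    | tmul a x =>
      induction t using TensorProduct.induction_on with
      | zero => simp [Φ]
      | add c d hc hd =>
        rw [TensorProduct.tmul_add, map_add, map_add, hc, hd]
        simp only [Φ, map_add, TensorProduct.map_add_right, LinearMap.comp_add,
          LinearMap.add_apply]
      | tmul v z =>
        rw [TensorProduct.assoc_symm_tmul, twist_tmul]
        change tensorAct X.str Y.str a (p ⊗ₜ v) ⊗ₜ _ = _
        rw [tensorAct_apply, LinearMap.rTensor_tmul]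
        generalize (Coalgebra.comul (R := k) a : G ⊗[k] G) = y
        induction y with
        | zero => simp
        | add a b ha hb => simp only [TensorProduct.add_tmul, map_add, LinearMap.add_apply, ha, hb]
        | tmul a b => simp [Φ]
  have e2 : ∀ q : G ⊗[k] R.carrier, (TensorProduct.assoc k X Y R.carrier).symm
      (((R.braidMul Y).flip t).lTensor X (TensorProduct.comm k R.carrier X
        ((X.act.toLinearMap.flip p).lTensor R.carrier (TensorProduct.comm k G R.carrier q)))) =
      Φ (R.coact.lTensor G q) := by
    intro q
    induction q with
    | zero => simp
    | add a b ha hb => simp only [map_add, ha, hb]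
    | tmul a x => simp [Φ, braidMul_apply]
  rw [braiding_apply, e2, ← R.str.coassoc, ← e1]
  rfl

/-- `a ⊗ (b ⊗ c) ↦ a b ⊗ c`. -/
def mulFst : R.carrier ⊗[k] (R.carrier ⊗[k] R.carrier) →ₗ[k] R.carrier ⊗[k] R.carrier :=
  R.mul.rTensor R.carrier ∘ₗ
    (TensorProduct.assoc k R.carrier R.carrier R.carrier).symm.toLinearMap

/-- The braided multiplicativity of `Δ`, rewritten so that `x₍₂₎` acts on `Δ(y)` by `braidMul`
before `x₍₁₎` multiplies the first factor. -/
theorem comul_mul_eq (x y : R.carrier) : R.comul (R.mul (x ⊗ₜ y)) =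
    R.mulFst (((R.braidMul R.toYDModule).flip (R.comul y)).lTensor R.carrier (R.comul x)) := by
  rw [R.comul_mul]
  generalize R.comul x = p
  generalize R.comul y = q
  induction p with
  | zero => simp
  | add a b ha hb => simp only [map_add, TensorProduct.add_tmul, ha, hb]
  | tmul a b =>
    induction q with
    | zero => simp
    | add c d hc hd =>
      simp only [map_add, TensorProduct.tmul_add, LinearMap.lTensor_add, LinearMap.add_apply, hc, hd]
    | tmul c d =>
      simp only [interchange, LinearMap.comp_apply, LinearEquiv.coe_coe,
        TensorProduct.assoc_tmul, LinearMap.lTensor_tmul, TensorProduct.assoc_symm_tmul,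
        LinearMap.rTensor_tmul, braiding_apply, LinearMap.flip_apply, braidMul_apply]
      generalize R.coact b = s
      induction s with
      | zero => simp
      | add e f he hf =>
        simp only [map_add, TensorProduct.add_tmul, TensorProduct.tmul_add, LinearMap.add_apply,
          he, hf]
      | tmul g b => simp [mulFst]

/-- `G`-linearity of the multiplication lets `u` pass the product of first factors. Then
`braidMul_tensor` braids `u` past `x₍₁₎`, and `braidMul_mul` merges it with `x₍₂₎`. -/
theorem braidMul_comul_mul (u x y : R.carrier) :
    R.braidMul R.toYDModule u (R.comul (R.mul (x ⊗ₜ y))) =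
      R.mulFst (((R.braidMul R.toYDModule).flip (R.comul y)).lTensor R.carrier
        (R.braidMul R.toYDModule u (R.comul x))) := by
  rw [comul_mul_eq]
  generalize R.comul x = p
  induction p with
  | zero => simp
  | add a b ha hb => simp only [map_add, ha, hb]
  | tmul a b =>
    rw [LinearMap.lTensor_tmul, LinearMap.flip_apply, mulFst, LinearMap.comp_apply,
      ← R.rTensor_braidMul (X := R.toYDModule.tensor R.toYDModule) (R.isHom_mul.map_act),
      LinearEquiv.coe_coe, R.braidMul_tensor R.toYDModule R.toYDModule, LinearMap.comp_apply]
    refine congrArg (R.mul.rTensor R.carrier)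
      (congrArg (TensorProduct.assoc k R.carrier R.carrier R.carrier).symm ?_)
    rw [braiding_apply, R.braidMul_apply _ u]
    have h : ∀ s : G ⊗[k] R.carrier,
        ((R.braidMul R.toYDModule).flip (R.braidMul R.toYDModule b (R.comul y))).lTensor R.carrier
          (TensorProduct.comm k R.carrier R.carrier ((R.act.toLinearMap.flip a).lTensor R.carrier
            (TensorProduct.comm k G R.carrier s))) =
        ((R.braidMul R.toYDModule).flip (R.comul y)).lTensor R.carrier
          (R.twist R.toYDModule s (a ⊗ₜ b)) := by
      intro s
      induction s with
      | zero => simp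
      | add e f he hf => simp only [map_add, LinearMap.add_apply, he, hf]
      | tmul g v => simp [braidMul_mul]
    exact h _

/-- The isomorphism `R^{⊗ n} ⊗ (R ⊗ R) → R^{⊗ (n+1)} ⊗ R`. -/
noncomputable def snocFst (n : ℕ) : R.tpow n ⊗[k] (R.carrier ⊗[k] R.carrier) →ₗ[k]
    R.tpow (n + 1) ⊗[k] R.carrier :=
  (TensorProduct.assoc k (R.tpow n) R.carrier R.carrier).symm.toLinearMap

@[simp] theorem snocFst_tmul (n : ℕ) (w : R.tpow n) (x y : R.carrier) :
    R.snocFst n (w ⊗ₜ (x ⊗ₜ y)) = R.snoc w x ⊗ₜ y := rfl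

/-- The map `w ⊗ u ↦ w ⊗ u₍₋₁₎ a ⊗ u₍₀₎ b` for `t = a ⊗ b`. -/
noncomputable def braidSnoc (n : ℕ) (t : R.carrier ⊗[k] R.carrier) :
    R.tpow n ⊗[k] R.carrier →ₗ[k] R.tpow (n + 1) ⊗[k] R.carrier :=
  R.snocFst n ∘ₗ ((R.braidMul R.toYDModule).flip t).lTensor (R.tpow n)

@[simp] theorem braidSnoc_tmul (n : ℕ) (t : R.carrier ⊗[k] R.carrier) (w : R.tpow n)
    (u : R.carrier) : R.braidSnoc n t (w ⊗ₜ u) =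
      R.snocFst n (w ⊗ₜ R.braidMul R.toYDModule u t) := rfl

theorem rTensor_snocFst {m n : ℕ} (f : R.tpow m →ₗ[k] R.tpow n)
    (t : R.tpow m ⊗[k] (R.carrier ⊗[k] R.carrier)) :
    (R.snocMap f).rTensor R.carrier (R.snocFst m t) =
      R.snocFst n (f.rTensor (R.carrier ⊗[k] R.carrier) t) := by
  refine LinearMap.congr_fun (f := (R.snocMap f).rTensor R.carrier ∘ₗ R.snocFst m)
    (g := R.snocFst n ∘ₗ f.rTensor _) (TensorProduct.ext' fun w s => ?_) t
  induction s with
  | zero => simp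
  | add a b ha hb => simp only [map_add, TensorProduct.tmul_add, ha, hb]
  | tmul a b => simp

theorem rTensor_braidSnoc {m n : ℕ} (f : R.tpow m →ₗ[k] R.tpow n) (t : R.carrier ⊗[k] R.carrier)
    (s : R.tpow m ⊗[k] R.carrier) :
    (R.snocMap f).rTensor R.carrier (R.braidSnoc m t s) =
      R.braidSnoc n t (f.rTensor R.carrier s) := by
  refine LinearMap.congr_fun (f := (R.snocMap f).rTensor R.carrier ∘ₗ R.braidSnoc m t)
    (g := R.braidSnoc n t ∘ₗ f.rTensor _) (TensorProduct.ext' fun w s => ?_) s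
  simp [rTensor_snocFst]

/-- Left multiplication by `x` reaches the appended factors through the braiding past `w`, where it
merges with the action of `u` because `braidMul` is an action. -/
theorem braidSnoc_braidMul (n : ℕ) (t : R.carrier ⊗[k] R.carrier) (x : R.carrier)
    (s : R.tpow n ⊗[k] R.carrier) :
    R.braidSnoc n t (R.braidMul (R.tpow n) x s) =
      R.braidMul (R.tpow (n + 1)) x (R.braidSnoc n t s) := by
  refine LinearMap.congr_fun (f := R.braidSnoc n t ∘ₗ R.braidMul (R.tpow n) x)
    (g := R.braidMul (R.tpow (n + 1)) x ∘ₗ R.braidSnoc n t)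
    (TensorProduct.ext' fun w u => ?_) s
  rw [LinearMap.comp_apply, LinearMap.comp_apply, braidSnoc_tmul]
  refine Eq.trans ?_ (R.braidMul_tensor (R.tpow n) R.toYDModule x w
    (R.braidMul R.toYDModule u t)).symm
  rw [braiding_apply, braidMul_apply]
  change R.snocFst n _ = R.snocFst n _
  congr 1
  generalize R.coact x = p
  induction p with
  | zero => simp
  | add a b ha hb => simp only [map_add, LinearMap.add_apply, ha, hb]
  | tmul g x => simp [braidMul_mul]

/-- The codiagonal right coaction `w ↦ w⁽¹⁾ ⊗ w⁽²⁾` of `R` on `R^{⊗ n}`: the braided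
comultiplication of `R^{⊗ n}` followed by the multiplication of the letters of the second word. -/
noncomputable def codiagonal : ∀ n, R.tpow n →ₗ[k] R.tpow n ⊗[k] R.carrier
  | 0 => (TensorProduct.mk k (R.tpow 0) R.carrier).flip (R.one 1)
  | n + 1 => R.snocFst n ∘ₗ
      (TensorProduct.lift ((LinearMap.lcomp k _ R.comul) ∘ₗ
        R.braidMul R.toYDModule)).lTensor (R.tpow n) ∘ₗ
      (TensorProduct.assoc k (R.tpow n) R.carrier R.carrier).toLinearMap ∘ₗ
      (codiagonal n).rTensor R.carrier

theorem codiagonal_zero (w : R.tpow 0) : R.codiagonal 0 w = w ⊗ₜ R.one 1 := rfl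

theorem codiagonal_snoc (n : ℕ) (w : R.tpow n) (x : R.carrier) :
    R.codiagonal (n + 1) (R.snoc w x) = R.braidSnoc n (R.comul x) (R.codiagonal n w) := by
  change R.snocFst n ((TensorProduct.lift ((LinearMap.lcomp k _ R.comul) ∘ₗ
        R.braidMul R.toYDModule)).lTensor (R.tpow n)
      (TensorProduct.assoc k (R.tpow n) R.carrier R.carrier (R.codiagonal n w ⊗ₜ x))) = _
  generalize R.codiagonal n w = t
  induction t using TensorProduct.induction_on with
  | zero => simp
  | add a b ha hb => simp only [map_add, TensorProduct.add_tmul, ha, hb]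
  | tmul a u => simp

/-- The place where the multiplicativity of `Δ` enters: the second legs of the last two letters
combine as in `braidMul_comul_mul`. -/
theorem codiagonal_mulLast (n : ℕ) (z : R.tpow (n + 2)) :
    R.codiagonal (n + 1) (R.mulLast n z) =
      (R.mulLast n).rTensor R.carrier (R.codiagonal (n + 2) z) := by
  refine LinearMap.congr_fun (f := R.codiagonal (n + 1) ∘ₗ R.mulLast n)
    (g := (R.mulLast n).rTensor R.carrier ∘ₗ R.codiagonal (n + 2)) (tpow_ext fun w y => ?_) z
  refine LinearMap.congr_fun (f := (R.codiagonal (n + 1) ∘ₗ R.mulLast n) ∘ₗ R.snoc.flip y)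
    (g := ((R.mulLast n).rTensor R.carrier ∘ₗ R.codiagonal (n + 2)) ∘ₗ R.snoc.flip y)
    (tpow_ext fun w x => ?_) w
  simp only [LinearMap.comp_apply, LinearMap.flip_apply, mulLast_snoc, codiagonal_snoc]
  generalize R.codiagonal n w = t
  induction t using TensorProduct.induction_on with
  | zero => simp
  | add a b ha hb => simp only [map_add, ha, hb]
  | tmul a u =>
    rw [braidSnoc_tmul, braidSnoc_tmul, braidMul_comul_mul]
    generalize R.braidMul R.toYDModule u (R.comul x) = s
    induction s with
    | zero => simp
    | add c d hc hd => simp only [map_add, TensorProduct.tmul_add, hc, hd]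
    | tmul c d =>
      simp only [LinearMap.lTensor_tmul, LinearMap.flip_apply, snocFst_tmul, braidSnoc_tmul]
      generalize R.braidMul R.toYDModule d (R.comul y) = s
      induction s with
      | zero => simp
      | add c d hc hd => simp only [map_add, TensorProduct.tmul_add, hc, hd]
      | tmul e f => simp [mulFst]

/-- An inner face either multiplies the last two letters or leaves the last letter alone, and both
kinds are compatible with appending a letter to the coaction. -/
theorem codiagonal_innerFaces : ∀ (n : ℕ) (z : R.tpow (n + 1)),
    R.codiagonal n (R.innerFaces n z) =
      (R.innerFaces n).rTensor R.carrier (R.codiagonal (n + 1) z)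
  | 0, z => by simp [innerFaces]
  | n + 1, z => by
    refine LinearMap.congr_fun (f := R.codiagonal (n + 1) ∘ₗ R.innerFaces (n + 1))
      (g := (R.innerFaces (n + 1)).rTensor R.carrier ∘ₗ R.codiagonal (n + 2))
      (tpow_ext fun w y => ?_) z
    simp only [LinearMap.comp_apply, innerFaces, LinearMap.add_apply, LinearMap.smul_apply,
      snocMap_snoc, map_add, map_smul, LinearMap.rTensor_add, LinearMap.rTensor_smul]
    rw [codiagonal_mulLast, codiagonal_snoc, codiagonal_innerFaces n, ← rTensor_braidSnoc,
      codiagonal_snoc]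

/-- For the outer faces a correction remains: `ε` removes only the first leg of `x`, so the second
leg of `w` is still multiplied by `x` from the right. -/
theorem codiagonal_counitLast (n : ℕ) (w : R.tpow n) (x : R.carrier) :
    (R.counitLast n).rTensor R.carrier (R.codiagonal (n + 1) (R.snoc w x)) =
      ((TensorProduct.curry R.mul).flip x).lTensor (R.tpow n) (R.codiagonal n w) := by
  rw [codiagonal_snoc]
  generalize R.codiagonal n w = t
  induction t using TensorProduct.induction_on with
  | zero => simp
  | add a b ha hb => simp only [map_add, ha, hb]
  | tmul a u =>
    have e1 : ∀ s : R.carrier ⊗[k] R.carrier, (R.counitLast n).rTensor R.carrier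
        (R.snocFst n (a ⊗ₜ s)) =
        a ⊗ₜ TensorProduct.lid k R.carrier (R.counit.rTensor R.carrier s) := by
      intro s
      induction s with
      | zero => simp
      | add c d hc hd => simp only [map_add, TensorProduct.tmul_add, hc, hd]
      | tmul c d => simp [TensorProduct.smul_tmul]
    have e2 : R.counit.rTensor R.carrier (R.comul x) = 1 ⊗ₜ x := by
      apply (TensorProduct.lid k R.carrier).injective
      rw [R.counit_comul]; simp
    have e3 := R.rTensor_braidMul (X := R.toYDModule) (Y := unit k G) (f := R.counit)
      R.isHom_counit.map_act u (R.comul x)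
    rw [e2] at e3
    rw [braidSnoc_tmul, e1, e3.trans (R.braidMul_unit u x 1)]
    simp

/-- Each second leg enters as `u x₍₂₎`, on which `ε` is multiplicative, and `x₍₁₎ ε(x₍₂₎) = x`. -/
theorem counit_codiagonal : ∀ (n : ℕ) (w : R.tpow n),
    TensorProduct.rid k (R.tpow n) (R.counit.lTensor (R.tpow n) (R.codiagonal n w)) = w
  | 0, w => by rw [codiagonal_zero]; simp [R.counit_one]
  | n + 1, w => by
    refine LinearMap.congr_fun (f := (TensorProduct.rid k (R.tpow (n + 1))).toLinearMap ∘ₗ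
      R.counit.lTensor (R.tpow (n + 1)) ∘ₗ R.codiagonal (n + 1)) (g := LinearMap.id)
      (tpow_ext fun w x => ?_) w
    conv_rhs => rw [← counit_codiagonal n w]
    simp only [LinearMap.comp_apply, LinearMap.id_apply, codiagonal_snoc]
    generalize R.codiagonal n w = t
    induction t using TensorProduct.induction_on with
    | zero => simp
    | add a b ha hb => simp only [map_add, LinearMap.add_apply, ha, hb]
    | tmul a u =>
      have e1 : ∀ s : R.carrier ⊗[k] R.carrier, TensorProduct.rid k (R.tpow (n + 1))
          (R.counit.lTensor (R.tpow (n + 1)) (R.snocFst n (a ⊗ₜ s))) =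
          R.snoc a (TensorProduct.rid k R.carrier (R.counit.lTensor R.carrier s)) := by
        intro s
        induction s with
        | zero => simp
        | add c d hc hd => simp only [map_add, TensorProduct.tmul_add, hc, hd]
        | tmul c d => simp
      rw [braidSnoc_tmul, LinearEquiv.coe_coe, e1, lTensor_counit_braidMul, map_smul,
        R.comul_counit]
      simp

/-- At the first letter the correction is a braided left multiplication. It persists while letters
are appended, by `braidSnoc_braidMul`. -/
theorem codiagonal_counitFirst : ∀ (n : ℕ) (z : R.tpow (n + 1)),
    (R.counitFirst n).rTensor R.carrier (R.codiagonal (n + 1) z) =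
      TensorProduct.lift (R.braidMul (R.tpow n))
        ((R.codiagonal n).lTensor R.carrier (R.uncons n z))
  | 0, z => by
    refine LinearMap.congr_fun (f := (R.counitFirst 0).rTensor R.carrier ∘ₗ R.codiagonal 1)
      (g := TensorProduct.lift (R.braidMul (R.tpow 0)) ∘ₗ
        (R.codiagonal 0).lTensor R.carrier ∘ₗ R.uncons 0) (tpow_ext fun w x => ?_) z
    refine LinearMap.congr_fun
      (f := ((R.counitFirst 0).rTensor R.carrier ∘ₗ R.codiagonal 1) ∘ₗ R.snoc.flip x)
      (g := (TensorProduct.lift (R.braidMul (R.tpow 0)) ∘ₗ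
        (R.codiagonal 0).lTensor R.carrier ∘ₗ R.uncons 0) ∘ₗ R.snoc.flip x)
      (tpow_zero_ext ?_) w
    simp only [LinearMap.comp_apply, LinearMap.flip_apply, uncons_zero, LinearMap.lTensor_tmul,
      TensorProduct.lift.tmul, codiagonal_zero]
    -- For a single letter the zeroth face is also the last one, and left and right multiplication
    -- by `x` agree on the unit.
    refine (R.codiagonal_counitLast 0 R.nil x).trans ?_
    rw [codiagonal_zero, LinearMap.lTensor_tmul]
    refine Eq.trans ?_ (R.braidMul_unit x (R.one 1) (1 : k)).symm
    simp only [LinearMap.flip_apply, TensorProduct.curry_apply, R.one_mul, R.mul_one]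
    rfl
  | n + 1, z => by
    refine LinearMap.congr_fun
      (f := (R.counitFirst (n + 1)).rTensor R.carrier ∘ₗ R.codiagonal (n + 2))
      (g := TensorProduct.lift (R.braidMul (R.tpow (n + 1))) ∘ₗ
        (R.codiagonal (n + 1)).lTensor R.carrier ∘ₗ R.uncons (n + 1)) (tpow_ext fun w y => ?_) z
    simp only [LinearMap.comp_apply, codiagonal_snoc, uncons_snoc, counitFirst]
    rw [rTensor_braidSnoc, codiagonal_counitFirst n]
    induction R.uncons n w using TensorProduct.induction_on with
    | zero => simp
    | add a b ha hb => simp only [map_add, ha, hb]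
    | tmul a b => simp [codiagonal_snoc, braidSnoc_braidMul]

end YDBialgebra

/-! ### The homotopy -/

namespace YDModule

variable {k G : Type u} [Field k] [Ring G] [HopfAlgebra k G]

/-- The map `w ⊗ a ↦ g(a₍₋₁₎ w) a₍₀₎`, for a linear form `g`. -/
def braidEval (X W : YDModule k G) (g : W →ₗ[k] k) : W →ₗ[k] X →ₗ[k] X where
  toFun w := (TensorProduct.lid k X).toLinearMap ∘ₗ
    (g ∘ₗ W.act.toLinearMap.flip w).rTensor X ∘ₗ X.coact
  map_add' v w := by ext; simp [LinearMap.comp_add, LinearMap.rTensor_add]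
  map_smul' c w := by ext; simp [LinearMap.comp_smul, LinearMap.rTensor_smul]

theorem braidEval_apply (X W : YDModule k G) (g : W →ₗ[k] k) (w : W) (a : X) :
    braidEval X W g w a = TensorProduct.lid k X
      ((g ∘ₗ W.act.toLinearMap.flip w).rTensor X (X.coact a)) := rfl

theorem braidEval_map {X Y W : YDModule k G} (g : W →ₗ[k] k) {f : X →ₗ[k] Y} (hf : IsHom X Y f)
    (w : W) (a : X) : f (braidEval X W g w a) = braidEval Y W g w (f a) := by
  rw [braidEval_apply, braidEval_apply, hf.map_coact]
  generalize X.coact a = p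
  induction p with
  | zero => simp
  | add a b ha hb => simp only [map_add, ha, hb]
  | tmul c a => simp

theorem braidEval_comp {X V W : YDModule k G} (g : W →ₗ[k] k) {f : V →ₗ[k] W} (hf : IsHom V W f)
    (v : V) : braidEval X W g (f v) = braidEval X V (g ∘ₗ f) v := by
  refine LinearMap.ext fun a => ?_
  have : g ∘ₗ W.act.toLinearMap.flip (f v) = (g ∘ₗ f) ∘ₗ V.act.toLinearMap.flip v := by
    ext c; simp [hf.map_act]
  rw [braidEval_apply, braidEval_apply, this]

/-- The coaction is codiagonal, so `a₍₋₁₎ y₍₋₁₎` acts on `w`: first `y` acts, then the evaluation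
runs against `a`. -/
theorem braidEval_tensor {X Y W : YDModule k G} (g : W →ₗ[k] k) (w : W) (a : X) (y : Y) :
    braidEval (X.tensor Y) W g w (a ⊗ₜ y) =
      TensorProduct.map ((braidEval X W g).flip a) LinearMap.id
        ((W.act.toLinearMap.flip w).rTensor Y (Y.coact y)) := by
  rw [braidEval_apply]
  change TensorProduct.lid k (X ⊗[k] Y) ((g ∘ₗ W.act.toLinearMap.flip w).rTensor (X ⊗[k] Y)
    (codiag k G X Y (X.coact a ⊗ₜ Y.coact y))) = _
  have e : ∀ c : G, (braidEval X W g).flip a (W.act c w) = TensorProduct.lid k X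
      ((g ∘ₗ W.act.toLinearMap.flip (W.act c w)).rTensor X (X.coact a)) := fun c => rfl
  generalize Y.coact y = q
  induction q with
  | zero => simp
  | add c d hc hd => simp only [TensorProduct.tmul_add, map_add, hc, hd]
  | tmul c y =>
    rw [LinearMap.rTensor_tmul, TensorProduct.map_tmul, LinearMap.flip_apply (m := c),
      AlgHom.toLinearMap_apply, e]
    generalize X.coact a = p
    induction p with
    | zero => simp
    | add c d hc hd => simp only [TensorProduct.add_tmul, map_add, hc, hd]
    | tmul b a => simp [TensorProduct.smul_tmul']

theorem braidEval_unit {W : YDModule k G} (g : W →ₗ[k] k) (w : W) (c : k) :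
    braidEval (unit k G) W g w c = g w * c := by
  rw [braidEval_apply]
  change TensorProduct.lid k k ((g ∘ₗ W.act.toLinearMap.flip w).rTensor k ((1 : G) ⊗ₜ c)) = _
  simp

end YDModule

/-! ### The insertion operator and the homotopy formula. -/

namespace YDBialgebra

variable {k G : Type u} [Field k] [Ring G] [HopfAlgebra k G] (R : YDBialgebra k G)

theorem snocMap_comp {l m n : ℕ} (f : R.tpow m →ₗ[k] R.tpow n) (g : R.tpow l →ₗ[k] R.tpow m)
    (z : R.tpow (l + 1)) : R.snocMap (f ∘ₗ g) z = R.snocMap f (R.snocMap g z) :=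
  LinearMap.congr_fun (f := R.snocMap (f ∘ₗ g)) (g := R.snocMap f ∘ₗ R.snocMap g)
    (tpow_ext fun _ _ => rfl) z

theorem mulLast_snocMap {m n : ℕ} (f : R.tpow m →ₗ[k] R.tpow n) (z : R.tpow (m + 2)) :
    R.mulLast n (R.snocMap (R.snocMap f) z) = R.snocMap f (R.mulLast m z) := by
  refine LinearMap.congr_fun (f := R.mulLast n ∘ₗ R.snocMap (R.snocMap f))
    (g := R.snocMap f ∘ₗ R.mulLast m) (tpow_ext fun w y => ?_) z
  refine LinearMap.congr_fun (f := (R.mulLast n ∘ₗ R.snocMap (R.snocMap f)) ∘ₗ R.snoc.flip y)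
    (g := (R.snocMap f ∘ₗ R.mulLast m) ∘ₗ R.snoc.flip y) (tpow_ext fun w x => ?_) w
  simp

theorem counitLast_snocMap {m n : ℕ} (f : R.tpow m →ₗ[k] R.tpow n) (z : R.tpow (m + 1)) :
    R.counitLast n (R.snocMap f z) = f (R.counitLast m z) :=
  LinearMap.congr_fun (f := R.counitLast n ∘ₗ R.snocMap f) (g := f ∘ₗ R.counitLast m)
    (tpow_ext fun w x => by simp) z

section insertion

variable {n : ℕ} (g : R.tpow n →ₗ[k] k)

/-- The map `(w ⊗ u) ⊗ a ↦ g(a₍₋₁₎ w) a₍₀₎ ⊗ u`. -/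
def braidEvalSnoc (N : ℕ) : R.tpow n ⊗[k] R.carrier →ₗ[k] R.tpow N →ₗ[k] R.tpow (N + 1) :=
  TensorProduct.lift (LinearMap.mk₂ k
    (fun w u => R.snoc.flip u ∘ₗ braidEval (R.tpow N) (R.tpow n) g w)
    (fun _ _ _ => by ext; simp) (fun _ _ _ => by ext; simp) (fun _ _ _ => by ext; simp)
    (fun _ _ _ => by ext; simp))

@[simp] theorem braidEvalSnoc_tmul (N : ℕ) (w : R.tpow n) (u : R.carrier) (a : R.tpow N) :
    R.braidEvalSnoc g N (w ⊗ₜ u) a = R.snoc (braidEval (R.tpow N) (R.tpow n) g w a) u := rfl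

theorem braidEvalSnoc_snocMap {M N : ℕ} {f : R.tpow M →ₗ[k] R.tpow N}
    (hf : IsHom (R.tpow M) (R.tpow N) f) (s : R.tpow n ⊗[k] R.carrier) (a : R.tpow M) :
    R.snocMap f (R.braidEvalSnoc g M s a) = R.braidEvalSnoc g N s (f a) := by
  induction s using TensorProduct.induction_on with
  | zero => simp
  | add a b ha hb => simp only [map_add, LinearMap.add_apply, ha, hb]
  | tmul w u => simp [braidEval_map g hf]

theorem braidEvalSnoc_rTensor {m : ℕ} {f : R.tpow m →ₗ[k] R.tpow n}
    (hf : IsHom (R.tpow m) (R.tpow n) f) (N : ℕ) (s : R.tpow m ⊗[k] R.carrier) :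
    R.braidEvalSnoc g N (f.rTensor R.carrier s) = R.braidEvalSnoc (g ∘ₗ f) N s := by
  induction s using TensorProduct.induction_on with
  | zero => simp
  | add a b ha hb => simp only [map_add, ha, hb]
  | tmul w u =>
    ext a
    simp [braidEval_comp g hf]

/-- If `a` ends in `x`, then `x₍₋₁₎` has acted on `w` and `x₍₀₎` stands next to `u`. Multiplying
them is exactly the braided left multiplication by `x`. -/
theorem mulLast_braidEvalSnoc_snoc (N : ℕ) (s : R.tpow n ⊗[k] R.carrier) (a : R.tpow N)
    (x : R.carrier) : R.mulLast N (R.braidEvalSnoc g (N + 1) s (R.snoc a x)) =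
      R.braidEvalSnoc g N (R.braidMul (R.tpow n) x s) a := by
  induction s using TensorProduct.induction_on with
  | zero => simp
  | add a b ha hb => simp only [map_add, LinearMap.add_apply, ha, hb]
  | tmul w u =>
    rw [braidEvalSnoc_tmul, braidMul_apply]
    have h : braidEval (R.tpow (N + 1)) (R.tpow n) g w (R.snoc a x) = _ :=
      braidEval_tensor (X := R.tpow N) (Y := R.toYDModule) g w a x
    rw [h]
    let M : G ⊗[k] R.carrier →ₗ[k] R.tpow (N + 1) :=
      TensorProduct.map ((braidEval (R.tpow N) (R.tpow n) g).flip a) LinearMap.id ∘ₗ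
        ((R.tpow n).act.toLinearMap.flip w).rTensor R.carrier
    have e : R.mulLast N ∘ₗ R.snoc.flip u ∘ₗ M =
        (R.braidEvalSnoc g N).flip a ∘ₗ (R.twist (R.tpow n)).flip (w ⊗ₜ u) :=
      TensorProduct.ext' fun c y => rfl
    exact LinearMap.congr_fun e (R.coact x)

theorem mulLast_snoc_braidEvalSnoc (N : ℕ) (s : R.tpow n ⊗[k] R.carrier) (a : R.tpow N)
    (x : R.carrier) : R.mulLast N (R.snoc (R.braidEvalSnoc g N s a) x) =
      R.braidEvalSnoc g N (((TensorProduct.curry R.mul).flip x).lTensor (R.tpow n) s) a := by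
  induction s using TensorProduct.induction_on with
  | zero => simp
  | add a b ha hb => simp only [map_add, LinearMap.add_apply, ha, hb]
  | tmul w u => simp

/-- The map `a ⊗ w ↦ g(a₍₋₁₎ w⁽¹⁾) a₍₀₎ ⊗ w⁽²⁾`. -/
noncomputable def insertLast (N : ℕ) : R.tpow N ⊗[k] R.tpow n →ₗ[k] R.tpow (N + 1) :=
  TensorProduct.lift (R.braidEvalSnoc g N ∘ₗ R.codiagonal n).flip

theorem insertLast_tmul (N : ℕ) (a : R.tpow N) (w : R.tpow n) :
    R.insertLast g N (a ⊗ₜ w) = R.braidEvalSnoc g N (R.codiagonal n w) a := rfl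

/-- Only the last of these faces touches the inserted letter. The others are morphisms acting on `a`
and pass through the insertion. -/
theorem lowFaces_insertLast (N : ℕ) (t : R.tpow (N + 1) ⊗[k] R.tpow n) :
    R.lowFaces (N + 1) (R.insertLast g (N + 1) t) =
      R.insertLast g N ((R.lowFaces N).rTensor (R.tpow n) t) +
      (-1 : k) ^ (N + 1) • R.mulLast N (R.insertLast g (N + 1) t) := by
  rw [lowFaces, LinearMap.add_apply, LinearMap.smul_apply]
  congr 1
  induction t using TensorProduct.induction_on with
  | zero => simp
  | add a b ha hb => simp only [map_add, ha, hb]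
  | tmul a w =>
    rw [insertLast_tmul, LinearMap.rTensor_tmul, insertLast_tmul,
      R.braidEvalSnoc_snocMap g (R.isHom_lowFaces N)]

/-- By counitality of the codiagonal coaction, augmenting the inserted letter leaves only the
evaluation of `g`. -/
theorem counitLast_insertLast (N : ℕ) (a : R.tpow N) (w : R.tpow n) :
    R.counitLast N (R.insertLast g N (a ⊗ₜ w)) = braidEval (R.tpow N) (R.tpow n) g w a := by
  conv_rhs => rw [← R.counit_codiagonal n w]
  rw [insertLast_tmul]
  generalize R.codiagonal n w = t
  induction t using TensorProduct.induction_on with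
  | zero => simp
  | add a b ha hb => simp only [map_add, LinearMap.add_apply, ha, hb]
  | tmul w u => simp

theorem insertLast_innerFaces (N : ℕ) (t : R.tpow N ⊗[k] R.tpow (n + 1)) :
    R.insertLast g N ((R.innerFaces n).lTensor (R.tpow N) t) =
      R.insertLast (g ∘ₗ R.innerFaces n) N t := by
  induction t using TensorProduct.induction_on with
  | zero => simp
  | add a b ha hb => simp only [map_add, ha, hb]
  | tmul a w =>
    rw [LinearMap.lTensor_tmul, insertLast_tmul, insertLast_tmul, codiagonal_innerFaces,
      R.braidEvalSnoc_rTensor g (R.isHom_innerFaces n)]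

theorem insertLast_smul_sub (g₁ g₂ : R.tpow n →ₗ[k] k) (c : k) (N : ℕ)
    (t : R.tpow N ⊗[k] R.tpow n) : R.insertLast (c • g₁ - g₂) N t =
      c • R.insertLast g₁ N t - R.insertLast g₂ N t := by
  induction t using TensorProduct.induction_on with
  | zero => simp
  | add a b ha hb => simp only [map_add, ha, hb]; module
  | tmul a w =>
    simp only [insertLast_tmul]
    induction R.codiagonal n w using TensorProduct.induction_on with
    | zero => simp
    | add a b ha hb => simp only [map_add, LinearMap.add_apply, ha, hb]; module
    | tmul w u =>
      simp [braidEval_apply, LinearMap.sub_comp, LinearMap.smul_comp, LinearMap.rTensor_sub,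
        LinearMap.rTensor_smul]

/-- Both sides are a braided left multiplication of the inserted letter by the first letter `x` of
the second word: on the left as the correction in `codiagonal_counitFirst`, on the right as a
product with the end of the lengthened `a`. -/
theorem insertLast_counitFirst (N : ℕ) (t : R.tpow N ⊗[k] R.tpow (n + 1)) :
    R.insertLast (g ∘ₗ R.counitFirst n) N t =
      R.mulLast N (R.insertLast g (N + 1) (R.shift N n ((R.uncons n).lTensor (R.tpow N) t))) := by
  induction t using TensorProduct.induction_on with
  | zero => simp
  | add a b ha hb => simp only [map_add, ha, hb]
  | tmul a w =>
    rw [insertLast_tmul, ← R.braidEvalSnoc_rTensor g (R.isHom_counitFirst n),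
      codiagonal_counitFirst, LinearMap.lTensor_tmul]
    induction R.uncons n w using TensorProduct.induction_on with
    | zero => simp
    | add a b ha hb =>
      simp only [TensorProduct.tmul_add, map_add, LinearMap.add_apply, ha, hb]
    | tmul x w =>
      simp [insertLast_tmul, mulLast_braidEvalSnoc_snoc]

/-- The mirror case: the correction in `codiagonal_counitLast` is the product of the inserted letter
with the letter after it. -/
theorem insertLast_counitLast (N : ℕ) (x : R.carrier) (t : R.tpow N ⊗[k] R.tpow n) :
    R.insertLast (g ∘ₗ R.counitLast n) N ((R.snoc.flip x).lTensor (R.tpow N) t) =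
      R.mulLast N (R.snoc (R.insertLast g N t) x) := by
  induction t using TensorProduct.induction_on with
  | zero => simp
  | add a b ha hb => simp only [map_add, LinearMap.add_apply, ha, hb]
  | tmul a w =>
    rw [LinearMap.lTensor_tmul, insertLast_tmul, ← R.braidEvalSnoc_rTensor g
      (R.isHom_counitLast n), LinearMap.flip_apply, codiagonal_counitLast, insertLast_tmul,
      mulLast_snoc_braidEvalSnoc]

/-- The map `(a, w) ↦ g(a₍₋₁₎ w⁽¹⁾) (a₍₀₎, w⁽²⁾)` on `R^{⊗ (n + N)}`. -/
noncomputable def insertSplit (N : ℕ) : R.tpow (n + N) →ₗ[k] R.tpow (N + 1) :=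
  R.insertLast g N ∘ₗ R.splitTo N n (n + N) (Nat.add_comm N n)

theorem insertSplit_apply (N : ℕ) (z : R.tpow (n + N)) : R.insertSplit g N z =
    R.insertLast g N (R.splitTo N n (n + N) (Nat.add_comm N n) z) := rfl

-- On a cocycle the inner faces equal minus the outer ones. This brings in the faces that fail to
-- commute with the codiagonal coaction.
variable {g} in
theorem comp_innerFaces (hg : g ∘ₗ R.bar n = 0) :
    g ∘ₗ R.innerFaces n = (-1 : k) ^ n • g ∘ₗ R.counitLast n - g ∘ₗ R.counitFirst n := by
  rw [bar_eq, lowFaces_eq_add, LinearMap.comp_add, LinearMap.comp_add, LinearMap.comp_smul,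
    pow_succ] at hg
  rw [eq_sub_iff_add_eq, ← sub_eq_zero, ← hg]
  module

-- The low faces of the whole word include the inner faces of `w`, which the cocycle condition
-- rewrites as outer faces. The one at the first letter accounts for the product of the end of `a`
-- with the inserted letter; the one at the last letter remains as the product with the following
-- letter.
variable {g} in
theorem lowFaces_insertSplit (hg : g ∘ₗ R.bar n = 0) (N : ℕ) (z : R.tpow (n + N + 1)) :
    R.lowFaces (N + 1) (R.insertSplit g (N + 1) z) =
      R.insertSplit g N (R.lowFaces (n + N) z) +
      (-1 : k) ^ (N + n + 1) • R.mulLast N (R.snocMap (R.insertSplit g N) z) := by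
  have h1 : R.mulLast N (R.snocMap (R.insertSplit g N) z) = R.insertLast (g ∘ₗ R.counitLast n) N
      (R.splitTo N (n + 1) (n + N + 1) (by omega) z) := by
    refine LinearMap.congr_fun (f := R.mulLast N ∘ₗ R.snocMap (R.insertSplit g N))
      (g := R.insertLast (g ∘ₗ R.counitLast n) N ∘ₗ
        R.splitTo N (n + 1) (n + N + 1) (by omega)) (tpow_ext fun w x => ?_) z
    rw [LinearMap.comp_apply, LinearMap.comp_apply, R.splitTo_snoc N n (n + N) (by omega),
      insertLast_counitLast]
    rfl
  have h2 := R.splitTo_succ_left N n (n + N + 1) (by omega) (by omega) z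
  rw [insertSplit_apply, insertSplit_apply, h1, lowFaces_insertLast,
    R.splitTo_lowFaces N n (n + N) (by omega) (by omega) (by omega), map_add, map_smul,
    insertLast_innerFaces, R.comp_innerFaces hg, insertLast_smul_sub, insertLast_counitFirst, ← h2]
  simp only [pow_succ, pow_add]
  module

/-- The sum of the maps `(a, w, b) ↦ ± g(a₍₋₁₎ w⁽¹⁾) (a₍₀₎, w⁽²⁾, b)` over all decompositions of a
word of length `n + N` with `w` of length `n`. -/
noncomputable def insertion : ∀ N, R.tpow (n + N) →ₗ[k] R.tpow (N + 1)
  | 0 => R.insertSplit g 0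
  | N + 1 => R.snocMap (insertion N) +
      (-1 : k) ^ ((n + 1) * (N + 1)) • R.insertSplit g (N + 1)

/-- The map `(w, b) ↦ g(w) b`. -/
noncomputable def evalFirst : ∀ N, R.tpow (n + N) →ₗ[k] R.tpow N
  | 0 => g
  | N + 1 => R.snocMap (evalFirst N)

/-- The map `(a, w) ↦ g(a₍₋₁₎ w) a₍₀₎`. -/
noncomputable def evalLast (N : ℕ) : R.tpow (n + N) →ₗ[k] R.tpow N :=
  TensorProduct.lift (braidEval (R.tpow N) (R.tpow n) g).flip ∘ₗ
    R.splitTo N n (n + N) (Nat.add_comm N n)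

theorem counitLast_insertSplit (N : ℕ) (z : R.tpow (n + N)) :
    R.counitLast N (R.insertSplit g N z) = R.evalLast g N z := by
  rw [insertSplit_apply, evalLast, LinearMap.comp_apply]
  induction R.splitTo N n (n + N) _ z using TensorProduct.induction_on with
  | zero => simp
  | add a b ha hb => simp only [map_add, ha, hb]
  | tmul a w => rw [counitLast_insertLast]; rfl

theorem evalFirst_eq : ∀ (N : ℕ) (z : R.tpow (n + N)), R.evalFirst g N z =
    TensorProduct.lid k (R.tpow N) (g.rTensor (R.tpow N) (R.splitTo n N (n + N) rfl z))
  | 0, z => by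
    exact (_root_.mul_one (g z)).symm
  | N + 1, z => by
    refine LinearMap.congr_fun (f := R.evalFirst g (N + 1))
      (g := (TensorProduct.lid k (R.tpow (N + 1))).toLinearMap ∘ₗ g.rTensor (R.tpow (N + 1)) ∘ₗ
        R.splitTo n (N + 1) (n + (N + 1)) rfl) (tpow_ext (n := n + N) fun w x => ?_) z
    rw [evalFirst, snocMap_snoc, evalFirst_eq N, LinearMap.comp_apply, LinearMap.comp_apply]
    change _ = TensorProduct.lid k (R.tpow (N + 1)) (g.rTensor (R.tpow (N + 1))
      (R.splitTo n (N + 1) (n + N + 1) rfl (R.snoc w x)))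
    rw [R.splitTo_snoc n N (n + N) rfl]
    induction R.splitTo n N (n + N) rfl w using TensorProduct.induction_on with
    | zero => simp
    | add a b ha hb => simp only [map_add, LinearMap.add_apply, ha, hb]
    | tmul a b => simp

/-- The empty word has trivial coaction, so no braiding is felt. -/
theorem evalLast_zero : R.evalLast g 0 = R.evalFirst g 0 := by
  refine LinearMap.ext fun z => ?_
  have h := R.splitTo_zero_left n (Nat.zero_add n) z
  refine (congrArg (TensorProduct.lift (braidEval (R.tpow 0) (R.tpow n) g).flip) h).trans ?_
  exact (braidEval_unit g z 1).trans (_root_.mul_one (g z))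

-- Telescoping over the position of `w`: the product of the inserted letter with the next one comes
-- both from `lowFaces_insertSplit` and from the multiplication of the last two letters after
-- `snocMap`, with opposite signs. The decomposition with `a` empty has no left neighbour and
-- contributes `evalFirst`.
variable {g} in
theorem lowFaces_insertion_succ (hg : g ∘ₗ R.bar n = 0) : ∀ (N : ℕ) (z : R.tpow (n + N + 1)),
    R.lowFaces (N + 1) (R.insertion g (N + 1) z) =
      R.snocMap (R.evalFirst g N) z +
      (-1 : k) ^ (n + 1) • R.insertion g N (R.lowFaces (n + N) z)
  | 0, z => by
    have h1 : R.lowFaces 0 ∘ₗ R.insertSplit g 0 = R.evalFirst g 0 := by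
      rw [← evalLast_zero]
      exact LinearMap.ext fun z => R.counitLast_insertSplit g 0 z
    have h2 : R.lowFaces 1 (R.snocMap (R.insertSplit g 0) z) = R.snocMap (R.evalFirst g 0) z -
        R.mulLast 0 (R.snocMap (R.insertSplit g 0) z) := by
      rw [← h1, snocMap_comp]
      simp [lowFaces, sub_eq_add_neg]
    have h3 : R.insertion g 1 z = R.snocMap (R.insertSplit g 0) z +
      (-1 : k) ^ ((n + 1) * 1) • R.insertSplit g 1 z := rfl
    have h4 := R.lowFaces_insertSplit hg 0 z
    rw [h3, map_add, map_smul, h4, insertion, h2]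
    rcases neg_one_pow_eq_or k n with hn | hn <;> simp [pow_succ, hn]
  | N + 1, z => by
    have ih : R.snocMap (R.lowFaces (N + 1)) (R.snocMap (R.insertion g (N + 1)) z) =
        R.snocMap (R.snocMap (R.evalFirst g N)) z + (-1 : k) ^ (n + 1) •
          R.snocMap (R.insertion g N) (R.snocMap (R.lowFaces (n + N)) z) := by
      rw [← snocMap_comp, ← snocMap_comp, ← LinearMap.smul_apply, ← map_smul,
        ← LinearMap.add_apply, ← map_add]
      refine congrArg (fun f => R.snocMap f z) (LinearMap.ext fun w => ?_)
      exact lowFaces_insertion_succ hg N w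
    have h1 : R.lowFaces (N + 2) (R.snocMap (R.insertion g (N + 1)) z) =
        R.snocMap (R.lowFaces (N + 1)) (R.snocMap (R.insertion g (N + 1)) z) +
          (-1 : k) ^ (N + 2) • R.mulLast (N + 1) (R.snocMap (R.insertion g (N + 1)) z) := rfl
    have h2 : R.mulLast (N + 1) (R.snocMap (R.insertion g (N + 1)) z) =
        R.snocMap (R.insertion g N) (R.mulLast (n + N) z) + (-1 : k) ^ ((n + 1) * (N + 1)) •
          R.mulLast (N + 1) (R.snocMap (R.insertSplit g (N + 1)) z) := by
      rw [insertion, map_add, map_smul, LinearMap.add_apply, LinearMap.smul_apply, map_add,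
        map_smul]
      exact congrArg (· + _) (R.mulLast_snocMap (R.insertion g N) z)
    have h3 : R.lowFaces (n + (N + 1)) z = R.snocMap (R.lowFaces (n + N)) z +
        (-1 : k) ^ (n + N + 1) • R.mulLast (n + N) z := rfl
    have h4 := R.lowFaces_insertSplit hg (N + 1) z
    have h5 : R.insertion g (N + 2) z = R.snocMap (R.insertion g (N + 1)) z +
      (-1 : k) ^ ((n + 1) * (N + 2)) • R.insertSplit g (N + 2) z := rfl
    have h6 : ∀ y, R.insertion g (N + 1) y = R.snocMap (R.insertion g N) y +
      (-1 : k) ^ ((n + 1) * (N + 1)) • R.insertSplit g (N + 1) y := fun _ => rfl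
    have h7 : R.snocMap (R.evalFirst g (N + 1)) z = R.snocMap (R.snocMap (R.evalFirst g N)) z := rfl
    have h8 : R.snocMap (R.insertion g N) (R.lowFaces (n + (N + 1)) z) =
        R.snocMap (R.insertion g N) (R.snocMap (R.lowFaces (n + N)) z) +
        (-1 : k) ^ (n + N + 1) • R.snocMap (R.insertion g N) (R.mulLast (n + N) z) := by
      rw [h3]
      exact (map_add _ _ _).trans (congrArg (_ + ·) (map_smul _ _ _))
    rw [h5, map_add, map_smul, h1, ih, h2, h4, h6, h7, h8]
    -- All signs depend only on the parities of `n` and `N`.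
    rcases neg_one_pow_eq_or k n with hn | hn <;> rcases neg_one_pow_eq_or k N with hN | hN <;>
      simp only [pow_succ, pow_add, pow_mul, mul_add, add_mul, _root_.one_mul, _root_.mul_one, hn, hN, one_pow,
        pow_zero] <;> module

variable {g} in
/-- The homotopy formula. -/
theorem bar_insertion (hg : g ∘ₗ R.bar n = 0) (N : ℕ) (z : R.tpow (n + N + 1)) :
    R.bar (N + 1) (R.insertion g (N + 1) z) =
      R.evalFirst g (N + 1) z - (-1 : k) ^ (n * (N + 1)) • R.evalLast g (N + 1) z +
      (-1 : k) ^ (n + 1) • R.insertion g N (R.bar (n + N) z) := by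
  -- The last face drops the last letter of `b`. If `b` is empty it augments the inserted letter
  -- instead, which produces `evalLast`.
  have h1 : R.counitLast (N + 1) (R.insertion g (N + 1) z) =
      R.insertion g N (R.counitLast (n + N) z) +
        (-1 : k) ^ ((n + 1) * (N + 1)) • R.evalLast g (N + 1) z := by
    rw [insertion, LinearMap.add_apply, LinearMap.smul_apply, map_add, map_smul,
      counitLast_insertSplit, counitLast_snocMap]
  have h2 : R.evalFirst g (N + 1) z = R.snocMap (R.evalFirst g N) z := rfl
  rw [bar_eq, bar_eq, LinearMap.add_apply, LinearMap.add_apply, LinearMap.smul_apply,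
    LinearMap.smul_apply, map_add, map_smul, R.lowFaces_insertion_succ hg, h1, h2]
  rcases neg_one_pow_eq_or k n with hn | hn <;> rcases neg_one_pow_eq_or k N with hN | hN <;>
    simp only [pow_succ, pow_add, pow_mul, mul_add, add_mul, _root_.one_mul, _root_.mul_one, hn, hN,
      one_pow] <;> module

variable {g} in
/-- For cocycles `f` and `g`, the cochain `(w, b) ↦ g(w) f(b)` is cohomologous to the cochain
`(a, w) ↦ ± g(a₍₋₁₎ w) f(a₍₀₎)`. -/
theorem exists_homotopy (hg : g ∘ₗ R.bar n = 0) (N : ℕ) (f : R.tpow (N + 1) →ₗ[k] k)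
    (hf : f ∘ₗ R.bar (N + 1) = 0) : ∃ h : R.tpow (n + N) →ₗ[k] k, h ∘ₗ R.bar (n + N) =
      f ∘ₗ R.evalFirst g (N + 1) - (-1 : k) ^ (n * (N + 1)) • f ∘ₗ R.evalLast g (N + 1) := by
  -- Composing the homotopy formula with `f` makes its left side vanish; the primitive is read off
  -- from what is left.
  refine ⟨-((-1 : k) ^ (n + 1) • f ∘ₗ R.insertion g N), LinearMap.ext fun z => ?_⟩
  have h := congrArg f (R.bar_insertion hg N z)
  have h' := LinearMap.congr_fun hf (R.insertion g (N + 1) z)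
  rw [LinearMap.comp_apply, LinearMap.zero_apply, h] at h'
  simp only [map_add, map_sub, map_smul] at h'
  change -((-1 : k) ^ (n + 1) • f (R.insertion g N (R.bar (n + N) z))) =
    f (R.evalFirst g (N + 1) z) - (-1 : k) ^ (n * (N + 1)) • f (R.evalLast g (N + 1) z)
  rw [neg_eq_iff_add_eq_zero, ← h']
  module

end insertion

end YDBialgebra

/-! ### Descent of morphisms, naturality of the braiding, and transport of structure. -/

namespace YDModule

variable {k G : Type u} [Field k] [Ring G] [HopfAlgebra k G]

namespace IsHom

theorem codRestrict {U V : YDModule k G} {f : U →ₗ[k] V} (hf : IsHom U V f) {W : Submodule k V}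
    (hW : IsSub V W) (h : ∀ u, f u ∈ W) : IsHom U (sub V W hW) (f.codRestrict W h) where
  map_act g u := Subtype.ext (hf.map_act g u)
  map_coact u := by
    apply lTensor_injective W.subtype W.injective_subtype
    refine (subCoact_spec V W hW _).trans ?_
    rw [← LinearMap.lTensor_comp_apply, LinearMap.subtype_comp_codRestrict]
    exact hf.map_coact u

theorem of_comp_surjective {U V W : YDModule k G} {q : U →ₗ[k] V} (hq : IsHom U V q)
    (hs : Function.Surjective q) {f : V →ₗ[k] W} (hf : IsHom U W (f ∘ₗ q)) : IsHom V W f where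
  map_act g v := by
    obtain ⟨u, rfl⟩ := hs v
    rw [← hq.map_act]
    exact hf.map_act g u
  map_coact v := by
    obtain ⟨u, rfl⟩ := hs v
    rw [hq.map_coact, ← LinearMap.lTensor_comp_apply]
    exact hf.map_coact u

theorem map_braiding {V V' W W' : YDModule k G} {f : V →ₗ[k] V'} {g : W →ₗ[k] W'}
    (hf : IsHom V V' f) (hg : IsHom W W' g) (t : V ⊗[k] W) :
    braiding V' W' (TensorProduct.map f g t) = TensorProduct.map g f (braiding V W t) := by
  induction t using TensorProduct.induction_on with
  | zero => simp
  | add a b ha hb => simp only [map_add, ha, hb]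
  | tmul v w =>
    rw [TensorProduct.map_tmul, braiding, braiding, LinearMap.comp_apply, LinearMap.comp_apply,
      LinearMap.comp_apply, LinearMap.comp_apply, LinearMap.rTensor_tmul, LinearMap.rTensor_tmul,
      hf.map_coact]
    generalize V.coact v = p
    induction p with
    | zero => simp
    | add a b ha hb => simp only [TensorProduct.add_tmul, map_add, ha, hb]
    | tmul a v => simp [hg.map_act]

/-- Precomposition with a morphism is a morphism of duals. -/
theorem dualMap (hS : Function.Bijective (HopfAlgebra.antipode k : G →ₗ[k] G)) {V W : YDModule k G}
    (hV : FiniteDimensional k G ∨ FiniteDimensional k V)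
    (hW : FiniteDimensional k G ∨ FiniteDimensional k W) {b : W →ₗ[k] V} (hb : IsHom W V b) :
    IsHom (dual hS V hV) (dual hS W hW) (LinearMap.lcomp k k b) := by
  rw [isHom_dual_iff]
  have h := (dualInnerHom hS V hV).isHom_ev.comp (hb.lTensor (dual hS V hV))
  have e : TensorProduct.lift (LinearMap.lcomp k k b) =
      TensorProduct.lift (LinearMap.id : (V →ₗ[k] k) →ₗ[k] V →ₗ[k] k) ∘ₗ
        b.lTensor (V →ₗ[k] k) := by
    ext f w; simp
  rw [e]
  exact h

end IsHom

/-- Evaluating the braided flip of two linear forms: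
`(f₍₋₁₎ g)(w) f₍₀₎(v) = g(v₍₋₁₎ w) f(v₍₀₎)`. -/
theorem map_braiding_dual (hS : Function.Bijective (HopfAlgebra.antipode k : G →ₗ[k] G))
    {V W : YDModule k G} (hV : FiniteDimensional k G ∨ FiniteDimensional k V)
    (hW : FiniteDimensional k G ∨ FiniteDimensional k W) (f : V →ₗ[k] k) (g : W →ₗ[k] k)
    (v : V) (w : W) :
    LinearMap.mul' k k (TensorProduct.map (LinearMap.applyₗ v) (LinearMap.applyₗ w)
      (TensorProduct.comm k _ _ (braiding (dual hS V hV) (dual hS W hW) (f ⊗ₜ g)))) =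
    f (braidEval V W g w v) := by
  have e1 : ∀ t : G ⊗[k] (V →ₗ[k] k),
      LinearMap.mul' k k (TensorProduct.map (LinearMap.applyₗ v) (LinearMap.applyₗ w)
        (TensorProduct.comm k (W →ₗ[k] k) (V →ₗ[k] k) ((TensorProduct.lift
          (dualAct W).toLinearMap).rTensor _ (TensorProduct.rightComm k G _ _ (t ⊗ₜ g))))) =
      g (W.act (HopfAlgebra.antipode k (tmulEval V G t v)) w) := by
    intro t
    induction t with
    | zero => simp
    | add a b ha hb =>
      simp only [TensorProduct.add_tmul, map_add, LinearMap.add_apply, ha, hb]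
    | tmul a f => simp
  have e2 : ∀ p : G ⊗[k] V, g (W.act (TensorProduct.rid k G (f.lTensor G p)) w) =
      f (TensorProduct.lid k V ((g ∘ₗ W.act.toLinearMap.flip w).rTensor V p)) := by
    intro p
    induction p with
    | zero => simp
    | add a b ha hb => simp only [map_add, LinearMap.add_apply, ha, hb]
    | tmul a v => simp [mul_comm]
  refine (e1 (dualCoact hS V hV f)).trans ?_
  rw [antipode_tmulEval_dualCoact, coactEval_apply, e2, braidEval_apply]

end YDModule

/-- Transport of a graded algebra structure along isomorphisms of Yetter–Drinfeld modules. -/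
noncomputable def YDGradedAlgebra.transport {k G : Type u} [Field k] [Ring G] [HopfAlgebra k G]
    {A B : ℕ → YDModule k G} (S : YDGradedAlgebra B) (κ : ∀ n, A n ≃ₗ[k] B n)
    (hκ : ∀ n, IsHom (A n) (B n) (κ n).toLinearMap) : YDGradedAlgebra A where
  one := (κ 0).symm.toLinearMap ∘ₗ S.one
  mul m n N h := (κ N).symm.toLinearMap ∘ₗ S.mul m n N h ∘ₗ
    TensorProduct.map (κ m).toLinearMap (κ n).toLinearMap
  isHom_one := ((hκ 0).symm).comp S.isHom_one
  isHom_mul m n N h := ((hκ N).symm).comp ((S.isHom_mul m n N h).comp ((hκ m).tensorMap (hκ n)))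
  one_mul n h x := by simp [S.one_mul]
  mul_one n h x := by simp [S.mul_one]
  mul_assoc a b c ab bc N h₁ h₂ h₃ h₄ x y z := by
    simp [S.mul_assoc a b c ab bc N h₁ h₂ h₃ h₄]

/-- The braiding is natural with respect to the isomorphisms `κ`, by `IsHom.map_braiding`. -/
theorem YDGradedAlgebra.IsBraidedGradedCommutative.transport {k G : Type u} [Field k] [Ring G]
    [HopfAlgebra k G] {A B : ℕ → YDModule k G} {S : YDGradedAlgebra B}
    (hS : S.IsBraidedGradedCommutative) (κ : ∀ n, A n ≃ₗ[k] B n)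
    (hκ : ∀ n, IsHom (A n) (B n) (κ n).toLinearMap) :
    (S.transport κ hκ).IsBraidedGradedCommutative := by
  intro m n N h h'
  refine LinearMap.ext fun t => ?_
  have e := LinearMap.congr_fun (hS m n N h h')
    (TensorProduct.map (κ m).toLinearMap (κ n).toLinearMap t)
  simp only [gradedBraiding, LinearMap.comp_apply, LinearMap.smul_apply, map_smul,
    (hκ m).map_braiding (hκ n)] at e
  simp only [gradedBraiding, YDGradedAlgebra.transport, LinearMap.comp_apply,
    LinearMap.smul_apply, map_smul, ← e]

/-! ### The algebra structure on ordinary Hochschild cohomology -/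

namespace YDModule

/-- Translates the formulation used in `IsInducedStr` into the one of `antipode_tmulEval_dualCoact`.
-/
theorem rid_map_antipode_applyₗ {k G : Type u} [Field k] [Ring G] [HopfAlgebra k G]
    {U V : Type u} [AddCommGroup U] [Module k U] [AddCommGroup V] [Module k V]
    (j : U →ₗ[k] V →ₗ[k] k) (v : V) (t : G ⊗[k] U) :
    TensorProduct.rid k G (TensorProduct.map (HopfAlgebra.antipode k)
      (LinearMap.applyₗ v ∘ₗ j) t) =
    HopfAlgebra.antipode k (tmulEval V G (j.lTensor G t) v) := by
  induction t with
  | zero => simp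
  | add a b ha hb => simp only [map_add, LinearMap.add_apply, ha, hb]
  | tmul a f => simp

end YDModule

namespace YDBialgebra

variable {k G : Type u} [Field k] [Ring G] [HopfAlgebra k G] (R : YDBialgebra k G)

theorem finiteDimensional_tpow [FiniteDimensional k R.carrier] :
    ∀ n, FiniteDimensional k (R.tpow n)
  | 0 => inferInstanceAs (FiniteDimensional k k)
  | n + 1 =>
    have := finiteDimensional_tpow n
    inferInstanceAs (FiniteDimensional k (R.tpow n ⊗[k] R.carrier))

theorem finiteDimensional_or_tpow
    (hfin : FiniteDimensional k G ∨ FiniteDimensional k R.carrier) (n : ℕ) :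
    FiniteDimensional k G ∨ FiniteDimensional k (R.tpow n) :=
  hfin.imp_right fun (_ : FiniteDimensional k R.carrier) => R.finiteDimensional_tpow n

theorem bar_zero : R.bar 0 = 0 := by
  simp [bar_eq, lowFaces]

/-! #### The cup product of ordinary cochains -/

variable {R}

theorem OrdCochain.ext {n : ℕ} {f g : R.OrdCochain n} (h : ∀ z, f.toLin z = g.toLin z) : f = g :=
  LinearMap.ext h

theorem toLin_ordDiff {n : ℕ} (f : R.OrdCochain n) (z : R.tpow (n + 1)) :
    (R.ordDiff n f).toLin z = f.toLin (R.bar n z) := rfl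

theorem toLin_ordCup (m n N : ℕ) (h : m + n = N) (f : R.OrdCochain m) (g : R.OrdCochain n)
    (z : R.tpow N) : (R.ordCup m n N h f g).toLin z =
      LinearMap.mul' k k (TensorProduct.map f.toLin g.toLin (R.splitTo m n N h z)) := rfl

theorem mem_ordCocycles {n : ℕ} (f : R.OrdCochain n) :
    f ∈ R.OrdCocycles n ↔ R.ordDiff n f = 0 := Iff.rfl

theorem mem_ordCocycles_iff_comp {n : ℕ} (f : R.OrdCochain n) :
    f ∈ R.OrdCocycles n ↔ f.toLin ∘ₗ R.bar n = 0 := Iff.rfl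

theorem ordCls_eq_zero {n : ℕ} (f : R.OrdCocycles n) :
    R.ordCls n f = 0 ↔ f.1 ∈ R.ordBoundaries n :=
  Submodule.Quotient.mk_eq_zero _

theorem ordCls_surjective (n : ℕ) : Function.Surjective (R.ordCls n) := Submodule.mkQ_surjective _

/-- The Leibniz rule, dual to the coderivation property `splitTo_bar`. -/
theorem ordDiff_ordCup (m n N : ℕ) (h : m + n = N) (h₁ : m + 1 + n = N + 1)
    (h₂ : m + (n + 1) = N + 1) (f : R.OrdCochain m) (g : R.OrdCochain n) :
    R.ordDiff N (R.ordCup m n N h f g) = R.ordCup (m + 1) n (N + 1) h₁ (R.ordDiff m f) g +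
      (-1 : k) ^ m • R.ordCup m (n + 1) (N + 1) h₂ f (R.ordDiff n g) := by
  refine OrdCochain.ext fun z => ?_
  rw [map_add, map_smul, LinearMap.add_apply, LinearMap.smul_apply, toLin_ordDiff, toLin_ordCup,
    toLin_ordCup, toLin_ordCup, R.splitTo_bar m n N h h₁ h₂, map_add, map_smul, map_add, map_smul]
  congr 2
  · induction R.splitTo (m + 1) n (N + 1) h₁ z using TensorProduct.induction_on with
    | zero => simp
    | add a b ha hb => simp only [map_add, ha, hb]
    | tmul a b => simp [toLin_ordDiff]
  · induction R.splitTo m (n + 1) (N + 1) h₂ z using TensorProduct.induction_on with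
    | zero => simp
    | add a b ha hb => simp only [map_add, ha, hb]
    | tmul a b => simp [toLin_ordDiff]

theorem ordCup_assoc (a b c ab bc N : ℕ) (h₁ : a + b = ab) (h₂ : b + c = bc)
    (h₃ : ab + c = N) (h₄ : a + bc = N) (f : R.OrdCochain a) (g : R.OrdCochain b)
    (h : R.OrdCochain c) : R.ordCup ab c N h₃ (R.ordCup a b ab h₁ f g) h =
      R.ordCup a bc N h₄ f (R.ordCup b c bc h₂ g h) := by
  refine OrdCochain.ext fun z => ?_
  have e1 : ∀ t : R.tpow ab ⊗[k] R.tpow c,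
      LinearMap.mul' k k (TensorProduct.map (R.ordCup a b ab h₁ f g).toLin h.toLin t) =
      LinearMap.mul' k k (TensorProduct.map f.toLin
        (LinearMap.mul' k k ∘ₗ TensorProduct.map g.toLin h.toLin)
        (TensorProduct.assoc k _ _ _ ((R.splitTo a b ab h₁).rTensor _ t))) := by
    intro t
    induction t using TensorProduct.induction_on with
    | zero => simp
    | add a b ha hb => simp only [map_add, ha, hb]
    | tmul p q =>
      rw [TensorProduct.map_tmul, LinearMap.mul'_apply, toLin_ordCup, LinearMap.rTensor_tmul]
      induction R.splitTo a b ab h₁ p using TensorProduct.induction_on with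
      | zero => simp
      | add a b ha hb => simp only [TensorProduct.add_tmul, map_add, add_mul, ha, hb]
      | tmul p r => simp [_root_.mul_assoc]
  have e2 : ∀ t : R.tpow a ⊗[k] R.tpow bc, LinearMap.mul' k k (TensorProduct.map f.toLin
        (LinearMap.mul' k k ∘ₗ TensorProduct.map g.toLin h.toLin)
        ((R.splitTo b c bc h₂).lTensor _ t)) =
      LinearMap.mul' k k (TensorProduct.map f.toLin (R.ordCup b c bc h₂ g h).toLin t) := by
    intro t
    induction t using TensorProduct.induction_on with
    | zero => simp
    | add a b ha hb => simp only [map_add, ha, hb]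
    | tmul p q => simp [toLin_ordCup]
  rw [toLin_ordCup, toLin_ordCup, e1, R.splitTo_assoc a b c ab bc N h₁ h₂ h₃ h₄, e2]

variable (R) in
/-- The opposite cup product of cochains as a linear map. -/
noncomputable def ordCupOp (m n N : ℕ) (h : m + n = N) :
    R.OrdCochain m ⊗[k] R.OrdCochain n →ₗ[k] R.OrdCochain N :=
  TensorProduct.lift (LinearMap.mk₂ k
    (fun f g => R.ordCup n m N ((Nat.add_comm n m).trans h) g f)
    (fun _ _ _ => by simp [ordCup, TensorProduct.map_add_right, LinearMap.add_comp,
      LinearMap.comp_add])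
    (fun _ _ _ => by simp [ordCup, TensorProduct.map_smul_right, LinearMap.smul_comp,
      LinearMap.comp_smul])
    (fun _ _ _ => by simp [ordCup, TensorProduct.map_add_left, LinearMap.add_comp,
      LinearMap.comp_add])
    (fun _ _ _ => by simp [ordCup, TensorProduct.map_smul_left, LinearMap.smul_comp,
      LinearMap.comp_smul]))

theorem ordCupOp_tmul (m n N : ℕ) (h : m + n = N) (f : R.OrdCochain m) (g : R.OrdCochain n) :
    R.ordCupOp m n N h (f ⊗ₜ g) = R.ordCup n m N ((Nat.add_comm n m).trans h) g f := rfl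

/-- The braided flip of a pure tensor is in general not pure, so the product must be evaluated on
arbitrary tensors. -/
theorem toLin_ordCupOp (m n N : ℕ) (h : m + n = N) (t : R.OrdCochain m ⊗[k] R.OrdCochain n)
    (z : R.tpow N) : (R.ordCupOp m n N h t).toLin z =
      LinearMap.mul' k k (TensorProduct.homTensorHomMap (RingHom.id k) (R.tpow n) (R.tpow m) k k
        (TensorProduct.comm k (R.tpow m →ₗ[k] k) (R.tpow n →ₗ[k] k) t)
        (R.splitTo n m N ((Nat.add_comm n m).trans h) z)) := by
  induction t using TensorProduct.induction_on with
  | zero => rw [map_zero]; erw [map_zero, map_zero]; rfl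
  | add s t hs ht =>
    rw [map_add, map_add, LinearMap.add_apply, hs, ht]
    erw [map_add, map_add]
    rw [LinearMap.add_apply, map_add]
  | tmul f g => rfl

/-! #### Yetter–Drinfeld structures -/

section str

variable (hS : Function.Bijective (HopfAlgebra.antipode k : G →ₗ[k] G))
  (hfin : ∀ n, FiniteDimensional k G ∨ FiniteDimensional k (R.tpow n))

variable (R) in
/-- The Yetter–Drinfeld structure on ordinary cochains. -/
noncomputable abbrev ordCochainStr (n : ℕ) : YDStruct k G (R.OrdCochain n) :=
  (dual hS (R.tpow n) (hfin n)).str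

variable (R) in
/-- The Yetter–Drinfeld module of ordinary cochains. -/
noncomputable abbrev ordYD (n : ℕ) : YDModule k G :=
  ⟨R.OrdCochain n, R.ordCochainStr hS hfin n⟩

theorem isHom_ordYD_iff {X : YDModule k G} (n : ℕ) (ψ : X →ₗ[k] R.OrdCochain n) :
    IsHom X (R.ordYD hS hfin n) ψ ↔ IsHom (X.tensor (R.tpow n)) (unit k G)
      (TensorProduct.lift (OrdCochain.toLin.toLinearMap ∘ₗ ψ)) := by
  rw [← isHom_dual_iff hS (R.tpow n) (hfin n)]
  exact ⟨fun h => ⟨h.1, h.2⟩, fun h => ⟨h.1, h.2⟩⟩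

theorem isHom_ordDiff (n : ℕ) :
    IsHom (R.ordYD hS hfin n) (R.ordYD hS hfin (n + 1)) (R.ordDiff n) :=
  have h := IsHom.dualMap hS (hfin n) (hfin (n + 1)) (R.isHom_bar n)
  ⟨h.1, h.2⟩

variable (R) in
/-- Ordinary cochains are an inner hom object. -/
noncomputable abbrev ordInnerHom (n : ℕ) : InnerHom (R.tpow n) (unit k G) where
  obj := R.ordYD hS hfin n
  ev := TensorProduct.lift OrdCochain.toLin.toLinearMap
  isHom_ev := (isHom_ordYD_iff hS hfin (X := R.ordYD hS hfin n) n LinearMap.id).1 (IsHom.id _)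
  existsUnique X φ hφ := by
    have e (ψ : X →ₗ[k] R.OrdCochain n) : TensorProduct.lift OrdCochain.toLin.toLinearMap ∘ₗ
        ψ.rTensor (R.tpow n) = TensorProduct.lift (OrdCochain.toLin.toLinearMap ∘ₗ ψ) :=
      TensorProduct.ext' fun x v => by simp
    refine ⟨OrdCochain.toLin.symm.toLinearMap ∘ₗ TensorProduct.curry φ, ⟨?_, ?_⟩, ?_⟩
    · rw [isHom_ordYD_iff]
      convert hφ
      exact TensorProduct.ext' fun x v => rfl
    · exact TensorProduct.ext' fun x v => rfl
    · rintro ψ ⟨-, rfl⟩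
      exact LinearMap.ext fun x => OrdCochain.ext fun v => rfl

/-- By the adjunction it suffices that the uncurried product is a morphism, and it is `evalTwice`
after splitting the word. -/
theorem isHom_ordCupOp (m n N : ℕ) (h : m + n = N) :
    IsHom ((R.ordYD hS hfin m).tensor (R.ordYD hS hfin n)) (R.ordYD hS hfin N)
      (R.ordCupOp m n N h) := by
  rw [isHom_ordYD_iff]
  have h1 := (isHom_evalTwice (R.ordInnerHom hS hfin m) (R.ordInnerHom hS hfin n)).comp
    ((R.isHom_splitTo n m N ((Nat.add_comm n m).trans h)).lTensor
      ((R.ordYD hS hfin m).tensor (R.ordYD hS hfin n)))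
  refine (congrArg (IsHom _ _) ?_).mp h1
  refine TensorProduct.ext' fun t z => ?_
  rw [TensorProduct.lift.tmul, LinearMap.comp_apply, LinearMap.lTensor_tmul]
  induction t using TensorProduct.induction_on with
  | zero => simp only [TensorProduct.zero_tmul, map_zero, LinearMap.zero_apply]
  | add s t hs ht => simp only [TensorProduct.add_tmul, map_add, LinearMap.add_apply, hs, ht]
  | tmul f g =>
    change _ = LinearMap.mul' k k (TensorProduct.map g.toLin f.toLin (R.splitTo n m N _ z))
    induction R.splitTo n m N ((Nat.add_comm n m).trans h) z using TensorProduct.induction_on with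
    | zero => simp only [TensorProduct.tmul_zero, map_zero]
    | add a b ha hb => simp only [TensorProduct.tmul_add, map_add, ha, hb]
    | tmul a b =>
      -- Evaluating the inner factors first feeds the front word to `g`, hence the opposite order in
      -- the product.
      change f.toLin (g.toLin a • b) = g.toLin a * f.toLin b
      rw [map_smul, smul_eq_mul]

theorem isSub_ordBoundaries : ∀ n, IsSub (R.ordYD hS hfin n) (R.ordBoundaries n)
  | 0 => isSub_bot _
  | n + 1 => (isHom_ordDiff hS hfin n).isSub_range

variable (R) in
/-- The Yetter–Drinfeld module of ordinary cocycles. -/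
noncomputable abbrev ordCocyclesYD (n : ℕ) : YDModule k G :=
  (R.ordYD hS hfin n).sub (R.OrdCocycles n) (isHom_ordDiff hS hfin n).isSub_ker

variable (R) in
/-- The Yetter–Drinfeld structure on ordinary Hochschild cohomology. -/
noncomputable abbrev ordStr (n : ℕ) : YDStruct k G (R.OrdHH n) :=
  ((R.ordCocyclesYD hS hfin n).quot ((R.ordBoundaries n).comap (R.OrdCocycles n).subtype)
    ((isHom_ordDiff hS hfin n).isSub_ker.comap_subtype (isSub_ordBoundaries hS hfin n))).str

variable (R) in
/-- Ordinary Hochschild cohomology as a Yetter–Drinfeld module. -/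
noncomputable abbrev ordHHYD (n : ℕ) : YDModule k G := ⟨R.OrdHH n, R.ordStr hS hfin n⟩

theorem isHom_ordCls (n : ℕ) :
    IsHom (R.ordCocyclesYD hS hfin n) (R.ordHHYD hS hfin n) (R.ordCls n) :=
  ⟨fun _ _ => rfl, fun _ => rfl⟩

theorem isInducedStr_ordStr : R.IsInducedStr (R.ordStr hS hfin) := by
  refine ⟨fun n g f => ⟨(R.ordCocyclesYD hS hfin n).act g f, fun v => rfl, rfl⟩,
    fun n f => ⟨(R.ordCocyclesYD hS hfin n).coact f, fun v => ?_, rfl⟩⟩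
  have h : (OrdCochain.toLin.toLinearMap ∘ₗ (R.OrdCocycles n).subtype).lTensor G
      ((R.ordCocyclesYD hS hfin n).coact f) = dualCoact hS (R.tpow n) (hfin n) f.1.toLin :=
    subCoact_spec (R.ordYD hS hfin n) (R.OrdCocycles n) (isHom_ordDiff hS hfin n).isSub_ker f
  rw [rid_map_antipode_applyₗ, h, antipode_tmulEval_dualCoact, coactEval_apply]

end str

end YDBialgebra

/-! ### The opposite cup product on ordinary cohomology and its commutativity. -/

namespace YDBialgebra

variable {k G : Type u} [Field k] [Ring G] [HopfAlgebra k G] {R : YDBialgebra k G}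

theorem ordCup_mem_ordCocycles {m n N : ℕ} (h : m + n = N) {f : R.OrdCochain m}
    {g : R.OrdCochain n} (hf : f ∈ R.OrdCocycles m) (hg : g ∈ R.OrdCocycles n) :
    R.ordCup m n N h f g ∈ R.OrdCocycles N := by
  rw [mem_ordCocycles] at *
  rw [ordDiff_ordCup m n N h (by omega) (by omega), hf, hg, ← ordCupOp_tmul, ← ordCupOp_tmul,
    TensorProduct.tmul_zero, TensorProduct.zero_tmul, map_zero, map_zero, smul_zero, add_zero]
  all_goals omega

theorem ordCup_mem_ordBoundaries_left {m n N : ℕ} (h : m + n = N) {f : R.OrdCochain m}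
    {g : R.OrdCochain n} (hf : f ∈ R.ordBoundaries m) (hg : g ∈ R.OrdCocycles n) :
    R.ordCup m n N h f g ∈ R.ordBoundaries N := by
  cases m with
  | zero =>
    rw [show f = 0 from hf, ← ordCupOp_tmul n 0 N (by omega), TensorProduct.tmul_zero, map_zero]
    exact zero_mem _
  | succ m =>
    obtain ⟨f, rfl⟩ := hf
    rw [mem_ordCocycles] at hg
    obtain ⟨M, rfl⟩ : ∃ M, N = M + 1 := ⟨m + n, by omega⟩
    have e := ordDiff_ordCup m n M (by omega) h (by omega) f g
    rw [hg, ← ordCupOp_tmul (n + 1) m (M + 1) (by omega), TensorProduct.zero_tmul, map_zero,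
      smul_zero, add_zero] at e
    exact ⟨_, e⟩

theorem ordCup_mem_ordBoundaries_right {m n N : ℕ} (h : m + n = N) {f : R.OrdCochain m}
    {g : R.OrdCochain n} (hf : f ∈ R.OrdCocycles m) (hg : g ∈ R.ordBoundaries n) :
    R.ordCup m n N h f g ∈ R.ordBoundaries N := by
  cases n with
  | zero =>
    rw [show g = 0 from hg, ← ordCupOp_tmul 0 m N (by omega), TensorProduct.zero_tmul, map_zero]
    exact zero_mem _
  | succ n =>
    obtain ⟨g, rfl⟩ := hg
    rw [mem_ordCocycles] at hf
    obtain ⟨M, rfl⟩ : ∃ M, N = M + 1 := ⟨m + n, by omega⟩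
    have e := ordDiff_ordCup m n M (by omega) (by omega) h f g
    rw [hf, ← ordCupOp_tmul n (m + 1) (M + 1) (by omega), TensorProduct.tmul_zero, map_zero,
      zero_add] at e
    -- The Leibniz rule carries the sign `(-1) ^ m` on this term; it is its own inverse.
    refine ⟨(-1 : k) ^ m • R.ordCup m n M (by omega) f g, ?_⟩
    rw [map_smul, e, smul_smul, ← mul_pow, neg_one_mul, neg_neg, one_pow, one_smul]

variable (R) in
/-- The opposite cup product of cocycles. -/
noncomputable def ordCocyclesMul (m n N : ℕ) (h : m + n = N) :
    R.OrdCocycles m ⊗[k] R.OrdCocycles n →ₗ[k] R.OrdCocycles N :=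
  (R.ordCupOp m n N h ∘ₗ TensorProduct.map (R.OrdCocycles m).subtype
    (R.OrdCocycles n).subtype).codRestrict _ fun t => by
      induction t using TensorProduct.induction_on with
      | zero => rw [map_zero]; exact zero_mem _
      | add a b ha hb => rw [map_add]; exact add_mem ha hb
      | tmul f g => exact ordCup_mem_ordCocycles ((Nat.add_comm n m).trans h) g.2 f.2

theorem coe_ordCocyclesMul_tmul (m n N : ℕ) (h : m + n = N) (f : R.OrdCocycles m)
    (g : R.OrdCocycles n) : (R.ordCocyclesMul m n N h (f ⊗ₜ g)).1 =
      R.ordCup n m N ((Nat.add_comm n m).trans h) g.1 f.1 := rfl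

variable (R) in
/-- The opposite cup product on ordinary Hochschild cohomology. -/
noncomputable def ordMul (m n N : ℕ) (h : m + n = N) :
    R.OrdHH m ⊗[k] R.OrdHH n →ₗ[k] R.OrdHH N :=
  TensorProduct.lift (Submodule.liftQ _ (LinearMap.flip (Submodule.liftQ _ (LinearMap.flip
    (TensorProduct.curry (R.ordCls N ∘ₗ R.ordCocyclesMul m n N h)))
      (fun g hg => LinearMap.ext fun f => (ordCls_eq_zero _).2
        (ordCup_mem_ordBoundaries_left ((Nat.add_comm n m).trans h) hg f.2))))
    (fun f hf => LinearMap.ext fun y => by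
      obtain ⟨g, rfl⟩ := ordCls_surjective n y
      exact (ordCls_eq_zero _).2
        (ordCup_mem_ordBoundaries_right ((Nat.add_comm n m).trans h) g.2 hf)))

theorem ordMul_ordCls (m n N : ℕ) (h : m + n = N) (f : R.OrdCocycles m) (g : R.OrdCocycles n) :
    R.ordMul m n N h (R.ordCls m f ⊗ₜ R.ordCls n g) =
      R.ordCls N (R.ordCocyclesMul m n N h (f ⊗ₜ g)) := rfl

theorem ordMul_comp_map (m n N : ℕ) (h : m + n = N) :
    R.ordMul m n N h ∘ₗ TensorProduct.map (R.ordCls m) (R.ordCls n) =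
      R.ordCls N ∘ₗ R.ordCocyclesMul m n N h :=
  TensorProduct.ext' fun f g => ordMul_ordCls m n N h f g

variable (R) in
/-- The identity of `k` as an ordinary cocycle of degree zero. -/
def ordUnit : R.OrdCocycles 0 :=
  ⟨OrdCochain.toLin.symm LinearMap.id, by
    rw [mem_ordCocycles_iff_comp, R.bar_zero, LinearMap.comp_zero]⟩

theorem toLin_ordUnit (c : k) : (R.ordUnit).1.toLin c = c := rfl

section str

variable (hS : Function.Bijective (HopfAlgebra.antipode k : G →ₗ[k] G))
  (hfin : ∀ n, FiniteDimensional k G ∨ FiniteDimensional k (R.tpow n))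

theorem isHom_ordCocyclesMul (m n N : ℕ) (h : m + n = N) :
    IsHom ((R.ordCocyclesYD hS hfin m).tensor (R.ordCocyclesYD hS hfin n))
      (R.ordCocyclesYD hS hfin N) (R.ordCocyclesMul m n N h) :=
  ((isHom_ordCupOp hS hfin m n N h).comp
    ((isHom_subtype (R.ordYD hS hfin m) _ _).tensorMap
      (isHom_subtype (R.ordYD hS hfin n) _ _))).codRestrict _ _

theorem isHom_ordMul (m n N : ℕ) (h : m + n = N) :
    IsHom ((R.ordHHYD hS hfin m).tensor (R.ordHHYD hS hfin n)) (R.ordHHYD hS hfin N)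
      (R.ordMul m n N h) := by
  refine ((isHom_ordCls hS hfin m).tensorMap (isHom_ordCls hS hfin n)).of_comp_surjective
    (TensorProduct.map_surjective (ordCls_surjective m) (ordCls_surjective n)) ?_
  rw [ordMul_comp_map]
  exact (isHom_ordCls hS hfin N).comp (isHom_ordCocyclesMul hS hfin m n N h)

theorem isHom_ordUnit : IsHom (unit k G) (R.ordHHYD hS hfin 0)
    (LinearMap.toSpanSingleton k (R.OrdHH 0) (R.ordCls 0 R.ordUnit)) := by
  have h : IsHom (unit k G) (R.ordYD hS hfin 0)
      (LinearMap.toSpanSingleton k (R.OrdCochain 0) R.ordUnit.1) := by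
    rw [isHom_ordYD_iff]
    refine (congrArg (IsHom _ _) ?_).mp (IsHom.lid (unit k G))
    exact TensorProduct.ext' fun c d => rfl
  exact (isHom_ordCls hS hfin 0).comp (h.codRestrict (isHom_ordDiff hS hfin 0).isSub_ker
    fun c => Submodule.smul_mem (R.OrdCocycles 0) c R.ordUnit.2)

variable (R) in
/-- Ordinary Hochschild cohomology with the opposite cup product, as a graded algebra in the
category of Yetter–Drinfeld modules. -/
noncomputable def ordAlgebra : YDGradedAlgebra (R.ordHHYD hS hfin) where
  one := LinearMap.toSpanSingleton k (R.OrdHH 0) (R.ordCls 0 R.ordUnit)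
  mul := R.ordMul
  isHom_one := isHom_ordUnit hS hfin
  isHom_mul := isHom_ordMul hS hfin
  one_mul n h x := by
    obtain ⟨f, rfl⟩ := ordCls_surjective n x
    rw [LinearMap.toSpanSingleton_apply_one, ordMul_ordCls]
    refine congrArg (R.ordCls n) (Subtype.ext (OrdCochain.ext fun z => ?_))
    -- The product is the opposite one, so the left unit is evaluated on an empty word at the end.
    rw [coe_ordCocyclesMul_tmul, toLin_ordCup, R.splitTo_zero_right]
    exact _root_.mul_one (f.1.toLin z)
  mul_one n h x := by
    obtain ⟨f, rfl⟩ := ordCls_surjective n x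
    rw [LinearMap.toSpanSingleton_apply_one, ordMul_ordCls]
    refine congrArg (R.ordCls n) (Subtype.ext (OrdCochain.ext fun z => ?_))
    rw [coe_ordCocyclesMul_tmul, toLin_ordCup, R.splitTo_zero_left]
    exact _root_.one_mul (f.1.toLin z)
  mul_assoc a b c ab bc N h₁ h₂ h₃ h₄ x y z := by
    obtain ⟨f, rfl⟩ := ordCls_surjective a x
    obtain ⟨g, rfl⟩ := ordCls_surjective b y
    obtain ⟨h, rfl⟩ := ordCls_surjective c z
    simp only [ordMul_ordCls]
    refine congrArg (R.ordCls N) (Subtype.ext ?_)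
    simp only [coe_ordCocyclesMul_tmul]
    exact (ordCup_assoc _ _ _ _ _ _ _ _ _ _ _ _ _).symm

theorem isOppositeCup_ordAlgebra :
    R.IsOppositeCup (R.ordStr hS hfin) (R.ordAlgebra hS hfin) :=
  ⟨⟨R.ordUnit, toLin_ordUnit, LinearMap.toSpanSingleton_apply_one ..⟩,
    fun m n N h f g => ⟨_, rfl, ordMul_ordCls m n N h f g⟩⟩

/-- By `map_braiding_dual`, flipping cochains amounts to letting `v₍₋₁₎` act on `w` before
evaluation. The result is `f` composed with `evalLast`. -/
theorem toLin_ordCupOp_braiding (m n N : ℕ) (h : n + m = N) (f : R.OrdCochain m)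
    (g : R.OrdCochain n) (z : R.tpow N) :
    (R.ordCupOp n m N h (braiding (R.ordYD hS hfin m) (R.ordYD hS hfin n) (f ⊗ₜ g))).toLin z =
      f.toLin (TensorProduct.lift (braidEval (R.tpow m) (R.tpow n) g.toLin).flip
        (R.splitTo m n N ((Nat.add_comm m n).trans h) z)) := by
  rw [toLin_ordCupOp]
  induction R.splitTo m n N ((Nat.add_comm m n).trans h) z using TensorProduct.induction_on with
  | zero => simp only [map_zero]
  | add a b ha hb => simp only [map_add, ha, hb]
  | tmul v w =>
    refine Eq.trans ?_ (map_braiding_dual hS (hfin m) (hfin n) f.toLin g.toLin v w)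
    have e (t : (R.tpow m →ₗ[k] k) ⊗[k] (R.tpow n →ₗ[k] k)) :
        LinearMap.mul' k k (TensorProduct.homTensorHomMap (RingHom.id k) (R.tpow m) (R.tpow n) k k t
          (v ⊗ₜ w)) =
        LinearMap.mul' k k (TensorProduct.map (LinearMap.applyₗ v) (LinearMap.applyₗ w) t) := by
      induction t using TensorProduct.induction_on with
      | zero => simp
      | add a b ha hb => simp only [map_add, LinearMap.add_apply, ha, hb]
      | tmul a b => simp
    exact e _

/-- The two products are `f` composed with `evalFirst` and with `evalLast`, which the homotopy
formula compares. -/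
theorem ordCup_sub_braiding_mem_ordBoundaries {m n : ℕ} {f : R.OrdCochain m} {g : R.OrdCochain n}
    (hf : f ∈ R.OrdCocycles m) (hg : g ∈ R.OrdCocycles n) :
    R.ordCup n m (n + m) rfl g f - (-1 : k) ^ (m * n) • R.ordCupOp n m (n + m) rfl
      (braiding (R.ordYD hS hfin m) (R.ordYD hS hfin n) (f ⊗ₜ g)) ∈ R.ordBoundaries (n + m) := by
  have e1 (z : R.tpow (n + m)) :
      (R.ordCup n m (n + m) rfl g f).toLin z = f.toLin (R.evalFirst g.toLin m z) := by
    rw [toLin_ordCup, R.evalFirst_eq]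
    induction R.splitTo n m (n + m) rfl z using TensorProduct.induction_on with
    | zero => simp only [map_zero]
    | add a b ha hb => simp only [map_add, ha, hb]
    | tmul a b => simp
  have e2 (z : R.tpow (n + m)) := toLin_ordCupOp_braiding hS hfin m n (n + m) rfl f g z
  have e3 (z : R.tpow (n + m)) : (R.ordCup n m (n + m) rfl g f - (-1 : k) ^ (m * n) •
      R.ordCupOp n m (n + m) rfl (braiding (R.ordYD hS hfin m) (R.ordYD hS hfin n)
        (f ⊗ₜ g))).toLin z =
      f.toLin (R.evalFirst g.toLin m z) - (-1 : k) ^ (m * n) • f.toLin (R.evalLast g.toLin m z) := by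
    rw [map_sub, map_smul, LinearMap.sub_apply, LinearMap.smul_apply, e1, e2]
    rfl
  -- The homotopy formula needs `f` of positive degree. In degree zero the two cochains already
  -- coincide, by `evalLast_zero`.
  cases m with
  | zero =>
    refine (congrArg (· ∈ R.ordBoundaries n) (OrdCochain.ext fun z => ?_)).mp
      (zero_mem (R.ordBoundaries n))
    refine Eq.symm ((e3 z).trans ?_)
    rw [R.evalLast_zero, Nat.zero_mul, pow_zero, one_smul, sub_self]
    rfl
  | succ M =>
    obtain ⟨h, hh⟩ := R.exists_homotopy hg M f.toLin hf
    refine ⟨(OrdCochain.toLin (R := R) (n := n + M)).symm h, OrdCochain.ext fun z => ?_⟩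
    rw [e3, Nat.mul_comm (M + 1) n]
    exact LinearMap.congr_fun hh z

/-- Classes lift to cocycles, and the braiding is natural both for the quotient map and for the
inclusion of cocycles into cochains, so the cochain statement suffices. -/
theorem isBraidedGradedCommutative_ordAlgebra :
    (R.ordAlgebra hS hfin).IsBraidedGradedCommutative := by
  intro m n N h h'
  subst h'
  refine TensorProduct.ext' fun x y => ?_
  obtain ⟨f, rfl⟩ := ordCls_surjective m x
  obtain ⟨g, rfl⟩ := ordCls_surjective n y
  have e1 := (isHom_ordCls hS hfin m).map_braiding (isHom_ordCls hS hfin n) (f ⊗ₜ g)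
  have e2 := LinearMap.congr_fun (ordMul_comp_map (R := R) n m (n + m) rfl)
    (braiding (R.ordCocyclesYD hS hfin m) (R.ordCocyclesYD hS hfin n) (f ⊗ₜ g))
  have e3 := (isHom_subtype (R.ordYD hS hfin m) (R.OrdCocycles m)
    (isHom_ordDiff hS hfin m).isSub_ker).map_braiding (isHom_subtype (R.ordYD hS hfin n)
      (R.OrdCocycles n) (isHom_ordDiff hS hfin n).isSub_ker) (f ⊗ₜ g)
  -- The intermediate term is the class obtained by braiding already at the level of cocycles.
  refine Eq.trans (b := (-1 : k) ^ (m * n) • R.ordCls (n + m) (R.ordCocyclesMul n m (n + m) rfl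
    (braiding (R.ordCocyclesYD hS hfin m) (R.ordCocyclesYD hS hfin n) (f ⊗ₜ g)))) ?_ ?_
  · refine Eq.trans ?_ (congrArg ((-1 : k) ^ (m * n) • ·) e2)
    refine Eq.trans ?_ (congrArg (fun t => (-1 : k) ^ (m * n) • R.ordMul n m (n + m) rfl t) e1)
    exact map_smul (R.ordMul n m (n + m) rfl) _ _
  · refine Eq.trans ?_ (ordMul_ordCls m n (n + m) h f g).symm
    rw [← map_smul, eq_comm, ← sub_eq_zero, ← map_sub, ordCls_eq_zero]
    refine (congrArg (· ∈ R.ordBoundaries (n + m)) ?_).mp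
      (ordCup_sub_braiding_mem_ordBoundaries hS hfin f.2 g.2)
    exact congrArg (fun t => R.ordCup n m (n + m) rfl g.1 f.1 - (-1 : k) ^ (m * n) •
      R.ordCupOp n m (n + m) rfl t) e3

end str

end YDBialgebra

/-! ### Comparison with ordinary Hochschild cohomology -/

namespace YDBialgebra

variable {k G : Type u} [Field k] [Ring G] [HopfAlgebra k G] {R : YDBialgebra k G}

section comparison

variable (hS : Function.Bijective (HopfAlgebra.antipode k : G →ₗ[k] G))
  (hfin : ∀ n, FiniteDimensional k G ∨ FiniteDimensional k (R.tpow n)) (E : R.HomObjects)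

/-- The map `z ↦ ev(z ⊗ -)` from an inner hom object to ordinary cochains. -/
noncomputable def toOrd (n : ℕ) : (E n).obj ≃ₗ[k] R.OrdCochain n :=
  LinearEquiv.ofBijective (TensorProduct.curry (E n).ev) ((E n).curry_ev_bijective hS (hfin n)) ≪≫ₗ
    OrdCochain.toLin.symm

theorem toLin_toOrd (n : ℕ) (z : (E n).obj) (v : R.tpow n) :
    (toOrd hS hfin E n z).toLin v = (E n).ev (z ⊗ₜ v) := rfl

theorem isHom_toOrd (n : ℕ) :
    IsHom (E n).obj (R.ordYD hS hfin n) (toOrd hS hfin E n).toLinearMap :=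
  have h := (E n).isHom_curry_ev hS (hfin n)
  ⟨h.1, h.2⟩

/-- The differential of inner hom objects is characterized by its evaluation, which is evaluation
along the bar differential. -/
theorem toOrd_diff (n : ℕ) (z : (E n).obj) :
    toOrd hS hfin E (n + 1) (diff E n z) = R.ordDiff n (toOrd hS hfin E n z) :=
  OrdCochain.ext fun v => (E (n + 1)).ev_curry_tmul _ _ z v

theorem toOrd_cup (m n N : ℕ) (h : m + n = N) (x : (E m).obj) (y : (E n).obj) :
    toOrd hS hfin E N (cup E m n N h (x ⊗ₜ y)) = R.ordCup n m N ((Nat.add_comm n m).trans h)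
      (toOrd hS hfin E n y) (toOrd hS hfin E m x) := by
  refine OrdCochain.ext fun z => ?_
  rw [toLin_toOrd, toLin_ordCup]
  refine ((E N).ev_curry_tmul (X := (E m).obj.tensor (E n).obj) _ _ (x ⊗ₜ y) z).trans ?_
  rw [LinearMap.comp_apply, LinearMap.lTensor_tmul]
  induction R.splitTo n m N ((Nat.add_comm n m).trans h) z using TensorProduct.induction_on with
  | zero => simp only [TensorProduct.tmul_zero, map_zero]
  | add a b ha hb => simp only [TensorProduct.tmul_add, map_add, ha, hb]
  | tmul a b =>
    simp [evalTwice, toLin_toOrd]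

theorem toOrd_unitCochain : toOrd hS hfin E 0 (unitCochain E 1) = R.ordUnit.1 :=
  OrdCochain.ext fun z => ((E 0).ev_curry_tmul (X := unit k G) _ (IsHom.lid (unit k G)) (1 : k)
    z).trans (_root_.one_mul (M := k) z)

theorem map_toOrd_ker (n : ℕ) : (LinearMap.ker (diff E n)).map (toOrd hS hfin E n).toLinearMap =
    R.OrdCocycles n := by
  ext f
  rw [Submodule.mem_map_equiv, LinearMap.mem_ker, mem_ordCocycles]
  rw [← (toOrd hS hfin E (n + 1)).map_eq_zero_iff, toOrd_diff, LinearEquiv.apply_symm_apply]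

theorem map_toOrd_boundaries : ∀ n, (boundaries E n).map (toOrd hS hfin E n).toLinearMap =
    R.ordBoundaries n
  | 0 => Submodule.map_bot _
  | n + 1 => by
    have e : (toOrd hS hfin E (n + 1)).toLinearMap ∘ₗ diff E n =
      R.ordDiff n ∘ₗ (toOrd hS hfin E n).toLinearMap := LinearMap.ext (toOrd_diff hS hfin E n)
    change (LinearMap.range (diff E n)).map _ = LinearMap.range (R.ordDiff n)
    rw [← LinearMap.range_comp, e, LinearMap.range_comp, LinearEquiv.range, Submodule.map_top]

/-- The isomorphism of cocycles induced by `toOrd`. -/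
noncomputable def cocyclesEquiv (n : ℕ) : cocycles E n ≃ₗ[k] R.OrdCocycles n :=
  (toOrd hS hfin E n).ofSubmodules _ _ (map_toOrd_ker hS hfin E n)

theorem coe_cocyclesEquiv (n : ℕ) (z : cocycles E n) :
    (cocyclesEquiv hS hfin E n z).1 = toOrd hS hfin E n z.1 := rfl

/-- The isomorphism in cohomology induced by `z ↦ ev(z ⊗ -)`. -/
noncomputable def comparison (n : ℕ) : HH E n ≃ₗ[k] R.OrdHH n :=
  Submodule.Quotient.equiv _ _ (cocyclesEquiv hS hfin E n) (by
    ext f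
    rw [Submodule.mem_map_equiv, Submodule.mem_comap, Submodule.mem_comap,
      ← map_toOrd_boundaries hS hfin E, Submodule.mem_map_equiv]
    rfl)

theorem comparison_cls (n : ℕ) (z : cocycles E n) :
    comparison hS hfin E n (cls E n z) = R.ordCls n (cocyclesEquiv hS hfin E n z) := rfl

theorem cls_surjective (n : ℕ) : Function.Surjective (cls E n) := Submodule.mkQ_surjective _

theorem isHom_cocyclesEquiv (n : ℕ) : IsHom (cocycles E n) (R.ordCocyclesYD hS hfin n)
    (cocyclesEquiv hS hfin E n).toLinearMap :=
  ((isHom_toOrd hS hfin E n).comp (isHom_subtype (E n).obj _ (isHom_diff E n).isSub_ker)).codRestrict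
    (isHom_ordDiff hS hfin n).isSub_ker fun z => (cocyclesEquiv hS hfin E n z).2

theorem isHom_comparison (n : ℕ) :
    IsHom (HH E n) (R.ordHHYD hS hfin n) (comparison hS hfin E n).toLinearMap :=
  (isHom_mkQ (cocycles E n) _ _).of_comp_surjective (cls_surjective E n)
    ((isHom_ordCls hS hfin n).comp (isHom_cocyclesEquiv hS hfin E n))

theorem comparison_eq_iff {n : ℕ} {x : HH E n} {z : cocycles E n} :
    x = cls E n z ↔ comparison hS hfin E n x = R.ordCls n (cocyclesEquiv hS hfin E n z) := by
  rw [← comparison_cls, (comparison hS hfin E n).injective.eq_iff]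

/-- Hochschild cohomology in the category of Yetter–Drinfeld modules as a graded algebra. -/
noncomputable def cupAlgebra : YDGradedAlgebra (HH E) :=
  (R.ordAlgebra hS hfin).transport (comparison hS hfin E) (isHom_comparison hS hfin E)

theorem cocyclesEquiv_unit {z : cocycles E 0} (hz : (z : (E 0).obj) = unitCochain E 1) :
    cocyclesEquiv hS hfin E 0 z = R.ordUnit :=
  Subtype.ext (by rw [coe_cocyclesEquiv, hz, toOrd_unitCochain])

theorem cocyclesEquiv_cup {m n N : ℕ} (h : m + n = N) {x : cocycles E m} {y : cocycles E n}
    {z : cocycles E N} (hz : (z : (E N).obj) = cup E m n N h ((x : (E m).obj) ⊗ₜ (y : (E n).obj))) :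
    cocyclesEquiv hS hfin E N z = R.ordCocyclesMul m n N h
      (cocyclesEquiv hS hfin E m x ⊗ₜ cocyclesEquiv hS hfin E n y) :=
  Subtype.ext (by
    rw [coe_cocyclesEquiv, hz, toOrd_cup, coe_ordCocyclesMul_tmul]
    rfl)

theorem isCupAlgebra_cupAlgebra : IsCupAlgebra E (cupAlgebra hS hfin E) := by
  refine ⟨?_, fun m n N h x y => ?_⟩
  · obtain ⟨z, hz⟩ := (cocyclesEquiv hS hfin E 0).surjective R.ordUnit
    refine ⟨z, (toOrd hS hfin E 0).injective ?_, (comparison_eq_iff hS hfin E).2 ?_⟩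
    · rw [toOrd_unitCochain, ← hz]; rfl
    · rw [hz]
      refine ((comparison hS hfin E 0).apply_symm_apply _).trans ?_
      exact LinearMap.toSpanSingleton_apply_one ..
  · obtain ⟨z, hz⟩ := (cocyclesEquiv hS hfin E N).surjective (R.ordCocyclesMul m n N h
      (cocyclesEquiv hS hfin E m x ⊗ₜ cocyclesEquiv hS hfin E n y))
    refine ⟨z, (toOrd hS hfin E N).injective ?_, (comparison_eq_iff hS hfin E).2 ?_⟩
    · rw [toOrd_cup, ← coe_cocyclesEquiv, hz]; rfl
    · rw [hz]
      exact (comparison hS hfin E N).apply_symm_apply _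

/-- `IsCupAlgebra` prescribes the unit and all products of classes of cocycles, and these classes
exhaust the cohomology. Hence the argument applies to every such `A`, not only to the transported
algebra. -/
theorem isComparisonIso_comparison {A : YDGradedAlgebra (HH E)} (hA : IsCupAlgebra E A) :
    R.IsComparisonIso E A (R.ordStr hS hfin) (R.ordAlgebra hS hfin) (comparison hS hfin E) := by
  refine ⟨fun n z => ⟨cocyclesEquiv hS hfin E n z, fun v => rfl, comparison_cls hS hfin E n z⟩,
    isHom_comparison hS hfin E, ?_, fun m n N h x y => ?_⟩
  · obtain ⟨z, hz, h1⟩ := hA.1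
    rw [h1, comparison_cls, cocyclesEquiv_unit hS hfin E hz]
    exact (LinearMap.toSpanSingleton_apply_one ..).symm
  · obtain ⟨x, rfl⟩ := cls_surjective E m x
    obtain ⟨y, rfl⟩ := cls_surjective E n y
    obtain ⟨z, hz, h1⟩ := hA.2 m n N h x y
    rw [h1, comparison_cls, cocyclesEquiv_cup hS hfin E h hz]
    rfl

end comparison

end YDBialgebra

/-! ### The main theorem. -/

theorem mainTheorem6 {k G : Type u} [Field k] [Ring G] [HopfAlgebra k G]
    (hS : Function.Bijective (HopfAlgebra.antipode k : G →ₗ[k] G))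
    (R : YDBialgebra k G)
    (hfin : FiniteDimensional k G ∨ FiniteDimensional k R.carrier) :
    Nonempty R.HomObjects ∧
    (∀ E : R.HomObjects, ∃ A : YDGradedAlgebra (YDBialgebra.HH E),
      YDBialgebra.IsCupAlgebra E A ∧ A.IsBraidedGradedCommutative) ∧
    (∃ (D : ∀ n, YDStruct k G (R.OrdHH n))
      (B : YDGradedAlgebra (fun n => (⟨R.OrdHH n, D n⟩ : YDModule k G))),
      R.IsInducedStr D ∧ R.IsOppositeCup D B ∧ B.IsBraidedGradedCommutative ∧
      ∀ (E : R.HomObjects) (A : YDGradedAlgebra (YDBialgebra.HH E)),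
        YDBialgebra.IsCupAlgebra E A → ∃ κ : ∀ n, YDBialgebra.HH E n ≃ₗ[k] R.OrdHH n,
          R.IsComparisonIso E A D B κ) := by
  have hfin := R.finiteDimensional_or_tpow hfin
  have hB := YDBialgebra.isBraidedGradedCommutative_ordAlgebra (R := R) hS hfin
  -- Ordinary cochains witness the existence of inner hom objects. Commutativity for an arbitrary
  -- choice `E` is transported from ordinary cohomology.
  exact ⟨⟨R.ordInnerHom hS hfin⟩,
    fun E => ⟨YDBialgebra.cupAlgebra hS hfin E, YDBialgebra.isCupAlgebra_cupAlgebra hS hfin E,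
      hB.transport _ _⟩,
    R.ordStr hS hfin, R.ordAlgebra hS hfin, YDBialgebra.isInducedStr_ordStr hS hfin,
    YDBialgebra.isOppositeCup_ordAlgebra hS hfin, hB,
    fun E A hA => ⟨YDBialgebra.comparison hS hfin E,
      YDBialgebra.isComparisonIso_comparison hS hfin E hA⟩⟩
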